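/- Let $p \ge 2$ be an integer. For an integer $k\ge 0$ let $H^k(\mathbb S^1)$ be the periodic Sobolev space of real functions $u$ on $[0,2\pi]$ whose (weak) derivatives up to order $k$ lie in $L^2([0,2\pi])$ and which satisfy $u^{(j)}(0)=u^{(j)}(2\pi)$ for $0\le j<k$, with its usual Hilbert space structure. Let $F: H^p(\mathbb S^1)\to H^{p-2}(\mathbb S^1)$ be given by $F(u)=-u''+u^2/2$, and let $C\subset H^p(\mathbb S^1)$ be the critical set of $F$, i.e. the set of $u$ for which the derivative $DF(u):H^p(\mathbb S^1)\to H^{p-2}(\mathbb S^1)$ is not surjective. Let $\mathbb H$ be a real infinite-dimensional separable Hilbert space. Let $\Pi: G\to SL(2,\mathbb R)$ be the universal cover of $SL(2,\mathbb R)$, with identity $I \in G$, and let $\phi_L:\mathbb R\times(0,\infty)\times\mathbb R\to G$ be the diffeomorphism (left Iwasawa decomposition) determined by $\phi_L(0,1,0)=I$ and $$(\Pi\circ\phi_L)(\theta,\rho,\nu)=\begin{pmatrix}\cos\theta&\sin\theta\\-\sin\theta&\cos\theta\end{pmatrix}\begin{pmatrix}\sqrt\rho&0\\0&1/\sqrt\rho\end{pmatrix}\begin{pmatrix}1&0\\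 \nu/2&1\end{pmatrix}.$$ Set $G_0=\phi_L((0,\infty)\times(0,\infty)\times\mathbb R)$, an open subset of $G$, and $T_2=\{g\in G:\operatorname{tr}\Pi(g)=2\}$. Let $\Sigma=\bigcup_{n\ge0}\Sigma_n\subset\mathbb R^3$, where $\Sigma_0$ is the plane $z=0$ and, for $n>0$, $\Sigma_n$ is the cone $x^2+y^2=\tan^2 z$, $2\pi n-\frac{\pi}{2}<z<2\pi n+\frac{\pi}{2}$. Then the pair $(H^p(\mathbb S^1),C)$ is diffeomorphic to $(G_0,T_2\cap G_0)\times\mathbb H$, and also to $(\mathbb R^3,\Sigma)\times\mathbb H$. That is, there are $C^\infty$ diffeomorphisms $\Psi: G_0\times\mathbb H\to H^p(\mathbb S^1)$ with $\Psi((T_2\cap G_0)\times\mathbb H)=C$ and $\tilde\Psi:\mathbb R^3\times\mathbb H\to H^p(\mathbb S^1)$ with $\tilde\Psi(\Sigma\times\mathbb H)=C$. -/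

import Mathlib

open MeasureTheory Set Topology
open scoped Manifold ContDiff

noncomputable section

/-! ### Periodic Sobolev spaces -/

/-- Lebesgue measure on `[0, 2π]`. -/
abbrev circleMeasure : Measure ℝ := volume.restrict (Icc 0 (2 * Real.pi))

/-- The real Hilbert space `H⁰ = L²([0, 2π])`. -/
abbrev L2Circle : Type := Lp ℝ 2 circleMeasure

/-- `f` has an absolutely continuous representative `w` on `[0, 2π]` which satisfies
`w(0) = w(2π)` and whose derivative is `g`. -/
def HasPeriodicDeriv (f g : ℝ → ℝ) : Prop :=
  ∃ w : ℝ → ℝ, AbsolutelyContinuousOnInterval w 0 (2 * Real.pi) ∧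
    w 0 = w (2 * Real.pi) ∧ f =ᵐ[circleMeasure] w ∧
    ∀ᵐ t ∂circleMeasure, HasDerivAt w (g t) t

theorem HasPeriodicDeriv.congr {f f' g g' : ℝ → ℝ} (h : HasPeriodicDeriv f g)
    (hf : f' =ᵐ[circleMeasure] f) (hg : g' =ᵐ[circleMeasure] g) : HasPeriodicDeriv f' g' := by
  obtain ⟨w, h1, h2, h3, h4⟩ := h
  refine ⟨w, h1, h2, hf.trans h3, ?_⟩
  filter_upwards [h4, hg] with t ht hgt
  rwa [hgt]

theorem HasPeriodicDeriv.add {f f' g g' : ℝ → ℝ} (h : HasPeriodicDeriv f g)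
    (h' : HasPeriodicDeriv f' g') :
    HasPeriodicDeriv (fun t => f t + f' t) (fun t => g t + g' t) := by
  obtain ⟨w, h1, h2, h3, h4⟩ := h
  obtain ⟨w', h1', h2', h3', h4'⟩ := h'
  refine ⟨fun t => w t + w' t, h1.add h1', by simp only [h2, h2'], ?_, ?_⟩
  · filter_upwards [h3, h3'] with t ht ht'
    rw [ht, ht']
  · filter_upwards [h4, h4'] with t ht ht'
    exact ht.add ht'

theorem HasPeriodicDeriv.const_mul {f g : ℝ → ℝ} (c : ℝ) (h : HasPeriodicDeriv f g) :
    HasPeriodicDeriv (fun t => c * f t) (fun t => c * g t) := by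
  obtain ⟨w, h1, h2, h3, h4⟩ := h
  refine ⟨fun t => c * w t, h1.const_mul c, by simp only [h2], ?_, ?_⟩
  · filter_upwards [h3] with t ht
    rw [ht]
  · filter_upwards [h4] with t ht
    exact ht.const_mul c

theorem HasPeriodicDeriv.mul {f f' g g' : ℝ → ℝ} (h : HasPeriodicDeriv f g)
    (h' : HasPeriodicDeriv f' g') :
    HasPeriodicDeriv (fun t => f t * f' t) (fun t => g t * f' t + f t * g' t) := by
  obtain ⟨w, h1, h2, h3, h4⟩ := h
  obtain ⟨w', h1', h2', h3', h4'⟩ := h'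
  refine ⟨fun t => w t * w' t, h1.fun_mul h1', by simp only [h2, h2'], ?_, ?_⟩
  · filter_upwards [h3, h3'] with t ht ht'
    rw [ht, ht']
  · filter_upwards [h4, h4', h3, h3'] with t ht ht' e e'
    rw [e, e']
    exact ht.mul ht'

theorem HasPeriodicDeriv.bounded {f g : ℝ → ℝ} (h : HasPeriodicDeriv f g) :
    ∃ w : ℝ → ℝ, MemLp w ⊤ circleMeasure ∧ f =ᵐ[circleMeasure] w := by
  obtain ⟨w, h1, -, h3, -⟩ := h
  have hc : ContinuousOn w (Icc 0 (2 * Real.pi)) := by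
    have := h1.continuousOn
    rwa [uIcc_of_le (by positivity)] at this
  obtain ⟨C, hC⟩ := isCompact_Icc.exists_bound_of_continuousOn hc
  refine ⟨w, memLp_top_of_bound (hc.aestronglyMeasurable measurableSet_Icc) C ?_, h3⟩
  filter_upwards [ae_restrict_mem measurableSet_Icc] with t ht using hC t ht

/-- The Sobolev space `H^p(𝕊¹)`: functions on `[0, 2π]` with derivatives up to order `p` in `L²`
such that `u^(j)(0) = u^(j)(2π)` for `j < p`. An element is recorded as the tuple
`(u, u', …, u^(p))`, so that the norm is `(∑_{j ≤ p} ‖u^(j)‖²)^{1/2}`. -/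
def periodicSobolev (p : ℕ) : Submodule ℝ (PiLp 2 fun _ : Fin (p + 1) => L2Circle) where
  carrier := {u | ∀ j : Fin p, HasPeriodicDeriv (u j.castSucc) (u j.succ)}
  zero_mem' := fun j => by
    refine HasPeriodicDeriv.congr (f := fun _ => 0) (g := fun _ => 0) ?_
      (Lp.coeFn_zero ℝ 2 circleMeasure) (Lp.coeFn_zero ℝ 2 circleMeasure)
    exact ⟨fun _ => 0, (LipschitzWith.const (0 : ℝ)).lipschitzOnWith.absolutelyContinuousOnInterval,
      rfl, ae_eq_rfl, Filter.Eventually.of_forall fun t => hasDerivAt_const t (0 : ℝ)⟩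
  add_mem' := fun {u v} hu hv j =>
    ((hu j).add (hv j)).congr (Lp.coeFn_add _ _) (Lp.coeFn_add _ _)
  smul_mem' := fun c u hu j =>
    ((hu j).const_mul c).congr (Lp.coeFn_smul _ _) (Lp.coeFn_smul _ _)

/-- `H^p(𝕊¹)` as a type. -/
abbrev Hper (p : ℕ) : Type := periodicSobolev p

/-- The derivative `u^(j)` of `u ∈ H^p(𝕊¹)`, for `j ≤ p`. -/
def Hper.der {p : ℕ} (u : Hper p) (j : Fin (p + 1)) : L2Circle := u.1 j

/-- The function `f` represents an element of `H^n(𝕊¹)`. -/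
def MemHper : ℕ → (ℝ → ℝ) → Prop
  | 0, f => MemLp f 2 circleMeasure
  | n + 1, f => ∃ g, HasPeriodicDeriv f g ∧ MemHper n g

theorem MemHper.pred {n : ℕ} : ∀ {f : ℝ → ℝ}, MemHper (n + 1) f → MemHper n f := by
  induction n with
  | zero =>
    rintro f ⟨g, h, -⟩
    obtain ⟨w, hw, hf⟩ := h.bounded
    exact (memLp_congr_ae hf).2 (hw.mono_exponent le_top)
  | succ n ih =>
    rintro f ⟨g, h, hg⟩
    exact ⟨g, h, ih hg⟩

theorem MemHper.mono {n m : ℕ} {f : ℝ → ℝ} (h : MemHper m f) (hnm : n ≤ m) : MemHper n f := by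
  induction hnm with
  | refl => exact h
  | step _ ih => exact ih h.pred

theorem MemHper.add {n : ℕ} : ∀ {f g : ℝ → ℝ}, MemHper n f → MemHper n g →
    MemHper n (fun t => f t + g t) := by
  induction n with
  | zero => exact fun hf hg => MemLp.add hf hg
  | succ n ih =>
    rintro f g ⟨f', hf, hf'⟩ ⟨g', hg, hg'⟩
    exact ⟨_, hf.add hg, ih hf' hg'⟩

theorem MemHper.const_mul {n : ℕ} (c : ℝ) : ∀ {f : ℝ → ℝ}, MemHper n f →
    MemHper n (fun t => c * f t) := by
  induction n with
  | zero => exact fun hf => MemLp.const_mul hf c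
  | succ n ih =>
    rintro f ⟨f', hf, hf'⟩
    exact ⟨_, hf.const_mul c, ih hf'⟩

theorem MemHper.mul {n : ℕ} : ∀ {f g : ℝ → ℝ}, MemHper n f → MemHper (max n 1) g →
    MemHper n (fun t => f t * g t) := by
  induction n with
  | zero =>
    rintro f g hf ⟨g', hg, -⟩
    obtain ⟨w, hw, hgw⟩ := hg.bounded
    have h : MemLp (fun t => w t * f t) 2 circleMeasure := MemLp.mul' hf hw
    refine (memLp_congr_ae ?_).2 h
    filter_upwards [hgw] with t ht
    rw [ht, mul_comm]
  | succ n ih =>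
    intro f g hf hg
    rw [max_eq_left (by omega)] at hg
    have hf0 := hf
    have hg0 := hg
    obtain ⟨f', hf, hf'⟩ := hf
    obtain ⟨g', hg, hg'⟩ := hg
    refine ⟨_, hf.mul hg, (ih hf' (hg0.mono (by omega))).add ?_⟩
    have := ih hg' (hf0.mono (by omega))
    simpa only [mul_comm] using this

theorem MemHper.exists_jet {n : ℕ} : ∀ {f : ℝ → ℝ}, MemHper n f →
    ∃ u : Hper n, u.der 0 =ᵐ[circleMeasure] f := by
  induction n with
  | zero =>
    intro f hf
    refine ⟨⟨WithLp.toLp 2 fun _ => MemLp.toLp f hf, fun j => j.elim0⟩, ?_⟩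
    exact MemLp.coeFn_toLp hf
  | succ n ih =>
    intro f hf
    have hf0 : MemHper 0 f := hf.mono (by omega)
    obtain ⟨g, hfg, hg⟩ := hf
    obtain ⟨v, hv⟩ := ih hg
    refine ⟨⟨WithLp.toLp 2 (Fin.cons (MemLp.toLp f hf0) v.1.ofLp), fun j => ?_⟩, ?_⟩
    · refine Fin.cases ?_ (fun i => ?_) j
      · exact hfg.congr (MemLp.coeFn_toLp hf0) hv
      · exact v.2 i
    · exact MemLp.coeFn_toLp hf0

theorem Hper.memHper_der {p : ℕ} (u : Hper p) : ∀ (n : ℕ) (j : Fin (p + 1)), j + n = p →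
    MemHper n (u.der j) := by
  intro n
  induction n with
  | zero => exact fun j _ => Lp.memLp _
  | succ n ih =>
    intro j hj
    have hjp : (j : ℕ) < p := by omega
    refine ⟨u.der (Fin.succ ⟨j, hjp⟩), u.2 ⟨j, hjp⟩, ih _ ?_⟩
    simp only [Fin.val_succ]
    omega

theorem exists_sturmLiouville (p : ℕ) (hp : 2 ≤ p) (u : Hper p) : ∃ v : Hper (p - 2),
    v.der 0 =ᵐ[circleMeasure]
      fun t => -(u.der ⟨2, by omega⟩ t) + (u.der 0 t) ^ 2 / 2 := by
  have h0 : MemHper p (u.der 0) := u.memHper_der p 0 (by simp)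
  have h2 : MemHper (p - 2) (u.der ⟨2, by omega⟩) :=
    u.memHper_der (p - 2) ⟨2, by omega⟩ (by simp only; omega)
  have hsq : MemHper (p - 2) (fun t => u.der 0 t * u.der 0 t) :=
    (h0.mono (by omega)).mul (h0.mono (by omega))
  have := ((h2.const_mul (-1)).add (hsq.const_mul (1 / 2))).exists_jet
  obtain ⟨v, hv⟩ := this
  refine ⟨v, hv.trans (Filter.Eventually.of_forall fun t => ?_)⟩
  simp only
  ring

/-- The nonlinear periodic Sturm-Liouville operator
`F : H^p(𝕊¹) → H^{p-2}(𝕊¹)`, `F(u) = -u'' + u²/2`: the element of `H^{p-2}(𝕊¹)` whose underlying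
function is `-u'' + u²/2`. -/
def sturmLiouville (p : ℕ) (hp : 2 ≤ p) (u : Hper p) : Hper (p - 2) :=
  (exists_sturmLiouville p hp u).choose

theorem sturmLiouville_spec (p : ℕ) (hp : 2 ≤ p) (u : Hper p) :
    (sturmLiouville p hp u).der 0 =ᵐ[circleMeasure]
      fun t => -(u.der ⟨2, by omega⟩ t) + (u.der 0 t) ^ 2 / 2 :=
  (exists_sturmLiouville p hp u).choose_spec

/-- The critical set of a map between normed spaces: the points at which its derivative
is not surjective. -/
def criticalSet {E E' : Type*} [NormedAddCommGroup E] [NormedSpace ℝ E]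
    [NormedAddCommGroup E'] [NormedSpace ℝ E'] (F : E → E') : Set E :=
  {u | ∃ F' : E →L[ℝ] E', HasFDerivAt F F' u ∧ ¬ Function.Surjective F'}

/-! ### The universal cover of `SL(2, ℝ)` -/

/-- Euclidean norm of the second column of a `2 × 2` matrix. -/
def colNorm (A : Matrix.SpecialLinearGroup (Fin 2) ℝ) : ℝ := Real.sqrt (A 0 1 ^ 2 + A 1 1 ^ 2)

/-- The universal cover `G` of `SL(2, ℝ)`: pairs `(A, θ)` where `π/2 - θ` is a determination of the
argument of the vector `A e₂`. -/
def SLCover : Type :=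
  {g : Matrix.SpecialLinearGroup (Fin 2) ℝ × ℝ //
    g.1 0 1 = colNorm g.1 * Real.sin g.2 ∧ g.1 1 1 = colNorm g.1 * Real.cos g.2}

namespace SLCover

instance : TopologicalSpace SLCover := instTopologicalSpaceSubtype

/-- The covering projection `Π : G → SL(2, ℝ)`. -/
def proj (g : SLCover) : Matrix.SpecialLinearGroup (Fin 2) ℝ := g.1.1

/-- The left Iwasawa angle `θ` of an element of `G`. -/
def angle (g : SLCover) : ℝ := g.1.2

/-- The trace of (the projection of) an element of `G`. -/
def trace (g : SLCover) : ℝ := Matrix.trace (proj g).1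

/-- The matrix
`!![cos θ, sin θ; -sin θ, cos θ] * !![√ρ, 0; 0, 1/√ρ] * !![1, 0; ν/2, 1]`. -/
def iwasawaMatrix (θ ρ ν : ℝ) : Matrix (Fin 2) (Fin 2) ℝ :=
  !![Real.cos θ, Real.sin θ; -Real.sin θ, Real.cos θ] * !![√ρ, 0; 0, 1 / √ρ] * !![1, 0; ν / 2, 1]

theorem iwasawaMatrix_eq (θ ρ ν : ℝ) : iwasawaMatrix θ ρ ν =
    !![Real.cos θ * √ρ + Real.sin θ * (1 / √ρ) * (ν / 2), Real.sin θ * (1 / √ρ);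
      -Real.sin θ * √ρ + Real.cos θ * (1 / √ρ) * (ν / 2), Real.cos θ * (1 / √ρ)] := by
  ext i j
  fin_cases i <;> fin_cases j <;> simp [iwasawaMatrix, Matrix.mul_apply, Fin.sum_univ_two]

theorem det_iwasawaMatrix (θ ν : ℝ) {ρ : ℝ} (hρ : 0 < ρ) : (iwasawaMatrix θ ρ ν).det = 1 := by
  have h : √ρ ≠ 0 := (Real.sqrt_pos.2 hρ).ne'
  rw [iwasawaMatrix, Matrix.det_mul, Matrix.det_mul]
  simp only [Matrix.det_fin_two_of]
  have := Real.sin_sq_add_cos_sq θ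
  field_simp
  linarith

theorem colNorm_sq (A : Matrix.SpecialLinearGroup (Fin 2) ℝ) :
    colNorm A ^ 2 = A 0 1 ^ 2 + A 1 1 ^ 2 := Real.sq_sqrt (by positivity)

theorem colNorm_pos (A : Matrix.SpecialLinearGroup (Fin 2) ℝ) : 0 < colNorm A := by
  refine Real.sqrt_pos.2 ?_
  have h := A.2
  rw [Matrix.det_fin_two] at h
  change A 0 0 * A 1 1 - A 0 1 * A 1 0 = 1 at h
  by_contra hn
  have h0 : A 0 1 = 0 := by nlinarith [sq_nonneg (A 0 1), sq_nonneg (A 1 1)]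
  have h1 : A 1 1 = 0 := by nlinarith [sq_nonneg (A 0 1), sq_nonneg (A 1 1)]
  rw [h0, h1] at h
  simp at h

theorem continuous_entry (i j : Fin 2) :
    Continuous fun A : Matrix.SpecialLinearGroup (Fin 2) ℝ => A i j :=
  (continuous_apply j).comp ((continuous_apply i).comp continuous_subtype_val)

theorem continuous_colNorm : Continuous colNorm :=
  Real.continuous_sqrt.comp
    (((continuous_entry 0 1).pow 2).add ((continuous_entry 1 1).pow 2))

theorem continuous_proj : Continuous proj := continuous_fst.comp continuous_subtype_val

theorem continuous_angle : Continuous angle := continuous_snd.comp continuous_subtype_val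

theorem colNorm_iwasawa (θ ν : ℝ) {ρ : ℝ} (hρ : 0 < ρ) :
    colNorm ⟨iwasawaMatrix θ ρ ν, det_iwasawaMatrix θ ν hρ⟩ = 1 / √ρ := by
  have h : 0 < √ρ := Real.sqrt_pos.2 hρ
  rw [← Real.sqrt_sq (show 0 ≤ 1 / √ρ by positivity)]
  refine congrArg Real.sqrt ?_
  change iwasawaMatrix θ ρ ν 0 1 ^ 2 + iwasawaMatrix θ ρ ν 1 1 ^ 2 = _
  simp only [iwasawaMatrix_eq, Matrix.of_apply, Matrix.cons_val', Matrix.cons_val_zero,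
    Matrix.cons_val_one, Matrix.cons_val_fin_one]
  rw [mul_pow, mul_pow, ← add_mul, Real.sin_sq_add_cos_sq, one_mul]

/-- The left Iwasawa decomposition `φ_L : ℝ × (0, ∞) × ℝ → G`, lifting `iwasawaMatrix` with
`φ_L(0, 1, 0) = I`. -/
def iwasawa : (ℝ × Ioi (0 : ℝ) × ℝ) ≃ₜ SLCover where
  toFun x := ⟨(⟨iwasawaMatrix x.1 x.2.1 x.2.2, det_iwasawaMatrix _ _ x.2.1.2⟩, x.1), by
    simp only [colNorm_iwasawa x.1 x.2.2 x.2.1.2]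
    change iwasawaMatrix _ _ _ 0 1 = _ ∧ iwasawaMatrix _ _ _ 1 1 = _
    simp [iwasawaMatrix_eq, mul_comm]⟩
  invFun g := (angle g, ⟨1 / colNorm (proj g) ^ 2, by
      have := colNorm_pos (proj g)
      simp only [mem_Ioi]
      positivity⟩,
    2 * (proj g 0 0 * proj g 0 1 + proj g 1 0 * proj g 1 1) / colNorm (proj g) ^ 2)
  left_inv := by
    rintro ⟨θ, ⟨ρ, hρ⟩, ν⟩
    have hρ' : (0 : ℝ) < ρ := hρ
    have h : 0 < √ρ := Real.sqrt_pos.2 hρ'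
    have hs : √ρ ^ 2 = ρ := Real.sq_sqrt hρ'.le
    have e := Real.sin_sq_add_cos_sq θ
    simp only [proj, angle, colNorm_iwasawa θ ν hρ']
    refine Prod.ext rfl (Prod.ext (Subtype.ext ?_) ?_)
    · simp only [one_div, inv_pow, inv_inv, hs]
    · change 2 * (iwasawaMatrix θ ρ ν 0 0 * iwasawaMatrix θ ρ ν 0 1 +
        iwasawaMatrix θ ρ ν 1 0 * iwasawaMatrix θ ρ ν 1 1) / (1 / √ρ) ^ 2 = ν
      simp only [iwasawaMatrix_eq, Matrix.of_apply, Matrix.cons_val', Matrix.cons_val_zero,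
        Matrix.cons_val_one, Matrix.cons_val_fin_one]
      field_simp
      linear_combination ν * e
  right_inv := by
    rintro ⟨⟨A, θ⟩, h0, h1⟩
    simp only at h0 h1
    have hc := colNorm_pos A
    have e := Real.sin_sq_add_cos_sq θ
    have hs : √(1 / colNorm A ^ 2) = 1 / colNorm A := by
      rw [one_div, one_div, ← inv_pow, Real.sqrt_sq (by positivity)]
    have hd := A.2
    rw [Matrix.det_fin_two] at hd
    change A 0 0 * A 1 1 - A 0 1 * A 1 0 = 1 at hd
    refine Subtype.ext (Prod.ext (Subtype.ext ?_) rfl)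
    simp only [proj, angle, iwasawaMatrix_eq, hs]
    rw [h0, h1] at hd ⊢
    ext i j
    fin_cases i <;> fin_cases j
    · change _ = A 0 0
      simp
      field_simp
      linear_combination Real.cos θ * (-1) * hd + A 0 0 * colNorm A * e
    · change _ = A 0 1
      simp [h0]
      ring
    · change _ = A 1 0
      simp
      field_simp
      linear_combination Real.sin θ * hd + A 1 0 * colNorm A * e
    · change _ = A 1 1
      simp [h1]
      ring
  continuous_toFun := by
    refine Continuous.subtype_mk (Continuous.prodMk (Continuous.subtype_mk ?_ _) continuous_fst) _
    simp only [iwasawaMatrix_eq]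
    have hr : Continuous fun x : ℝ × Ioi (0 : ℝ) × ℝ => √(x.2.1 : ℝ) := by fun_prop
    have hi : Continuous fun x : ℝ × Ioi (0 : ℝ) × ℝ => (√(x.2.1 : ℝ))⁻¹ :=
      hr.inv₀ fun x => (Real.sqrt_pos.2 x.2.1.2).ne'
    refine continuous_matrix fun i j => ?_
    fin_cases i <;> fin_cases j <;> simp
    · exact (((Real.continuous_cos.comp continuous_fst).mul hr).add
        (((Real.continuous_sin.comp continuous_fst).mul hi).mul (by fun_prop)))
    · exact (Real.continuous_sin.comp continuous_fst).mul hi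
    · exact (((Real.continuous_sin.comp continuous_fst).mul hr).neg.add
        (((Real.continuous_cos.comp continuous_fst).mul hi).mul (by fun_prop)))
    · exact (Real.continuous_cos.comp continuous_fst).mul hi
  continuous_invFun := by
    have hn : Continuous fun g : SLCover => colNorm (proj g) ^ 2 :=
      (continuous_colNorm.comp continuous_proj).pow 2
    have hn0 : ∀ g : SLCover, colNorm (proj g) ^ 2 ≠ 0 := fun g =>
      pow_ne_zero 2 (colNorm_pos _).ne'
    have he : ∀ i j : Fin 2, Continuous fun g : SLCover => proj g i j := fun i j =>
      (continuous_entry i j).comp continuous_proj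
    refine continuous_angle.prodMk (Continuous.prodMk (Continuous.subtype_mk ?_ _) ?_)
    · exact continuous_const.div hn hn0
    · exact (continuous_const.mul (((he 0 0).mul (he 0 1)).add ((he 1 0).mul (he 1 1)))).div hn hn0

/-- The global coordinates `(θ, ρ, ν)` of the left Iwasawa decomposition. -/
def coord (g : SLCover) : ℝ × ℝ × ℝ :=
  ((iwasawa.symm g).1, ((iwasawa.symm g).2.1 : ℝ), (iwasawa.symm g).2.2)

theorem isOpenEmbedding_coord : IsOpenEmbedding coord := by
  have h : IsOpenEmbedding (fun x : ℝ × Ioi (0 : ℝ) × ℝ => (x.1, (x.2.1 : ℝ), x.2.2)) :=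
    IsOpenEmbedding.id.prodMap (isOpen_Ioi.isOpenEmbedding_subtypeVal.prodMap .id)
  exact h.comp iwasawa.symm.isOpenEmbedding

instance : Nonempty SLCover := ⟨iwasawa (0, ⟨1, mem_Ioi.2 one_pos⟩, 0)⟩

/-- The smooth structure of `G`, given by the left Iwasawa coordinates `φ_L⁻¹`. In these coordinates
the entries of `Π` are smooth functions and `(ρ, ν)` and (locally) `θ` are smooth functions of the
entries, so this is the structure for which `Π` is a local diffeomorphism. -/
instance : ChartedSpace (ℝ × ℝ × ℝ) SLCover := isOpenEmbedding_coord.singletonChartedSpace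

instance : IsManifold 𝓘(ℝ, ℝ × ℝ × ℝ) ∞ SLCover := isOpenEmbedding_coord.isManifold_singleton

instance : SimplyConnectedSpace SLCover := by
  have : ContractibleSpace (Ioi (0 : ℝ)) :=
    (convex_Ioi (0 : ℝ)).contractibleSpace ⟨1, mem_Ioi.2 one_pos⟩
  have : ContractibleSpace SLCover := iwasawa.symm.contractibleSpace
  infer_instance

/-- The point of the unit circle with argument `θ` for `(A, θ) ∈ G`. -/
def colDir (A : Matrix.SpecialLinearGroup (Fin 2) ℝ) : Circle :=
  ⟨⟨A 1 1 / colNorm A, A 0 1 / colNorm A⟩, by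
    have h := colNorm_pos A
    have h2 := colNorm_sq A
    refine mem_sphere_zero_iff_norm.2 ?_
    rw [← sq_eq_sq₀ (norm_nonneg _) zero_le_one, ← Complex.normSq_eq_norm_sq, Complex.normSq_mk]
    field_simp
    linarith⟩

theorem exp_eq_colDir_iff (A : Matrix.SpecialLinearGroup (Fin 2) ℝ) (θ : ℝ) :
    Circle.exp θ = colDir A ↔
      A 0 1 = colNorm A * Real.sin θ ∧ A 1 1 = colNorm A * Real.cos θ := by
  have h := (colNorm_pos A).ne'
  rw [Circle.ext_iff, Complex.ext_iff, Circle.coe_exp, Complex.exp_ofReal_mul_I_re,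
    Complex.exp_ofReal_mul_I_im, and_comm]
  change Real.sin θ = A 0 1 / colNorm A ∧ Real.cos θ = A 1 1 / colNorm A ↔ _
  rw [eq_div_iff h, eq_div_iff h, mul_comm, mul_comm (Real.cos θ), eq_comm,
    eq_comm (b := A 1 1)]

theorem continuous_colDir : Continuous colDir := by
  refine Continuous.subtype_mk ?_ _
  have h : ∀ i, Continuous fun A : Matrix.SpecialLinearGroup (Fin 2) ℝ => A i 1 / colNorm A :=
    fun i => (continuous_entry i 1).div continuous_colNorm fun A => (colNorm_pos A).ne'
  exact Complex.equivRealProdCLM.symm.continuous.comp ((h 1).prodMk (h 0))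

theorem exp_angle (g : SLCover) : Circle.exp (angle g) = colDir (proj g) :=
  (exp_eq_colDir_iff _ _).2 g.2

/-- `Π : G → SL(2, ℝ)` is a covering map; as `G` is simply connected, it is the universal cover. -/
theorem isCoveringMap_proj : IsCoveringMap proj := by
  intro A
  refine IsEvenlyCovered.to_isEvenlyCovered_preimage (I := Circle.exp ⁻¹' {colDir A}) ?_
  obtain ⟨hI, U, hAU, hU, hfU, H, hH⟩ := Circle.isCoveringMap_exp (colDir A)
  have hV : IsOpen (colDir ⁻¹' U) := hU.preimage continuous_colDir
  have hm : ∀ g : proj ⁻¹' (colDir ⁻¹' U), angle g.1 ∈ Circle.exp ⁻¹' U := fun g => by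
    have := g.2
    rw [mem_preimage, mem_preimage, ← exp_angle] at this
    exact this
  have hs : ∀ x : U × (Circle.exp ⁻¹' {colDir A}), Circle.exp (H.symm x).1 = x.1 := fun x => by
    rw [← hH, H.apply_symm_apply]
  refine ⟨hI, colDir ⁻¹' U, hAU, hV, hV.preimage continuous_proj, ?_⟩
  refine ⟨{ toFun g := (⟨proj g.1, g.2⟩, (H ⟨angle g.1, hm g⟩).2)
            invFun x := ⟨⟨(x.1.1, (H.symm (⟨colDir x.1.1, x.1.2⟩, x.2)).1),
              (exp_eq_colDir_iff _ _).1 (hs _)⟩, x.1.2⟩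
            left_inv := ?_
            right_inv := ?_
            continuous_toFun := ?_
            continuous_invFun := ?_ }, fun g => rfl⟩
  · intro g
    refine Subtype.ext (Subtype.ext (Prod.ext rfl ?_))
    change (H.symm (⟨colDir (proj g.1), g.2⟩, (H ⟨angle g.1, hm g⟩).2)).1 = angle g.1
    have : ((⟨colDir (proj g.1), g.2⟩, (H ⟨angle g.1, hm g⟩).2) : U × _) = H ⟨angle g.1, hm g⟩ := by
      refine Prod.ext (Subtype.ext ?_) rfl
      rw [hH]
      exact (exp_angle g.1).symm
    rw [this, H.symm_apply_apply]
  · intro x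
    refine Prod.ext rfl ?_
    change (H ⟨(H.symm (⟨colDir x.1.1, x.1.2⟩, x.2)).1, _⟩).2 = x.2
    exact congrArg Prod.snd (H.apply_symm_apply (⟨colDir x.1.1, x.1.2⟩, x.2))
  · refine Continuous.prodMk ?_ ?_
    · exact Continuous.subtype_mk (continuous_proj.comp continuous_subtype_val) _
    · exact continuous_snd.comp (H.continuous.comp
        (Continuous.subtype_mk (continuous_angle.comp continuous_subtype_val) _))
  · refine Continuous.subtype_mk (Continuous.subtype_mk (Continuous.prodMk ?_ ?_) _) _
    · exact continuous_subtype_val.comp continuous_fst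
    · exact continuous_subtype_val.comp (H.symm.continuous.comp (Continuous.prodMk
        (Continuous.subtype_mk (continuous_colDir.comp
          (continuous_subtype_val.comp continuous_fst)) _) continuous_snd))

/-- The open set `G₀ = φ_L((0, ∞) × (0, ∞) × ℝ)`. -/
def G₀ : TopologicalSpace.Opens SLCover :=
  ⟨iwasawa '' {x | 0 < x.1}, iwasawa.isOpenMap _ (isOpen_lt continuous_const continuous_fst)⟩

/-- The subset `T_c ∩ G₀` of `G₀`, where `T_c ⊆ G` is the level set of the trace. -/
def traceLevel (c : ℝ) : Set G₀ := {g | trace g.1 = c}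

end SLCover

/-! ### The model surface in `ℝ³` -/

/-- The plane `z = 0` (for `n = 0`) and, for `n > 0`, the cone
`x² + y² = tan² z`, `2πn - π/2 < z < 2πn + π/2`. -/
def SigmaPiece : ℕ → Set (EuclideanSpace ℝ (Fin 3))
  | 0 => {v | v 2 = 0}
  | n + 1 => {v | v 0 ^ 2 + v 1 ^ 2 = Real.tan (v 2) ^ 2 ∧
      2 * Real.pi * (n + 1) - Real.pi / 2 < v 2 ∧ v 2 < 2 * Real.pi * (n + 1) + Real.pi / 2}

/-- `Σ = ⋃_{n ≥ 0} Σ_n`. -/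
def SigmaSet : Set (EuclideanSpace ℝ (Fin 3)) := ⋃ n : ℕ, SigmaPiece n

end

noncomputable section

/-! ### Primitives on `[0, 2π]` -/

/-! The derivative of `F` at `q` is `w ↦ -w'' + q w`. Solving for periodic initial data shows that
it is onto when the monodromy matrix of `v'' = q v` does not have the eigenvalue 1. If it does, a
nonzero periodic solution is orthogonal to the range. The monodromy has determinant one, so `q` is
critical exactly when its trace is 2 (`Hper.mem_criticalSet_iff`). It remains to find a global chart
of the Sobolev space in which this trace depends on three real coordinates only.

The Kepler transform provides them. Write the normalized fundamental solutions as a plane curve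
`e^{-ψ/2} (cos θ, sin θ)`. Wronskian one is the area law `θ' = e^ψ`, and the linear equation becomes
`ψ'' = ψ'²/2 - 2 e^{2ψ} - 2q` with `ψ(0) = ψ'(0) = 0`; conversely `q` is an explicit expression in
`ψ, ψ', ψ''`. The monodromy is a function of `a = ψ(2π)`, `b = ψ'(2π)` and `c = θ(2π) = ∫ e^ψ > 0`.

The obstacle is that periodicity of `q` is a nonlinear condition on the endpoint jets of `ψ`. Split
`q` as `y` plus a part flat at the endpoints, with `y` in the orthogonal complement of the flat
functions. For given `(a, b, y)`, solve the Kepler equation with potential `y` from zero data at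
`0`, solve it again from data `(a, b)` at `2π`, and glue the two by a cutoff. The true `ψ` differs
from the glued function by some `h` flat at both ends, and any flat `h` is allowed, so `q ↦ (a, b,
y, h)` is a diffeomorphism onto a product of linear spaces (`Hper.exists_coordEquiv`). Moving `h`
along a fixed positive flat bump makes `c` run monotonically through `(0, ∞)`, so the bump
coefficient can be traded for `log c` (`Hper.exists_realCoordEquiv`). What is left is an
infinite-dimensional separable Hilbert space, hence isometric to the given one.

For the group, `c = θ`, `ρ = e^{-a}`, `ν = -b e^{-a}` are left Iwasawa coordinates of a conjugate of
the monodromy, so traces agree (`SLCover.trace_ofReal`). For the cones, put `x = sinh (a/2)` and `y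
= -(b/4) e^{-a/2}`: trace 2 means `√(1+x²) cos c + y sin c = 1`, that is `√(1+x²+y²) cos φ = 1` with
`φ = c - arctan (y/√(1+x²))`, which for `c ≥ π` is the family of cones `x² + y² = tan² φ`. The
component with `c < π` is a topological plane, flattened by a shear and a monotone change of the
last coordinate (`exists_straightening`). -/

theorem two_pi_nonneg : (0 : ℝ) ≤ 2 * Real.pi := by positivity

theorem uIcc_zero_two_pi : uIcc 0 (2 * Real.pi) = Icc 0 (2 * Real.pi) := uIcc_of_le two_pi_nonneg

theorem AbsolutelyContinuousOnInterval.congr {f g : ℝ → ℝ} {a b : ℝ}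
    (h : AbsolutelyContinuousOnInterval f a b) (hfg : EqOn f g (uIcc a b)) :
    AbsolutelyContinuousOnInterval g a b := by
  rw [absolutelyContinuousOnInterval_iff] at h ⊢
  intro ε hε
  obtain ⟨δ, hδ, H⟩ := h ε hε
  refine ⟨δ, hδ, fun E hE hd => ?_⟩
  convert H E hE hd using 1
  refine Finset.sum_congr rfl fun i hi => ?_
  have := hE.1 i hi
  rw [hfg this.1, hfg this.2]

/-- `f` is a primitive of the integrable function `g` on `[0, 2π]`. -/
def IsPrimitive (f g : ℝ → ℝ) : Prop :=
  IntervalIntegrable g volume 0 (2 * Real.pi) ∧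
    ∀ t ∈ Icc 0 (2 * Real.pi), f t = f 0 + ∫ s in (0 : ℝ)..t, g s

theorem ae_circle_of_ae_uIcc {P : ℝ → Prop}
    (h : ∀ᵐ t, t ∈ uIcc 0 (2 * Real.pi) → P t) : ∀ᵐ t ∂circleMeasure, P t := by
  rw [uIcc_zero_two_pi] at h
  exact (ae_restrict_iff' measurableSet_Icc).2 h

theorem ae_circle_mem_Ioo : ∀ᵐ t ∂circleMeasure, t ∈ Ioo 0 (2 * Real.pi) := by
  rw [circleMeasure, ← restrict_Ioo_eq_restrict_Icc]
  exact ae_restrict_mem measurableSet_Ioo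

theorem ae_circle_of_forall {P : ℝ → Prop} (h : ∀ t ∈ Icc 0 (2 * Real.pi), P t) :
    ∀ᵐ t ∂circleMeasure, P t := by
  filter_upwards [ae_restrict_mem measurableSet_Icc] with t ht using h t ht

theorem ae_uIoc_of_ae_circle {P : ℝ → Prop} (h : ∀ᵐ t ∂circleMeasure, P t) {a b : ℝ}
    (ha : a ∈ Icc 0 (2 * Real.pi)) (hb : b ∈ Icc 0 (2 * Real.pi)) :
    ∀ᵐ t, t ∈ uIoc a b → P t := by
  have := (ae_restrict_iff' measurableSet_Icc).1 h
  filter_upwards [this] with t ht hm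
  refine ht ⟨?_, ?_⟩
  · have := hm.1; exact (le_min ha.1 hb.1).trans this.le
  · exact hm.2.trans (max_le ha.2 hb.2)

theorem intervalIntegral_congr_circle {f g : ℝ → ℝ} (h : f =ᵐ[circleMeasure] g) {a b : ℝ}
    (ha : a ∈ Icc 0 (2 * Real.pi)) (hb : b ∈ Icc 0 (2 * Real.pi)) :
    ∫ s in a..b, f s = ∫ s in a..b, g s :=
  intervalIntegral.integral_congr_ae (ae_uIoc_of_ae_circle h ha hb)

theorem left_mem_circle : (0 : ℝ) ∈ Icc 0 (2 * Real.pi) := ⟨le_rfl, two_pi_nonneg⟩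

theorem right_mem_circle : 2 * Real.pi ∈ Icc 0 (2 * Real.pi) := ⟨two_pi_nonneg, le_rfl⟩

theorem intervalIntegrable_iff_circle {g : ℝ → ℝ} :
    IntervalIntegrable g volume 0 (2 * Real.pi) ↔ Integrable g circleMeasure := by
  rw [intervalIntegrable_iff_integrableOn_Icc_of_le two_pi_nonneg]
  rfl

theorem IntervalIntegrable.mono_circle {g : ℝ → ℝ}
    (h : IntervalIntegrable g volume 0 (2 * Real.pi)) {a b : ℝ}
    (ha : a ∈ Icc 0 (2 * Real.pi)) (hb : b ∈ Icc 0 (2 * Real.pi)) :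
    IntervalIntegrable g volume a b := by
  refine h.mono_set ?_
  rw [uIcc_zero_two_pi]
  exact ordConnected_Icc.uIcc_subset ha hb

theorem intervalIntegrable_of_memLp_circle {g : ℝ → ℝ} (h : MemLp g 2 circleMeasure) :
    IntervalIntegrable g volume 0 (2 * Real.pi) :=
  intervalIntegrable_iff_circle.2 (h.integrable (by norm_num))

theorem ContinuousOn.intervalIntegrable_circle {g : ℝ → ℝ}
    (h : ContinuousOn g (Icc 0 (2 * Real.pi))) :
    IntervalIntegrable g volume 0 (2 * Real.pi) := by
  rw [← uIcc_zero_two_pi] at h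
  exact h.intervalIntegrable

namespace IsPrimitive

variable {f g f' g' : ℝ → ℝ}

theorem sub_eq_integral (h : IsPrimitive f g) {a b : ℝ}
    (ha : a ∈ Icc 0 (2 * Real.pi)) (hb : b ∈ Icc 0 (2 * Real.pi)) :
    f b - f a = ∫ s in a..b, g s := by
  rw [h.2 a ha, h.2 b hb, ← intervalIntegral.integral_interval_sub_left
    (h.1.mono_circle left_mem_circle hb) (h.1.mono_circle left_mem_circle ha)]
  ring

theorem absolutelyContinuous (h : IsPrimitive f g) :
    AbsolutelyContinuousOnInterval f 0 (2 * Real.pi) := by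
  have h0 := h.1.absolutelyContinuousOnInterval_intervalIntegral (c := 0) (by simp)
  have h1 : AbsolutelyContinuousOnInterval (fun _ : ℝ => f 0) 0 (2 * Real.pi) :=
    (LipschitzWith.const (f 0)).lipschitzOnWith.absolutelyContinuousOnInterval
  refine (h1.add h0).congr fun t ht => ?_
  rw [uIcc_zero_two_pi] at ht
  exact (h.2 t ht).symm

theorem continuousOn (h : IsPrimitive f g) : ContinuousOn f (Icc 0 (2 * Real.pi)) := by
  rw [← uIcc_zero_two_pi]
  exact h.absolutelyContinuous.continuousOn

theorem ae_hasDerivAt (h : IsPrimitive f g) : ∀ᵐ t ∂circleMeasure, HasDerivAt f (g t) t := by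
  filter_upwards [ae_circle_of_ae_uIcc h.1.ae_hasDerivAt_integral, ae_circle_mem_Ioo]
    with t ht hm
  have := (ht 0 (by simp)).const_add (f 0)
  refine this.congr_of_eventuallyEq ?_
  filter_upwards [Ioo_mem_nhds hm.1 hm.2] with s hs
  exact h.2 s (Ioo_subset_Icc_self hs)

theorem of_absolutelyContinuous (h : AbsolutelyContinuousOnInterval f 0 (2 * Real.pi))
    (hd : ∀ᵐ t ∂circleMeasure, HasDerivAt f (g t) t) : IsPrimitive f g := by
  have hae : deriv f =ᵐ[circleMeasure] g := hd.mono fun t ht => ht.deriv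
  refine ⟨?_, fun t ht => ?_⟩
  · have := h.intervalIntegrable_deriv
    rw [intervalIntegrable_iff_circle] at this ⊢
    exact this.congr hae
  · have := (h.mono (c := 0) (d := t) (by
      rw [uIcc_zero_two_pi]; exact ordConnected_Icc.uIcc_subset left_mem_circle ht)
      ).integral_deriv_eq_sub
    rw [← intervalIntegral_congr_circle hae left_mem_circle ht, this]
    ring

theorem congr (h : IsPrimitive f g) (hf : EqOn f f' (Icc 0 (2 * Real.pi)))
    (hg : g =ᵐ[circleMeasure] g') : IsPrimitive f' g' := by
  refine ⟨?_, fun t ht => ?_⟩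
  · have := h.1
    rw [intervalIntegrable_iff_circle] at this ⊢
    exact this.congr hg
  · rw [← hf ht, ← hf left_mem_circle, h.2 t ht, intervalIntegral_congr_circle hg left_mem_circle ht]

theorem unique (h : IsPrimitive f g) (h' : IsPrimitive f g') : g =ᵐ[circleMeasure] g' := by
  filter_upwards [h.ae_hasDerivAt, h'.ae_hasDerivAt] with t h1 h2 using h1.unique h2

theorem mul (h : IsPrimitive f g) (h' : IsPrimitive f' g') :
    IsPrimitive (fun t => f t * f' t) (fun t => g t * f' t + f t * g' t) := by
  refine of_absolutelyContinuous (h.absolutelyContinuous.fun_mul h'.absolutelyContinuous) ?_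
  filter_upwards [h.ae_hasDerivAt, h'.ae_hasDerivAt] with t h1 h2 using h1.mul h2

theorem add (h : IsPrimitive f g) (h' : IsPrimitive f' g') :
    IsPrimitive (fun t => f t + f' t) (fun t => g t + g' t) := by
  refine of_absolutelyContinuous (h.absolutelyContinuous.add h'.absolutelyContinuous) ?_
  filter_upwards [h.ae_hasDerivAt, h'.ae_hasDerivAt] with t h1 h2 using h1.add h2

theorem const_mul (c : ℝ) (h : IsPrimitive f g) :
    IsPrimitive (fun t => c * f t) (fun t => c * g t) := by
  refine of_absolutelyContinuous (h.absolutelyContinuous.const_mul c) ?_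
  filter_upwards [h.ae_hasDerivAt] with t h1 using h1.const_mul c

theorem integral (hg : IntervalIntegrable g volume 0 (2 * Real.pi)) :
    IsPrimitive (fun t => ∫ s in (0 : ℝ)..t, g s) g :=
  ⟨hg, fun t _ => by simp⟩

theorem const (c : ℝ) : IsPrimitive (fun _ => c) (fun _ => 0) :=
  ⟨by simp, fun t _ => by simp⟩

theorem hasDerivWithinAt (h : IsPrimitive f g) (hg : ContinuousOn g (Icc 0 (2 * Real.pi)))
    {t : ℝ} (ht : t ∈ Icc 0 (2 * Real.pi)) : HasDerivWithinAt f (g t) (Icc 0 (2 * Real.pi)) t := by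
  have : Fact (t ∈ Icc 0 (2 * Real.pi)) := ⟨ht⟩
  have := intervalIntegral.integral_hasDerivWithinAt_right (h.1.mono_circle left_mem_circle ht)
    (s := Icc 0 (2 * Real.pi)) (t := Icc 0 (2 * Real.pi))
    (hg.stronglyMeasurableAtFilter_nhdsWithin measurableSet_Icc t) (hg t ht)
  refine (this.const_add (f 0)).congr (fun s hs => h.2 s hs) (h.2 t ht)

theorem of_hasDerivWithinAt (hg : ContinuousOn g (Icc 0 (2 * Real.pi)))
    (h : ∀ t ∈ Icc 0 (2 * Real.pi), HasDerivWithinAt f (g t) (Icc 0 (2 * Real.pi)) t) :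
    IsPrimitive f g := by
  refine ⟨hg.intervalIntegrable_circle, fun t ht => ?_⟩
  have hs : Icc 0 t ⊆ Icc 0 (2 * Real.pi) := Icc_subset_Icc le_rfl ht.2
  have := intervalIntegral.integral_eq_sub_of_hasDerivAt_of_le ht.1
    (fun s hs' => (h s (hs hs')).continuousWithinAt.mono hs)
    (fun s hs' => (h s (hs (Ioo_subset_Icc_self hs'))).hasDerivAt
      (Icc_mem_nhds hs'.1 (hs'.2.trans_le ht.2)))
    (hg.intervalIntegrable_circle.mono_circle left_mem_circle ht)
  rw [this]
  ring

theorem of_hasDerivAt (hg : Continuous g) (h : ∀ t, HasDerivAt f (g t) t) : IsPrimitive f g :=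
  of_hasDerivWithinAt hg.continuousOn fun t _ => (h t).hasDerivWithinAt

theorem comp (h : IsPrimitive f g) (hg : ContinuousOn g (Icc 0 (2 * Real.pi)))
    {φ φ' : ℝ → ℝ} (hφ : ∀ t ∈ Icc 0 (2 * Real.pi), HasDerivAt φ (φ' (f t)) (f t))
    (hφ' : ContinuousOn (fun t => φ' (f t)) (Icc 0 (2 * Real.pi))) :
    IsPrimitive (fun t => φ (f t)) (fun t => φ' (f t) * g t) :=
  of_hasDerivWithinAt (hφ'.mul hg) fun t ht =>
    (hφ t ht).comp_hasDerivWithinAt t (h.hasDerivWithinAt hg ht)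

theorem eqOn (h : IsPrimitive f g) (h' : IsPrimitive f' g') (hg : g =ᵐ[circleMeasure] g') {t₀ : ℝ}
    (ht₀ : t₀ ∈ Icc 0 (2 * Real.pi)) (h0 : f t₀ = f' t₀) : EqOn f f' (Icc 0 (2 * Real.pi)) := by
  intro t ht
  have e1 := h.sub_eq_integral ht₀ ht
  have e2 := h'.sub_eq_integral ht₀ ht
  rw [intervalIntegral_congr_circle hg ht₀ ht] at e1
  linarith

end IsPrimitive

theorem eqOn_circle_of_ae {f g : ℝ → ℝ} (hf : ContinuousOn f (Icc 0 (2 * Real.pi)))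
    (hg : ContinuousOn g (Icc 0 (2 * Real.pi))) (h : f =ᵐ[circleMeasure] g) :
    EqOn f g (Icc 0 (2 * Real.pi)) :=
  Measure.eqOn_Icc_of_ae_eq volume (by positivity) h hf hg

/-- The fundamental theorem of calculus for absolutely continuous functions. From here on weak
derivatives are handled through integrals. -/
theorem hasPeriodicDeriv_iff {f g : ℝ → ℝ} : HasPeriodicDeriv f g ↔
    ∃ w, IsPrimitive w g ∧ w 0 = w (2 * Real.pi) ∧ f =ᵐ[circleMeasure] w := by
  refine exists_congr fun w => ⟨?_, ?_⟩
  · rintro ⟨h1, h2, h3, h4⟩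
    exact ⟨.of_absolutelyContinuous h1 h4, h2, h3⟩
  · rintro ⟨h1, h2, h3⟩
    exact ⟨h1.absolutelyContinuous, h2, h3, h1.ae_hasDerivAt⟩

end

noncomputable section

/-! ### Continuous and square-integrable functions on `[0, 2π]` -/

/-- Continuous functions on `[0, 2π]`. -/
abbrev CircleC : Type := C(Icc (0 : ℝ) (2 * Real.pi), ℝ)

/-- A continuous function on `[0, 2π]`, extended by constants. -/
def CircleC.ext (F : CircleC) : ℝ → ℝ := IccExtend two_pi_nonneg F

namespace CircleC

theorem ext_apply (F : CircleC) {t : ℝ} (ht : t ∈ Icc 0 (2 * Real.pi)) : F.ext t = F ⟨t, ht⟩ :=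
  IccExtend_of_mem _ _ ht

theorem continuous_ext (F : CircleC) : Continuous F.ext := F.continuous.Icc_extend'

theorem norm_ext_le (F : CircleC) (t : ℝ) : ‖F.ext t‖ ≤ ‖F‖ := F.norm_coe_le_norm _

theorem memLp_ext (F : CircleC) : MemLp F.ext 2 circleMeasure :=
  MemLp.of_bound F.continuous_ext.aestronglyMeasurable ‖F‖ (Filter.Eventually.of_forall F.norm_ext_le)

/-- The inclusion `C([0, 2π]) → L²([0, 2π])`. -/
def toL2 : CircleC →L[ℝ] L2Circle :=
  LinearMap.mkContinuous
    { toFun F := F.memLp_ext.toLp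
      map_add' F G := (MemLp.toLp_add F.memLp_ext G.memLp_ext)
      map_smul' c F := (MemLp.toLp_const_smul c F.memLp_ext) }
    (measureUnivNNReal circleMeasure ^ (ENNReal.toReal 2)⁻¹) fun F => by
      refine Lp.norm_le_of_ae_bound (norm_nonneg F) ?_
      filter_upwards [F.memLp_ext.coeFn_toLp] with t ht
      change ‖(F.memLp_ext.toLp _ : ℝ → ℝ) t‖ ≤ _
      rw [ht]
      exact F.norm_ext_le t

theorem coeFn_toL2 (F : CircleC) : toL2 F =ᵐ[circleMeasure] F.ext := F.memLp_ext.coeFn_toLp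

/-- The measure is finite, so `L²` embeds continuously in `L¹`. This bounds the Volterra operator.
-/
theorem integral_norm_le : ∃ C : ℝ, 0 ≤ C ∧ ∀ g : L2Circle,
    ∫ s, ‖g s‖ ∂circleMeasure ≤ C * ‖g‖ := by
  refine ⟨(circleMeasure univ ^ (1 / (1 : ENNReal).toReal - 1 / (2 : ENNReal).toReal)).toReal,
    ENNReal.toReal_nonneg, fun g => ?_⟩
  have hg := (Lp.memLp g).aestronglyMeasurable
  have h := eLpNorm_le_eLpNorm_mul_rpow_measure_univ (p := 1) (q := 2) (by norm_num) hg
  rw [integral_norm_eq_lintegral_enorm hg, ← eLpNorm_one_eq_lintegral_enorm, Lp.norm_def, mul_comm,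
    ← ENNReal.toReal_mul]
  refine ENNReal.toReal_mono (ENNReal.mul_ne_top (Lp.eLpNorm_ne_top g) ?_) h
  exact ENNReal.rpow_ne_top_of_nonneg (by norm_num) (measure_ne_top _ _)

theorem intervalIntegrable_coeFn (g : L2Circle) : IntervalIntegrable g volume 0 (2 * Real.pi) :=
  intervalIntegrable_of_memLp_circle (Lp.memLp g)

theorem integral_add_circle (g g' : L2Circle) {t : ℝ} (ht : t ∈ Icc 0 (2 * Real.pi)) :
    ∫ s in (0 : ℝ)..t, (g + g' : L2Circle) s = (∫ s in (0 : ℝ)..t, g s) + ∫ s in (0 : ℝ)..t, g' s := by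
  rw [intervalIntegral_congr_circle (Lp.coeFn_add g g') left_mem_circle ht]
  exact intervalIntegral.integral_add
    ((intervalIntegrable_coeFn g).mono_circle left_mem_circle ht)
    ((intervalIntegrable_coeFn g').mono_circle left_mem_circle ht)

theorem integral_smul_circle (c : ℝ) (g : L2Circle) {t : ℝ} (ht : t ∈ Icc 0 (2 * Real.pi)) :
    ∫ s in (0 : ℝ)..t, (c • g : L2Circle) s = c * ∫ s in (0 : ℝ)..t, g s := by
  rw [intervalIntegral_congr_circle (Lp.coeFn_smul c g) left_mem_circle ht]
  simp

/-- The Volterra operator `g ↦ ∫₀ᵗ g` from `L²([0, 2π])` to `C([0, 2π])`. -/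
def volterra : L2Circle →L[ℝ] CircleC :=
  LinearMap.mkContinuous
    { toFun g := ⟨fun t => ∫ s in (0 : ℝ)..t, g s,
        (IsPrimitive.integral (intervalIntegrable_coeFn g)).continuousOn.domRestrict⟩
      map_add' g g' := by
        ext t
        exact integral_add_circle g g' t.2
      map_smul' c g := by
        ext t
        exact integral_smul_circle c g t.2 }
    integral_norm_le.choose fun g => by
      obtain ⟨hC, h⟩ := integral_norm_le.choose_spec
      refine (ContinuousMap.norm_le _ (mul_nonneg hC (norm_nonneg g))).2 fun t => ?_
      refine le_trans ?_ (h g)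
      change ‖∫ s in (0 : ℝ)..t, g s‖ ≤ _
      refine (intervalIntegral.norm_integral_le_integral_norm t.2.1).trans ?_
      rw [intervalIntegral.integral_of_le t.2.1]
      refine setIntegral_mono_set ((Lp.memLp g).integrable (by norm_num)).norm
        (Filter.Eventually.of_forall fun s => norm_nonneg _) ?_
      exact (Ioc_subset_Icc_self.trans (Icc_subset_Icc le_rfl t.2.2)).eventuallyLE

theorem volterra_apply (g : L2Circle) (t : Icc (0 : ℝ) (2 * Real.pi)) :
    volterra g t = ∫ s in (0 : ℝ)..t, g s := rfl

theorem memLp_ext_mul (F : CircleC) (g : L2Circle) :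
    MemLp (fun t => F.ext t * g t) 2 circleMeasure :=
  MemLp.mul' (Lp.memLp g) (MemLp.of_bound (p := ⊤) F.continuous_ext.aestronglyMeasurable ‖F‖
    (Filter.Eventually.of_forall F.norm_ext_le))

/-- Multiplication `C([0, 2π]) × L²([0, 2π]) → L²([0, 2π])`. -/
def mulL2 : CircleC →L[ℝ] L2Circle →L[ℝ] L2Circle :=
  LinearMap.mkContinuous₂
    (LinearMap.mk₂ ℝ (fun F g => (F.memLp_ext_mul g).toLp)
      (fun F F' g => by
        refine Lp.ext ?_
        filter_upwards [((F + F').memLp_ext_mul g).coeFn_toLp, (F.memLp_ext_mul g).coeFn_toLp,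
          (F'.memLp_ext_mul g).coeFn_toLp, Lp.coeFn_add (F.memLp_ext_mul g).toLp
            (F'.memLp_ext_mul g).toLp] with t h1 h2 h3 h4
        rw [h1, h4, Pi.add_apply, h2, h3]
        exact add_mul _ _ _)
      (fun c F g => by
        refine Lp.ext ?_
        filter_upwards [((c • F).memLp_ext_mul g).coeFn_toLp, (F.memLp_ext_mul g).coeFn_toLp,
          Lp.coeFn_smul c (F.memLp_ext_mul g).toLp] with t h1 h2 h3
        rw [h1, h3, Pi.smul_apply, h2]
        exact mul_assoc _ _ _)
      (fun F g g' => by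
        refine Lp.ext ?_
        filter_upwards [(F.memLp_ext_mul (g + g')).coeFn_toLp, (F.memLp_ext_mul g).coeFn_toLp,
          (F.memLp_ext_mul g').coeFn_toLp, Lp.coeFn_add (F.memLp_ext_mul g).toLp
            (F.memLp_ext_mul g').toLp, Lp.coeFn_add g g'] with t h1 h2 h3 h4 h5
        rw [h1, h4, Pi.add_apply, h2, h3, h5]
        exact mul_add _ _ _)
      (fun c F g => by
        refine Lp.ext ?_
        filter_upwards [(F.memLp_ext_mul (c • g)).coeFn_toLp, (F.memLp_ext_mul g).coeFn_toLp,
          Lp.coeFn_smul c (F.memLp_ext_mul g).toLp, Lp.coeFn_smul c g] with t h1 h2 h3 h4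
        rw [h1, h3, Pi.smul_apply, h2, h4]
        exact mul_left_comm _ _ _))
    1 fun F g => by
      rw [one_mul]
      refine Lp.norm_le_mul_norm_of_ae_le_mul ?_
      rw [LinearMap.mk₂_apply]
      filter_upwards [(F.memLp_ext_mul g).coeFn_toLp] with t ht
      rw [ht, norm_mul]
      exact mul_le_mul_of_nonneg_right (F.norm_ext_le t) (norm_nonneg _)

theorem coeFn_mulL2 (F : CircleC) (g : L2Circle) :
    mulL2 F g =ᵐ[circleMeasure] fun t => F.ext t * g t := (F.memLp_ext_mul g).coeFn_toLp

end CircleC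

end

noncomputable section

/-! ### Smooth families of functions on `[0, 2π]` -/

section Families

variable {E E' : Type*} [NormedAddCommGroup E] [NormedSpace ℝ E]
  [NormedAddCommGroup E'] [NormedSpace ℝ E']

/-- A family of functions which depends smoothly on its parameter as an element of
`C([0, 2π])`. -/
def CFamily (f : E → ℝ → ℝ) : Prop :=
  ∃ F : E → CircleC, ContDiff ℝ ∞ F ∧ ∀ x t (ht : t ∈ Icc 0 (2 * Real.pi)), F x ⟨t, ht⟩ = f x t

/-- A family of functions which depends smoothly on its parameter as an element of
`L²([0, 2π])`. -/
def L2Family (f : E → ℝ → ℝ) : Prop :=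
  ∃ F : E → L2Circle, ContDiff ℝ ∞ F ∧ ∀ x, F x =ᵐ[circleMeasure] f x

namespace CFamily

variable {f g : E → ℝ → ℝ}

theorem congr (h : CFamily f) (hfg : ∀ x, EqOn (f x) (g x) (Icc 0 (2 * Real.pi))) : CFamily g := by
  obtain ⟨F, hF, h⟩ := h
  exact ⟨F, hF, fun x t ht => (h x t ht).trans (hfg x ht)⟩

theorem continuousOn (h : CFamily f) (x : E) : ContinuousOn (f x) (Icc 0 (2 * Real.pi)) := by
  obtain ⟨F, hF, h⟩ := h
  rw [continuousOn_iff_continuous_domRestrict]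
  convert (F x).continuous using 1
  ext t
  exact (h x t t.2).symm

theorem contDiff_eval (h : CFamily f) {t : ℝ} (ht : t ∈ Icc 0 (2 * Real.pi)) :
    ContDiff ℝ ∞ fun x => f x t := by
  obtain ⟨F, hF, h⟩ := h
  have := (ContinuousMap.evalCLM ℝ (⟨t, ht⟩ : Icc (0 : ℝ) (2 * Real.pi)) :
    CircleC →L[ℝ] ℝ).contDiff.comp hF
  convert this using 1
  ext x
  exact (h x t ht).symm

theorem of_scalar {c : E → ℝ} (hc : ContDiff ℝ ∞ c) : CFamily fun x _ => c x := by
  refine ⟨fun x => c x • (1 : CircleC), hc.smul contDiff_const, fun x t ht => ?_⟩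
  simp

theorem of_continuous {c : ℝ → ℝ} (hc : Continuous c) : CFamily fun _ : E => c :=
  ⟨fun _ => ⟨fun t => c t, by fun_prop⟩, contDiff_const, fun _ _ _ => rfl⟩

theorem add (hf : CFamily f) (hg : CFamily g) : CFamily fun x t => f x t + g x t := by
  obtain ⟨F, hF, hf⟩ := hf
  obtain ⟨G, hG, hg⟩ := hg
  exact ⟨fun x => F x + G x, hF.add hG, fun x t ht => by simp [hf, hg]⟩

theorem mul (hf : CFamily f) (hg : CFamily g) : CFamily fun x t => f x t * g x t := by
  obtain ⟨F, hF, hf⟩ := hf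
  obtain ⟨G, hG, hg⟩ := hg
  exact ⟨fun x => F x * G x, hF.mul hG, fun x t ht => by simp [hf, hg]⟩

theorem smul {c : E → ℝ} (hc : ContDiff ℝ ∞ c) (hf : CFamily f) :
    CFamily fun x t => c x * f x t := (of_scalar hc).mul hf

theorem const_mul (c : ℝ) (hf : CFamily f) : CFamily fun x t => c * f x t :=
  hf.smul contDiff_const

theorem sub (hf : CFamily f) (hg : CFamily g) : CFamily fun x t => f x t - g x t :=
  (hf.add (hg.const_mul (-1))).congr fun x t _ => by ring

/-- `C([0, 2π])` is a Banach algebra, so its exponential is analytic; evaluation at a point is a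
continuous algebra homomorphism and carries it to the real exponential. -/
theorem exp (hf : CFamily f) : CFamily fun x t => Real.exp (f x t) := by
  obtain ⟨F, hF, hf⟩ := hf
  have h : ContDiff ℝ ∞ (NormedSpace.exp : CircleC → CircleC) :=
    contDiff_iff_contDiffAt.2 fun x => (NormedSpace.exp_analytic (𝕂 := ℝ) x).contDiffAt
  refine ⟨fun x => NormedSpace.exp (F x), h.comp hF, fun x t ht => ?_⟩
  have := NormedSpace.map_exp (ContinuousMap.evalAlgHom ℝ ℝ (⟨t, ht⟩ : Icc (0 : ℝ) (2 * Real.pi)))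
    (continuous_eval_const _) (F x)
  change _ = Real.exp (f x t)
  rw [← hf x t ht, Real.exp_eq_exp_ℝ]
  exact this

/-- A function without zeros is a unit of the Banach algebra `C([0, 2π])`, and inversion is smooth
at units. -/
theorem inv (hf : CFamily f) (h0 : ∀ x, ∀ t ∈ Icc 0 (2 * Real.pi), f x t ≠ 0) :
    CFamily fun x t => (f x t)⁻¹ := by
  obtain ⟨F, hF, hf⟩ := hf
  have hu : ∀ x, IsUnit (F x) := fun x =>
    ContinuousMap.isUnit_iff_forall_ne_zero _ |>.2 fun t => by
      rw [hf x t t.2]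
      exact h0 x t t.2
  refine ⟨fun x => Ring.inverse (F x), contDiff_iff_contDiffAt.2 fun x => ?_, fun x t ht => ?_⟩
  · have := contDiffAt_ringInverse (n := ∞) ℝ (hu x).unit
    exact this.comp x hF.contDiffAt
  · have := congrArg (fun G : CircleC => G ⟨t, ht⟩) (Ring.inverse_mul_cancel _ (hu x))
    simp only [ContinuousMap.mul_apply, hf, ContinuousMap.one_apply] at this
    exact eq_inv_of_mul_eq_one_left this

theorem comp (hf : CFamily f) {φ : E' → E} (hφ : ContDiff ℝ ∞ φ) :
    CFamily fun x => f (φ x) := by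
  obtain ⟨F, hF, hf⟩ := hf
  exact ⟨fun x => F (φ x), hF.comp hφ, fun x => hf (φ x)⟩

theorem l2Family (hf : CFamily f) : L2Family f := by
  obtain ⟨F, hF, hf⟩ := hf
  refine ⟨fun x => CircleC.toL2 (F x), CircleC.toL2.contDiff.comp hF, fun x => ?_⟩
  refine (CircleC.coeFn_toL2 _).trans (ae_circle_of_forall fun t ht => ?_)
  rw [CircleC.ext_apply _ ht, hf]

end CFamily

namespace L2Family

variable {f g : E → ℝ → ℝ}

theorem congr (h : L2Family f) (hfg : ∀ x, f x =ᵐ[circleMeasure] g x) : L2Family g := by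
  obtain ⟨F, hF, h⟩ := h
  exact ⟨F, hF, fun x => (h x).trans (hfg x)⟩

theorem memLp (h : L2Family f) (x : E) : MemLp (f x) 2 circleMeasure := by
  obtain ⟨F, hF, h⟩ := h
  exact (memLp_congr_ae (h x)).1 (Lp.memLp _)

theorem intervalIntegrable (h : L2Family f) (x : E) :
    IntervalIntegrable (f x) volume 0 (2 * Real.pi) :=
  intervalIntegrable_of_memLp_circle (h.memLp x)

theorem add (hf : L2Family f) (hg : L2Family g) : L2Family fun x t => f x t + g x t := by
  obtain ⟨F, hF, hf⟩ := hf
  obtain ⟨G, hG, hg⟩ := hg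
  refine ⟨fun x => F x + G x, hF.add hG, fun x => ?_⟩
  filter_upwards [hf x, hg x, Lp.coeFn_add (F x) (G x)] with t h1 h2 h3
  rw [h3, Pi.add_apply, h1, h2]

theorem mul (hf : L2Family f) (hg : CFamily g) : L2Family fun x t => f x t * g x t := by
  obtain ⟨F, hF, hf⟩ := hf
  obtain ⟨G, hG, hg⟩ := hg
  refine ⟨fun x => CircleC.mulL2 (G x) (F x),
    (CircleC.mulL2.contDiff.comp hG).clm_apply hF, fun x => ?_⟩
  filter_upwards [hf x, CircleC.coeFn_mulL2 (G x) (F x), ae_restrict_mem measurableSet_Icc]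
    with t h1 h2 h3
  rw [h2, CircleC.ext_apply _ h3, hg, h1, mul_comm]

theorem integral (hf : L2Family f) : CFamily fun x t => ∫ s in (0 : ℝ)..t, f x s := by
  obtain ⟨F, hF, hf⟩ := hf
  refine ⟨fun x => CircleC.volterra (F x), CircleC.volterra.contDiff.comp hF, fun x t ht => ?_⟩
  rw [CircleC.volterra_apply]
  exact intervalIntegral_congr_circle (hf x) left_mem_circle ht

theorem comp (hf : L2Family f) {φ : E' → E} (hφ : ContDiff ℝ ∞ φ) :
    L2Family fun x => f (φ x) := by
  obtain ⟨F, hF, hf⟩ := hf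
  exact ⟨fun x => F (φ x), hF.comp hφ, fun x => hf (φ x)⟩

end L2Family

/-- Integration is continuous from `L²` to `C`, so only the constant of integration has to be
checked, at any one point. -/
theorem CFamily.of_primitive {f g : E → ℝ → ℝ} (hg : L2Family g)
    (h : ∀ x, IsPrimitive (f x) (g x)) {t₀ : ℝ} (ht₀ : t₀ ∈ Icc 0 (2 * Real.pi))
    (h0 : ContDiff ℝ ∞ fun x => f x t₀) : CFamily f := by
  refine ((CFamily.of_scalar (h0.sub (hg.integral.contDiff_eval ht₀))).add hg.integral).congr
    fun x t ht => ?_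
  simp only [(h x).2 t ht, (h x).2 t₀ ht₀]
  ring

/-- A family of functions which depends smoothly on its parameter as an element of the (not
necessarily periodic) Sobolev space of order `n`, and whose derivatives up to order `n - 1` vanish
on `S`. -/
def SobFamily (S : Set ℝ) : ℕ → (E → ℝ → ℝ) → Prop
  | 0, f => L2Family f
  | n + 1, f => CFamily f ∧ (∀ x, ∀ t ∈ S ∩ Icc 0 (2 * Real.pi), f x t = 0) ∧
      ∃ g : E → ℝ → ℝ, SobFamily S n g ∧ ∀ x, IsPrimitive (f x) (g x)

/-! ### Calculus of Sobolev families with prescribed vanishing -/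

namespace SobFamily

variable {S S' : Set ℝ} {f g : E → ℝ → ℝ} {n m : ℕ}

theorem cFamily (h : SobFamily S (n + 1) f) : CFamily f := h.1

theorem congr (h : SobFamily S n f) (hfg : ∀ x, EqOn (f x) (g x) (Icc 0 (2 * Real.pi))) :
    SobFamily S n g := by
  cases n with
  | zero => exact L2Family.congr h fun x => ae_circle_of_forall (hfg x)
  | succ n =>
    obtain ⟨h1, h2, k, h3, h4⟩ := h
    exact ⟨h1.congr hfg, fun x t ht => (hfg x ht.2).symm.trans (h2 x t ht), k, h3,
      fun x => (h4 x).congr (hfg x) ae_eq_rfl⟩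

theorem mono_set (h : SobFamily S n f) (hS : S' ⊆ S) : SobFamily S' n f := by
  induction n generalizing f with
  | zero => exact h
  | succ n ih =>
    obtain ⟨h1, h2, k, h3, h4⟩ := h
    exact ⟨h1, fun x t ht => h2 x t ⟨hS ht.1, ht.2⟩, k, ih h3, h4⟩

theorem free (h : SobFamily S n f) : SobFamily ∅ n f := h.mono_set (empty_subset _)

theorem pred (h : SobFamily S (n + 1) f) : SobFamily S n f := by
  induction n generalizing f with
  | zero => exact h.1.l2Family
  | succ n ih =>
    obtain ⟨h1, h2, k, h3, h4⟩ := h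
    exact ⟨h1, h2, k, ih h3, h4⟩

theorem of_le (h : SobFamily S m f) (hnm : n ≤ m) : SobFamily S n f := by
  induction hnm with
  | refl => exact h
  | step _ ih => exact ih h.pred

theorem l2Family (h : SobFamily S n f) : L2Family f := h.of_le (Nat.zero_le n)

theorem add (hf : SobFamily S n f) (hg : SobFamily S n g) :
    SobFamily S n fun x t => f x t + g x t := by
  induction n generalizing f g with
  | zero => exact L2Family.add hf hg
  | succ n ih =>
    obtain ⟨h1, h2, k, h3, h4⟩ := hf
    obtain ⟨h1', h2', k', h3', h4'⟩ := hg
    exact ⟨h1.add h1', fun x t ht => by simp [h2 x t ht, h2' x t ht], _, ih h3 h3',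
      fun x => (h4 x).add (h4' x)⟩

theorem smul {c : E → ℝ} (hc : ContDiff ℝ ∞ c) (hf : SobFamily S n f) :
    SobFamily S n fun x t => c x * f x t := by
  induction n generalizing f with
  | zero =>
    exact (L2Family.mul hf (CFamily.of_scalar hc)).congr fun x =>
      Filter.Eventually.of_forall fun t => mul_comm _ _
  | succ n ih =>
    obtain ⟨h1, h2, k, h3, h4⟩ := hf
    exact ⟨h1.smul hc, fun x t ht => by simp [h2 x t ht], _, ih h3, fun x => (h4 x).const_mul (c x)⟩

theorem const_mul (c : ℝ) (hf : SobFamily S n f) : SobFamily S n fun x t => c * f x t :=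
  hf.smul contDiff_const

theorem sub (hf : SobFamily S n f) (hg : SobFamily S n g) :
    SobFamily S n fun x t => f x t - g x t :=
  (hf.add (hg.const_mul (-1))).congr fun x t _ => by ring

theorem comp (hf : SobFamily S n f) {φ : E' → E} (hφ : ContDiff ℝ ∞ φ) :
    SobFamily S n fun x => f (φ x) := by
  induction n generalizing f with
  | zero => exact L2Family.comp hf hφ
  | succ n ih =>
    obtain ⟨h1, h2, k, h3, h4⟩ := hf
    exact ⟨h1.comp hφ, fun x => h2 _, _, ih h3, fun x => h4 _⟩

/-- Vanishing on a whole half-line, unlike vanishing at `t`, passes to the derivative, so the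
induction can run on `c` and `deriv c`. -/
theorem of_contDiff {c : ℝ → ℝ} (hc : ContDiff ℝ ∞ c)
    (hS : ∀ t ∈ S, (∀ s ≤ t, c s = 0) ∨ (∀ s ≥ t, c s = 0)) : SobFamily S n fun _ : E => c := by
  induction n generalizing c with
  | zero => exact (CFamily.of_continuous hc.continuous).l2Family
  | succ n ih =>
    have hd : ContDiff ℝ ∞ (deriv c) := (contDiff_infty_iff_deriv.1 hc).2
    have hcl : IsClosed {s | deriv c s = 0} := isClosed_eq hd.continuous continuous_const
    refine ⟨CFamily.of_continuous hc.continuous, fun x t ht => ?_, fun _ => deriv c,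
      ih hd fun t ht => ?_, fun x => IsPrimitive.of_hasDerivAt hd.continuous fun t =>
        (hc.differentiable (by simp) t).hasDerivAt⟩
    · exact (hS t ht.1).elim (fun h => h t le_rfl) fun h => h t le_rfl
    · refine (hS t ht).imp (fun h => ?_) fun h => ?_
      -- The derivative is known to vanish on the open half-line; closedness of its zero set adds
      -- the endpoint `t`.
      · have : closure (Iio t) ⊆ {s | deriv c s = 0} := by
          refine hcl.closure_subset_iff.2 fun s hs => ?_
          have : c =ᶠ[𝓝 s] fun _ => 0 := by
            filter_upwards [Iio_mem_nhds hs] with r hr using h r (le_of_lt hr)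
          simpa using this.deriv_eq
        rw [closure_Iio] at this
        exact fun s hs => this hs
      · have : closure (Ioi t) ⊆ {s | deriv c s = 0} := by
          refine hcl.closure_subset_iff.2 fun s hs => ?_
          have : c =ᶠ[𝓝 s] fun _ => 0 := by
            filter_upwards [Ioi_mem_nhds hs] with r hr using h r (le_of_lt hr)
          simpa using this.deriv_eq
        rw [closure_Ioi] at this
        exact fun s hs => this hs

/-- By the Leibniz rule each summand of a derivative keeps one factor vanishing on `S` and one
vanishing on `S'`. The `max n 1` makes `g` continuous even when `n = 0`, since `L²` is not closed
under products. -/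
theorem mul (hf : SobFamily S n f) (hg : SobFamily S' (max n 1) g) :
    SobFamily (S ∪ S') n fun x t => f x t * g x t := by
  induction n generalizing f g S S' with
  | zero => exact L2Family.mul hf hg.1
  | succ n ih =>
    rw [max_eq_left (by omega)] at hg
    have hf0 := hf
    have hg0 := hg
    obtain ⟨h1, h2, k, h3, h4⟩ := hf
    obtain ⟨h1', h2', k', h3', h4'⟩ := hg
    refine ⟨h1.mul h1', ?_, _, (ih h3 (hg0.of_le (by omega))).add ?_, fun x => (h4 x).mul (h4' x)⟩
    · rintro x t ⟨ht | ht, ht'⟩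
      · simp [h2 x t ⟨ht, ht'⟩]
      · simp [h2' x t ⟨ht, ht'⟩]
    · rw [union_comm]
      exact (ih h3' (hf0.of_le (by omega))).congr fun x t _ => mul_comm _ _

theorem mul_free (hf : SobFamily S n f) (hg : SobFamily ∅ m g) (hnm : n ≤ m) (hm : 1 ≤ m) :
    SobFamily S n fun x t => f x t * g x t := by
  have := hf.mul (hg.of_le (max_le hnm hm))
  rwa [union_empty] at this

theorem of_primitive (hg : SobFamily S n g) (h : ∀ x, IsPrimitive (f x) (g x)) (hf : CFamily f)
    (h0 : ∀ x, ∀ t ∈ S ∩ Icc 0 (2 * Real.pi), f x t = 0) : SobFamily S (n + 1) f :=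
  ⟨hf, h0, g, hg, h⟩

/-- Derivatives are unique almost everywhere, hence everywhere once both are continuous. An explicit
derivative may thus replace the existential one. -/
theorem derivative (hf : SobFamily S (n + 1) f) (h : ∀ x, IsPrimitive (f x) (g x))
    (hg : CFamily g) : SobFamily S n g := by
  cases n with
  | zero => exact hg.l2Family
  | succ n =>
    obtain ⟨h1, h2, k, h3, h4⟩ := hf
    exact h3.congr fun x => eqOn_circle_of_ae (h3.1.continuousOn x) (hg.continuousOn x)
      ((h4 x).unique (h x))

/-- The two hypotheses come with unrelated derivative witnesses; uniqueness of the derivative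
transfers the vanishing on `S'` to the first witness. -/
theorem union (h : SobFamily S n f) (h' : SobFamily S' n f) : SobFamily (S ∪ S') n f := by
  induction n generalizing f with
  | zero => exact h
  | succ n ih =>
    obtain ⟨h1, h2, k, h3, h4⟩ := h
    refine ⟨h1, ?_, k, ?_, h4⟩
    · rintro x t ⟨ht | ht, ht'⟩
      · exact h2 x t ⟨ht, ht'⟩
      · exact h'.2.1 x t ⟨ht, ht'⟩
    · cases n with
      | zero => exact h3
      | succ n => exact ih h3 (h'.derivative h4 h3.1)

/-- Bootstrap on `(e^ψ)' = e^ψ η`: the exponential gains one order over `η`. -/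
theorem exp {ψ η : E → ℝ → ℝ} (hψ : CFamily ψ) (hη : CFamily η)
    (h : ∀ x, IsPrimitive (ψ x) (η x)) (hηn : SobFamily ∅ n η) :
    SobFamily ∅ (n + 1) fun x t => Real.exp (ψ x t) := by
  have hp : ∀ x, IsPrimitive (fun t => Real.exp (ψ x t)) (fun t => Real.exp (ψ x t) * η x t) :=
    fun x => (h x).comp (φ' := Real.exp) (hη.continuousOn x) (fun t _ => Real.hasDerivAt_exp _)
      (hψ.exp.continuousOn x)
  induction n with
  | zero => exact of_primitive (hψ.exp.mul hη).l2Family hp hψ.exp (by simp)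
  | succ n ih =>
    exact of_primitive ((ih hηn.pred).mul_free hηn le_rfl (by omega)) hp hψ.exp (by simp)

/-- In `(e^{ψ₁} - e^{ψ₂})' = (η₁ - η₂) e^{ψ₁} + (e^{ψ₁} - e^{ψ₂}) η₂` every term has a factor that
vanishes on `S`, so the order of contact can be bootstrapped. -/
theorem exp_sub_exp {ψ₁ η₁ ψ₂ η₂ : E → ℝ → ℝ} (hψ₁ : CFamily ψ₁) (hη₁ : CFamily η₁)
    (h₁ : ∀ x, IsPrimitive (ψ₁ x) (η₁ x)) (hψ₂ : CFamily ψ₂) (hη₂ : CFamily η₂)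
    (h₂ : ∀ x, IsPrimitive (ψ₂ x) (η₂ x)) (hη₁n : SobFamily ∅ n η₁) (hη₂n : SobFamily ∅ n η₂)
    (hη : SobFamily S n fun x t => η₁ x t - η₂ x t)
    (hψ : ∀ x, ∀ t ∈ S ∩ Icc 0 (2 * Real.pi), ψ₁ x t - ψ₂ x t = 0) :
    SobFamily S (n + 1) fun x t => Real.exp (ψ₁ x t) - Real.exp (ψ₂ x t) := by
  have hp : ∀ x, IsPrimitive (fun t => Real.exp (ψ₁ x t) - Real.exp (ψ₂ x t))
      (fun t => (η₁ x t - η₂ x t) * Real.exp (ψ₁ x t) +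
        (Real.exp (ψ₁ x t) - Real.exp (ψ₂ x t)) * η₂ x t) := fun x => by
    have a₁ := (h₁ x).comp (φ' := Real.exp) (hη₁.continuousOn x)
      (fun t _ => Real.hasDerivAt_exp _) (hψ₁.exp.continuousOn x)
    have a₂ := (h₂ x).comp (φ' := Real.exp) (hη₂.continuousOn x)
      (fun t _ => Real.hasDerivAt_exp _) (hψ₂.exp.continuousOn x)
    refine (a₁.add (a₂.const_mul (-1))).congr (fun t _ => by ring)
      (Filter.Eventually.of_forall fun t => by ring)
  have h0 : ∀ x, ∀ t ∈ S ∩ Icc 0 (2 * Real.pi), Real.exp (ψ₁ x t) - Real.exp (ψ₂ x t) = 0 :=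
    fun x t ht => by rw [sub_eq_zero.1 (hψ x t ht), sub_self]
  have hc := hψ₁.exp.sub hψ₂.exp
  induction n with
  | zero =>
    exact of_primitive (((hη₁.sub hη₂).mul hψ₁.exp).add (hc.mul hη₂)).l2Family hp hc h0
  | succ n ih =>
    exact of_primitive ((hη.mul_free (exp hψ₁ hη₁ h₁ hη₁n.pred) le_rfl (by omega)).add
      ((ih hη₁n.pred hη₂n.pred hη.pred).mul_free hη₂n le_rfl (by omega))) hp hc h0

end SobFamily

end Families

end

noncomputable section

/-! ### The linear equation `v'' = q v + g` -/

namespace CircleC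

/-- The primitive `f ↦ ∫₀ᵗ f` of a continuous function. -/
def primitive : CircleC →L[ℝ] CircleC := volterra ∘L toL2

theorem primitive_apply {F : CircleC} {f : ℝ → ℝ}
    (h : ∀ t (ht : t ∈ Icc 0 (2 * Real.pi)), F ⟨t, ht⟩ = f t) (t : Icc (0 : ℝ) (2 * Real.pi)) :
    primitive F t = ∫ s in (0 : ℝ)..t, f s := by
  refine (volterra_apply _ t).trans ?_
  refine intervalIntegral_congr_circle ((coeFn_toL2 F).trans (ae_circle_of_forall fun s hs => ?_))
    left_mem_circle t.2
  rw [ext_apply _ hs, h]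

/-- Integrating `tⁿ/n!`. Two applications per power of `secondPrimitive` produce the `(2n)!` of the
norm estimate. -/
theorem abs_primitive_le {F : CircleC} {K : ℝ} {n : ℕ}
    (h : ∀ t : Icc (0 : ℝ) (2 * Real.pi), |F t| ≤ K * ((t : ℝ) ^ n / n.factorial))
    (t : Icc (0 : ℝ) (2 * Real.pi)) :
    |primitive F t| ≤ K * ((t : ℝ) ^ (n + 1) / (n + 1).factorial) := by
  rw [primitive_apply (f := F.ext) fun s hs => (F.ext_apply hs).symm]
  have : ∀ s ∈ Ioc (0 : ℝ) t, ‖F.ext s‖ ≤ K * (s ^ n / n.factorial) := fun s hs => by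
    have hs' : s ∈ Icc 0 (2 * Real.pi) := ⟨hs.1.le, hs.2.trans t.2.2⟩
    rw [ext_apply _ hs']
    exact h ⟨s, hs'⟩
  have hi := intervalIntegral.norm_integral_le_of_norm_le t.2.1
    (Filter.Eventually.of_forall this)
    (Continuous.intervalIntegrable (μ := volume) (by fun_prop) 0 (t : ℝ))
  refine hi.trans (le_of_eq ?_)
  rw [intervalIntegral.integral_const_mul, intervalIntegral.integral_div, integral_pow,
    Nat.factorial_succ]
  push_cast
  have : (n.factorial : ℝ) ≠ 0 := by positivity
  have : (n + 1 : ℝ) ≠ 0 := by positivity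
  simp only [ne_eq, Nat.add_eq_zero_iff, one_ne_zero, and_false,
    not_false_eq_true, zero_pow, sub_zero]
  field_simp

/-- The operator `v ↦ ∫₀ᵗ ∫₀ˢ q v`. -/
def secondPrimitive (q : CircleC) : CircleC →L[ℝ] CircleC :=
  primitive ∘L primitive ∘L ContinuousLinearMap.mul ℝ CircleC q

theorem contDiff_secondPrimitive : ContDiff ℝ ∞ secondPrimitive := by
  have h : ContDiff ℝ ∞ fun q => ContinuousLinearMap.mul ℝ CircleC q :=
    ContinuousLinearMap.contDiff (E := CircleC) (F := CircleC →L[ℝ] CircleC) _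
  exact contDiff_const.clm_comp (contDiff_const.clm_comp h)

theorem abs_secondPrimitive_pow_le (q f : CircleC) (n : ℕ) (t : Icc (0 : ℝ) (2 * Real.pi)) :
    |(secondPrimitive q ^ n) f t| ≤
      (‖q‖ ^ n * ‖f‖) * ((t : ℝ) ^ (2 * n) / (2 * n).factorial) := by
  induction n generalizing t with
  | zero => simpa using f.norm_coe_le_norm t
  | succ n ih =>
    rw [pow_succ' (secondPrimitive q)]
    refine abs_primitive_le (n := 2 * n + 1) (abs_primitive_le (n := 2 * n) fun s => ?_) t
    change |q s * (secondPrimitive q ^ n) f s| ≤ _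
    rw [abs_mul, pow_succ', mul_assoc, mul_assoc, ← mul_assoc (‖q‖ ^ n)]
    exact mul_le_mul (q.norm_coe_le_norm s) (ih s) (abs_nonneg _) (norm_nonneg _)

/-- The powers `Kⁿ` tend to zero like `x^{2n}/(2n)!`, so `1 - Kⁿ` is invertible for some `n`. It is
the product of `1 - K` with the commuting sum `1 + K + … + K^{n-1}`, so `1 - K` is invertible too,
with no smallness assumption on `q`. -/
theorem isUnit_one_sub_secondPrimitive (q : CircleC) : IsUnit (1 - secondPrimitive q) := by
  have hb : ∀ n, ‖secondPrimitive q ^ n‖ ≤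
      ((1 + ‖q‖) * (2 * Real.pi)) ^ (2 * n) / (2 * n).factorial := fun n => by
    refine ContinuousLinearMap.opNorm_le_bound _ (by positivity) fun f => ?_
    refine (ContinuousMap.norm_le _ (by positivity)).2 fun t => ?_
    refine (abs_secondPrimitive_pow_le q f n t).trans ?_
    have h1 : (t : ℝ) ^ (2 * n) ≤ (2 * Real.pi) ^ (2 * n) := pow_le_pow_left₀ t.2.1 t.2.2 _
    have h2 : ‖q‖ ^ n ≤ (1 + ‖q‖) ^ (2 * n) := by
      refine (pow_le_pow_left₀ (norm_nonneg q) (by linarith) n).trans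
        (pow_le_pow_right₀ (by linarith [norm_nonneg q]) (by omega))
    calc _ ≤ ((1 + ‖q‖) ^ (2 * n) * ‖f‖) * ((2 * Real.pi) ^ (2 * n) / (2 * n).factorial) := by
          have : 0 ≤ (t : ℝ) := t.2.1
          gcongr
      _ = _ := by rw [mul_pow (1 + ‖q‖)]; ring
  have hlim : Filter.Tendsto (fun n : ℕ => ‖secondPrimitive q ^ n‖) Filter.atTop (𝓝 0) := by
    refine squeeze_zero (fun n => norm_nonneg (secondPrimitive q ^ n)) hb ?_
    exact (FloorSemiring.tendsto_pow_div_factorial_atTop ((1 + ‖q‖) * (2 * Real.pi))).comp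
      (Filter.tendsto_id.const_mul_atTop' (by norm_num : 0 < 2))
  obtain ⟨n, hn⟩ := (hlim.eventually (gt_mem_nhds one_pos)).exists
  have hu : IsUnit (1 - secondPrimitive q ^ n) :=
    isUnit_one_sub_of_norm_lt_one (R := CircleC →L[ℝ] CircleC) hn
  rw [← mul_neg_geom_sum] at hu
  refine ((Commute.isUnit_mul_iff ?_).1 hu).1
  exact Commute.sum_right _ _ _ fun i _ =>
    (Commute.one_left _).sub_left ((Commute.refl _).pow_right i)

end CircleC

theorem eqOn_zero_of_linear_ode {q v d : ℝ → ℝ} (hq : ContinuousOn q (Icc 0 (2 * Real.pi)))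
    (hv : IsPrimitive v d) (hd : IsPrimitive d fun t => q t * v t) (h0 : v 0 = 0) (h1 : d 0 = 0) :
    EqOn v (fun _ => 0) (Icc 0 (2 * Real.pi)) := by
  let Q : CircleC := ⟨_, hq.domRestrict⟩
  let V : CircleC := ⟨_, hv.continuousOn.domRestrict⟩
  have e : (1 - CircleC.secondPrimitive Q) V = 0 := by
    ext t
    have e1 : ∀ t : Icc (0 : ℝ) (2 * Real.pi), CircleC.primitive (Q * V) t = d t := fun t => by
      rw [CircleC.primitive_apply (f := fun s => q s * v s) fun _ _ => rfl, hd.2 t t.2, h1, zero_add]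
    have e2 : CircleC.primitive (CircleC.primitive (Q * V)) t = v t := by
      rw [CircleC.primitive_apply (f := d) fun s hs => e1 ⟨s, hs⟩, hv.2 t t.2, h0, zero_add]
    change v t - CircleC.primitive (CircleC.primitive (Q * V)) t = 0
    rw [e2, sub_self]
  obtain ⟨W, hW⟩ := CircleC.isUnit_one_sub_secondPrimitive Q
  have hV : V = 0 := by
    have : (↑W⁻¹ * ↑W : CircleC →L[ℝ] CircleC) V = 0 := by
      rw [mul_apply_eq_comp, hW, e, map_zero]
    simpa using this
  intro t ht
  exact congrArg (fun F : CircleC => F ⟨t, ht⟩) hV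

theorem linear_ode_unique {q v d v' d' g : ℝ → ℝ} (hq : ContinuousOn q (Icc 0 (2 * Real.pi)))
    (hv : IsPrimitive v d) (hd : IsPrimitive d fun t => q t * v t + g t)
    (hv' : IsPrimitive v' d') (hd' : IsPrimitive d' fun t => q t * v' t + g t)
    (h0 : v 0 = v' 0) (h1 : d 0 = d' 0) :
    EqOn v v' (Icc 0 (2 * Real.pi)) ∧ EqOn d d' (Icc 0 (2 * Real.pi)) := by
  have a := hv.add (hv'.const_mul (-1))
  have b := (hd.add (hd'.const_mul (-1))).congr (fun _ _ => rfl)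
    (g' := fun t => q t * (v t + -1 * v' t)) (Filter.Eventually.of_forall fun t => by ring)
  have := eqOn_zero_of_linear_ode hq a b (by rw [h0]; ring) (by rw [h1]; ring)
  have hvv : EqOn v v' (Icc 0 (2 * Real.pi)) := fun t ht => by
    have := this ht
    simp only at this
    linarith
  refine ⟨hvv, hd.eqOn hd' (ae_circle_of_forall fun t ht => ?_) left_mem_circle h1⟩
  simp only [hvv ht]

/-- Integrated twice, the equation reads `(1 - K_q) v = α + β t + ∫∫ g` with `K_q` the operator
`secondPrimitive`. Both sides depend smoothly on the parameter, and so does inversion in the algebra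
of operators. -/
theorem exists_linear_solution {E : Type*} [NormedAddCommGroup E] [NormedSpace ℝ E]
    {q g : E → ℝ → ℝ} (hq : CFamily q) (hg : L2Family g) {α β : E → ℝ} (hα : ContDiff ℝ ∞ α)
    (hβ : ContDiff ℝ ∞ β) : ∃ v d : E → ℝ → ℝ, CFamily v ∧ CFamily d ∧
      (∀ x, IsPrimitive (v x) (d x)) ∧
      (∀ x, IsPrimitive (d x) fun t => q x t * v x t + g x t) ∧
      (∀ x, v x 0 = α x) ∧ ∀ x, d x 0 = β x := by
  have hg1 : CFamily fun x t => β x + ∫ s in (0 : ℝ)..t, g x s :=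
    (CFamily.of_scalar hβ).add hg.integral
  have hf := (CFamily.of_scalar hα).add hg1.l2Family.integral
  obtain ⟨Q, hQ, hq'⟩ := hq
  obtain ⟨F, hF, hf⟩ := hf
  have hu := fun x => CircleC.isUnit_one_sub_secondPrimitive (Q x)
  let V : E → CircleC := fun x => Ring.inverse (1 - CircleC.secondPrimitive (Q x)) (F x)
  have hV : ContDiff ℝ ∞ V := by
    refine ContDiff.clm_apply (contDiff_iff_contDiffAt.2 fun x => ?_) hF
    have := contDiffAt_ringInverse (R := CircleC →L[ℝ] CircleC) (n := ∞) ℝ (hu x).unit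
    exact this.comp x (contDiff_const.sub (CircleC.contDiff_secondPrimitive.comp hQ)).contDiffAt
  have hVe : ∀ x, V x = F x + CircleC.primitive (CircleC.primitive (Q x * V x)) := fun x => by
    have h := congrArg (fun T : CircleC →L[ℝ] CircleC => T (F x))
      (Ring.mul_inverse_cancel _ (hu x))
    have h' : V x - CircleC.primitive (CircleC.primitive (Q x * V x)) = F x := h
    rw [← h', sub_add_cancel]
  let v : E → ℝ → ℝ := fun x => (V x).ext
  have hv : CFamily v := ⟨V, hV, fun x t ht => ((V x).ext_apply ht).symm⟩
  have hq : CFamily q := ⟨Q, hQ, hq'⟩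
  have hqv : L2Family fun x t => q x t * v x t := (hq.mul hv).l2Family
  let d : E → ℝ → ℝ := fun x t =>
    (β x + ∫ s in (0 : ℝ)..t, g x s) + ∫ s in (0 : ℝ)..t, q x s * v x s
  have hd : CFamily d := hg1.add hqv.integral
  have hvd : ∀ x, ∀ t ∈ Icc 0 (2 * Real.pi), v x t = α x + ∫ s in (0 : ℝ)..t, d x s := by
    intro x t ht
    have e := congrArg (fun G : CircleC => G ⟨t, ht⟩) (hVe x)
    simp only [ContinuousMap.add_apply, hf] at e
    rw [CircleC.primitive_apply (f := fun t => ∫ s in (0 : ℝ)..t, q x s * v x s) fun s hs => by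
      rw [CircleC.primitive_apply (f := fun s => q x s * v x s)]
      intro r hr
      rw [ContinuousMap.mul_apply, hq', ← CircleC.ext_apply]] at e
    simp only [v, d]
    rw [CircleC.ext_apply _ ht, e, intervalIntegral.integral_add
      ((hg1.l2Family.intervalIntegrable x).mono_circle left_mem_circle ht)
      ((hqv.integral.l2Family.intervalIntegrable x).mono_circle left_mem_circle ht), add_assoc]
  refine ⟨v, d, hv, hd, fun x => ⟨hd.l2Family.intervalIntegrable x, fun t ht => ?_⟩,
    fun x => ⟨(hqv.add hg).intervalIntegrable x, fun t ht => ?_⟩, fun x => ?_, fun x => ?_⟩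
  · rw [hvd x t ht, hvd x 0 left_mem_circle]
    simp
  · simp only [d]
    rw [intervalIntegral.integral_add]
    · simp only [intervalIntegral.integral_same]
      ring
    · exact (hqv.intervalIntegrable x).mono_circle left_mem_circle ht
    · exact (hg.intervalIntegrable x).mono_circle left_mem_circle ht
  · rw [hvd x 0 left_mem_circle]
    simp
  · simp [d]

theorem wronskian_eq {q v d v' d' : ℝ → ℝ} (hv : IsPrimitive v d)
    (hd : IsPrimitive d fun t => q t * v t) (hv' : IsPrimitive v' d')
    (hd' : IsPrimitive d' fun t => q t * v' t) {s t : ℝ} (hs : s ∈ Icc 0 (2 * Real.pi))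
    (ht : t ∈ Icc 0 (2 * Real.pi)) : v t * d' t - d t * v' t = v s * d' s - d s * v' s := by
  have a := ((hv.mul hd').add ((hd.mul hv').const_mul (-1))).congr (fun _ _ => rfl)
    (g' := fun _ => 0) (Filter.Eventually.of_forall fun t => by ring)
  have := a.sub_eq_integral hs ht
  rw [intervalIntegral.integral_zero] at this
  linarith

end

noncomputable section

/-! ### The Kepler transform of a potential -/

/-- The second order equation `ψ'' = ψ'² / 2 - 2 e^{2ψ} - 2q` satisfied by `ψ = log θ'`, where `θ`
is the polar angle of the plane curve formed by two solutions of `v'' = q v` of Wronskian one. -/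
def KeplerEq (q ψ η : ℝ → ℝ) : Prop :=
  IsPrimitive ψ η ∧ IsPrimitive η fun t => η t ^ 2 / 2 - 2 * Real.exp (2 * ψ t) - 2 * q t

/-- Here `ψ = -log |w|²` for the plane curve `w = (w₁, w₂)`, which avoids the origin because its
Wronskian is one. -/
theorem keplerEq_of_linear {q w₁ u₁ w₂ u₂ : ℝ → ℝ}
    (h₁ : IsPrimitive w₁ u₁) (h₁' : IsPrimitive u₁ fun t => q t * w₁ t)
    (h₂ : IsPrimitive w₂ u₂) (h₂' : IsPrimitive u₂ fun t => q t * w₂ t)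
    (hW : ∀ t ∈ Icc 0 (2 * Real.pi), w₁ t * u₂ t - u₁ t * w₂ t = 1) :
    KeplerEq q (fun t => -Real.log (w₁ t ^ 2 + w₂ t ^ 2))
      (fun t => -2 * (w₁ t * u₁ t + w₂ t * u₂ t) * (w₁ t ^ 2 + w₂ t ^ 2)⁻¹) := by
  have hm : ∀ t ∈ Icc 0 (2 * Real.pi), w₁ t ^ 2 + w₂ t ^ 2 ≠ 0 := fun t ht h0 => by
    have h1 : w₁ t = 0 := by nlinarith [sq_nonneg (w₁ t), sq_nonneg (w₂ t)]
    have h2 : w₂ t = 0 := by nlinarith [sq_nonneg (w₁ t), sq_nonneg (w₂ t)]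
    have := hW t ht
    simp [h1, h2] at this
  have pm : IsPrimitive (fun t => w₁ t ^ 2 + w₂ t ^ 2)
      (fun t => 2 * (w₁ t * u₁ t + w₂ t * u₂ t)) :=
    ((h₁.mul h₁).add (h₂.mul h₂)).congr (fun t _ => by ring)
      (Filter.Eventually.of_forall fun t => by ring)
  have pP := ((h₁.mul h₁').add (h₂.mul h₂')).const_mul (-2)
  have cw₁ := h₁.continuousOn
  have cw₂ := h₂.continuousOn
  have cu₁ := h₁'.continuousOn
  have cu₂ := h₂'.continuousOn
  have cP : ContinuousOn (fun t => 2 * (w₁ t * u₁ t + w₂ t * u₂ t)) (Icc 0 (2 * Real.pi)) := by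
    fun_prop
  have pinv := pm.comp (φ := fun y => y⁻¹) (φ' := fun y => -(y ^ 2)⁻¹) cP
    (fun t ht => by simpa [neg_div] using hasDerivAt_inv (hm t ht))
    ((ContinuousOn.inv₀ (by fun_prop) fun t ht => pow_ne_zero 2 (hm t ht)).neg)
  refine ⟨(pm.comp (φ := fun y => -Real.log y) (φ' := fun y => -y⁻¹) cP
      (fun t ht => (Real.hasDerivAt_log (hm t ht)).neg)
      ((ContinuousOn.inv₀ (by fun_prop) hm).neg)).congr (fun t _ => rfl)
        (Filter.Eventually.of_forall fun t => by ring), ?_⟩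
  refine (pP.mul pinv).congr (fun t _ => by ring) (ae_circle_of_forall fun t ht => ?_)
  have h0 := hm t ht
  have hpos : 0 < w₁ t ^ 2 + w₂ t ^ 2 := lt_of_le_of_ne (by positivity) (Ne.symm h0)
  have e : Real.exp (2 * -Real.log (w₁ t ^ 2 + w₂ t ^ 2)) = ((w₁ t ^ 2 + w₂ t ^ 2) ^ 2)⁻¹ := by
    rw [show 2 * -Real.log (w₁ t ^ 2 + w₂ t ^ 2) = -(Real.log ((w₁ t ^ 2 + w₂ t ^ 2) ^ 2)) by
      rw [Real.log_pow]; push_cast; ring, Real.exp_neg, Real.exp_log (by positivity)]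
  have hw := hW t ht
  simp only [e]
  field_simp
  -- Lagrange's identity `(w·u)² + W² = |w|² |u|²` is what remains, with the Wronskian `W` equal to
  -- one.
  have hw2 : (w₁ t * u₂ t - u₁ t * w₂ t) ^ 2 = 1 := by rw [hw]; norm_num
  linear_combination -hw2

/-- Polar form `e^{-ψ/2} (cos θ, sin θ)` with `θ' = e^ψ`. The tangential part of the acceleration
vanishes by the area law, and the radial part is `q` by the equation for `ψ`. -/
theorem linear_of_keplerEq {q ψ η : ℝ → ℝ} (h : KeplerEq q ψ η) :
    ∃ θ w₁ u₁ w₂ u₂ : ℝ → ℝ, (∀ t, θ t = ∫ s in (0 : ℝ)..t, Real.exp (ψ s)) ∧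
      IsPrimitive w₁ u₁ ∧ IsPrimitive u₁ (fun t => q t * w₁ t) ∧
      IsPrimitive w₂ u₂ ∧ IsPrimitive u₂ (fun t => q t * w₂ t) ∧
      (∀ t, w₁ t = Real.exp (-ψ t / 2) * Real.cos (θ t)) ∧
      (∀ t, w₂ t = Real.exp (-ψ t / 2) * Real.sin (θ t)) ∧
      (∀ t, u₁ t = -η t / 2 * (Real.exp (-ψ t / 2) * Real.cos (θ t)) -
        Real.exp (ψ t / 2) * Real.sin (θ t)) ∧
      (∀ t, u₂ t = -η t / 2 * (Real.exp (-ψ t / 2) * Real.sin (θ t)) +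
        Real.exp (ψ t / 2) * Real.cos (θ t)) := by
  obtain ⟨hψ, hη⟩ := h
  have cψ := hψ.continuousOn
  have cη := hη.continuousOn
  have cE : ContinuousOn (fun t => Real.exp (ψ t)) (Icc 0 (2 * Real.pi)) := by fun_prop
  have pθ := IsPrimitive.integral cE.intervalIntegrable_circle
  set θ : ℝ → ℝ := fun t => ∫ s in (0 : ℝ)..t, Real.exp (ψ s) with hθ
  have cθ := pθ.continuousOn
  have pc := pθ.comp (φ := Real.cos) (φ' := fun y => -Real.sin y) cE
    (fun t _ => Real.hasDerivAt_cos _) (by fun_prop)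
  have ps := pθ.comp (φ := Real.sin) (φ' := Real.cos) cE
    (fun t _ => Real.hasDerivAt_sin _) (by fun_prop)
  have p1 := hψ.comp (φ := fun y => Real.exp (-y / 2)) (φ' := fun y => -1 / 2 * Real.exp (-y / 2)) cη
    (fun t _ => by
      have := ((hasDerivAt_id (ψ t)).neg.div_const 2).exp
      simpa [mul_comm] using this) (by fun_prop)
  have p2 := hψ.comp (φ := fun y => Real.exp (y / 2)) (φ' := fun y => 1 / 2 * Real.exp (y / 2)) cη
    (fun t _ => by
      have := ((hasDerivAt_id (ψ t)).div_const 2).exp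
      simpa [mul_comm] using this) (by fun_prop)
  have e1 : ∀ t, Real.exp (-ψ t / 2) * Real.exp (ψ t) = Real.exp (ψ t / 2) := fun t => by
    rw [← Real.exp_add]; ring_nf
  have e2 : ∀ t, Real.exp (ψ t / 2) * Real.exp (ψ t) =
      Real.exp (2 * ψ t) * Real.exp (-ψ t / 2) := fun t => by
    rw [← Real.exp_add, ← Real.exp_add]; ring_nf
  refine ⟨θ, fun t => Real.exp (-ψ t / 2) * Real.cos (θ t),
    fun t => -η t / 2 * (Real.exp (-ψ t / 2) * Real.cos (θ t)) - Real.exp (ψ t / 2) * Real.sin (θ t),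
    fun t => Real.exp (-ψ t / 2) * Real.sin (θ t),
    fun t => -η t / 2 * (Real.exp (-ψ t / 2) * Real.sin (θ t)) + Real.exp (ψ t / 2) * Real.cos (θ t),
    fun t => rfl, ?_, ?_, ?_, ?_, fun t => rfl, fun t => rfl, fun t => rfl, fun t => rfl⟩
  · refine (p1.mul pc).congr (fun _ _ => rfl) (Filter.Eventually.of_forall fun t => ?_)
    simp only
    linear_combination -Real.sin (θ t) * e1 t
  · refine (((hη.const_mul (-1 / 2)).mul (p1.mul pc)).add ((p2.mul ps).const_mul (-1))).congr
      (fun t _ => by ring) (Filter.Eventually.of_forall fun t => ?_)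
    simp only
    linear_combination (η t / 2 * Real.sin (θ t)) * e1 t - Real.cos (θ t) * e2 t
  · refine (p1.mul ps).congr (fun _ _ => rfl) (Filter.Eventually.of_forall fun t => ?_)
    simp only
    linear_combination Real.cos (θ t) * e1 t
  · refine (((hη.const_mul (-1 / 2)).mul (p1.mul ps)).add (p2.mul pc)).congr
      (fun t _ => by ring) (Filter.Eventually.of_forall fun t => ?_)
    simp only
    linear_combination (-η t / 2 * Real.cos (θ t)) * e1 t - Real.sin (θ t) * e2 t

/-- Reduced to uniqueness for the linear equation: equal data for `ψ` give equal data for the plane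
curves, and `w₁² + w₂² = e^{-ψ}` recovers `ψ`. -/
theorem keplerEq_unique {q ψ η ψ' η' : ℝ → ℝ} (hq : ContinuousOn q (Icc 0 (2 * Real.pi)))
    (h : KeplerEq q ψ η) (h' : KeplerEq q ψ' η') (h0 : ψ 0 = ψ' 0) (h1 : η 0 = η' 0) :
    EqOn ψ ψ' (Icc 0 (2 * Real.pi)) ∧ EqOn η η' (Icc 0 (2 * Real.pi)) := by
  obtain ⟨θ, w₁, u₁, w₂, u₂, hθ, a1, a2, a3, a4, b1, b2, b3, b4⟩ := linear_of_keplerEq h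
  obtain ⟨θ', w₁', u₁', w₂', u₂', hθ', a1', a2', a3', a4', b1', b2', b3', b4'⟩ :=
    linear_of_keplerEq h'
  have t0 : θ 0 = 0 := by rw [hθ, intervalIntegral.integral_same]
  have t0' : θ' 0 = 0 := by rw [hθ', intervalIntegral.integral_same]
  have z : ∀ {u w : ℝ → ℝ}, IsPrimitive u (fun t => q t * w t) →
      IsPrimitive u (fun t => q t * w t + (fun _ => (0 : ℝ)) t) := fun h => by simpa using h
  have e1 := (linear_ode_unique hq a1 (z a2) a1' (z a2') (by rw [b1, b1', h0, t0, t0'])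
    (by rw [b3, b3', h0, h1, t0, t0'])).1
  have e2 := (linear_ode_unique hq a3 (z a4) a3' (z a4') (by rw [b2, b2', h0, t0, t0'])
    (by rw [b4, b4', h0, h1, t0, t0'])).1
  have hψ : EqOn ψ ψ' (Icc 0 (2 * Real.pi)) := fun t ht => by
    have k : ∀ x y : ℝ, (Real.exp (-x / 2) * Real.cos y) ^ 2 + (Real.exp (-x / 2) * Real.sin y) ^ 2
        = Real.exp (-x) := fun x y => by
      rw [mul_pow, mul_pow, ← mul_add, Real.cos_sq_add_sin_sq, mul_one, ← Real.exp_nat_mul]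
      congr 1
      push_cast
      ring
    have := k (ψ t) (θ t)
    rw [← b1, ← b2, e1 ht, e2 ht, b1', b2', k, Real.exp_eq_exp] at this
    linarith
  refine ⟨hψ, eqOn_circle_of_ae h.2.continuousOn h'.2.continuousOn ?_⟩
  exact (h.1.congr hψ ae_eq_rfl).unique h'.1

/-! ### Kepler transforms of smooth families of potentials -/

section Families

variable {E : Type*} [NormedAddCommGroup E] [NormedSpace ℝ E]

/-- The equation for `ψ` is nonlinear, yet it has solutions on the whole interval, smooth in all
data, since they come from the linear equation. -/
theorem exists_kepler {q : E → ℝ → ℝ} (hq : CFamily q) {t₀ : ℝ} (ht₀ : t₀ ∈ Icc 0 (2 * Real.pi))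
    {α β : E → ℝ} (hα : ContDiff ℝ ∞ α) (hβ : ContDiff ℝ ∞ β) :
    ∃ ψ η : E → ℝ → ℝ, CFamily ψ ∧ CFamily η ∧ (∀ x, KeplerEq (q x) (ψ x) (η x)) ∧
      (∀ x, ψ x t₀ = α x) ∧ ∀ x, η x t₀ = β x := by
  have z : L2Family fun (_ : E) (_ : ℝ) => (0 : ℝ) := (CFamily.of_scalar contDiff_const).l2Family
  obtain ⟨v₁, d₁, cv₁, cd₁, hv₁, hd₁, i₁, j₁⟩ :=
    exists_linear_solution hq z (α := fun _ => 1) (β := fun _ => 0) contDiff_const contDiff_const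
  obtain ⟨v₂, d₂, cv₂, cd₂, hv₂, hd₂, i₂, j₂⟩ :=
    exists_linear_solution hq z (α := fun _ => 0) (β := fun _ => 1) contDiff_const contDiff_const
  simp only [add_zero] at hd₁ hd₂
  have W : ∀ x, v₁ x t₀ * d₂ x t₀ - d₁ x t₀ * v₂ x t₀ = 1 := fun x => by
    rw [wronskian_eq (hv₁ x) (hd₁ x) (hv₂ x) (hd₂ x) left_mem_circle ht₀, i₁, i₂, j₁, j₂]
    norm_num
  -- Coefficients that give the data `w₁ = e^{-α/2}`, `u₁ = -(β/2) e^{-α/2}`, `w₂ = 0`, `u₂ =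
  -- e^{α/2}` at `t₀`. They are found by inverting the fundamental matrix there, which has
  -- determinant one. These data have Wronskian one and give `ψ = α`, `η = β`.
  let A : E → ℝ := fun x => Real.exp (-α x / 2) * d₂ x t₀ + β x / 2 * Real.exp (-α x / 2) * v₂ x t₀
  let B : E → ℝ := fun x => -Real.exp (-α x / 2) * d₁ x t₀ - β x / 2 * Real.exp (-α x / 2) * v₁ x t₀
  let C : E → ℝ := fun x => -Real.exp (α x / 2) * v₂ x t₀
  let D : E → ℝ := fun x => Real.exp (α x / 2) * v₁ x t₀
  have sv₁ := cv₁.contDiff_eval ht₀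
  have sv₂ := cv₂.contDiff_eval ht₀
  have sd₁ := cd₁.contDiff_eval ht₀
  have sd₂ := cd₂.contDiff_eval ht₀
  have hA : ContDiff ℝ ∞ A := by fun_prop
  have hB : ContDiff ℝ ∞ B := by fun_prop
  have hC : ContDiff ℝ ∞ C := by fun_prop
  have hD : ContDiff ℝ ∞ D := by fun_prop
  let w₁ : E → ℝ → ℝ := fun x t => A x * v₁ x t + B x * v₂ x t
  let u₁ : E → ℝ → ℝ := fun x t => A x * d₁ x t + B x * d₂ x t
  let w₂ : E → ℝ → ℝ := fun x t => C x * v₁ x t + D x * v₂ x t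
  let u₂ : E → ℝ → ℝ := fun x t => C x * d₁ x t + D x * d₂ x t
  have cw₁ : CFamily w₁ := (cv₁.smul hA).add (cv₂.smul hB)
  have cu₁ : CFamily u₁ := (cd₁.smul hA).add (cd₂.smul hB)
  have cw₂ : CFamily w₂ := (cv₁.smul hC).add (cv₂.smul hD)
  have cu₂ : CFamily u₂ := (cd₁.smul hC).add (cd₂.smul hD)
  have p₁ : ∀ x, IsPrimitive (w₁ x) (u₁ x) := fun x =>
    ((hv₁ x).const_mul (A x)).add ((hv₂ x).const_mul (B x))
  have p₂ : ∀ x, IsPrimitive (w₂ x) (u₂ x) := fun x =>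
    ((hv₁ x).const_mul (C x)).add ((hv₂ x).const_mul (D x))
  have p₁' : ∀ x, IsPrimitive (u₁ x) fun t => q x t * w₁ x t := fun x =>
    (((hd₁ x).const_mul (A x)).add ((hd₂ x).const_mul (B x))).congr (fun _ _ => rfl)
      (Filter.Eventually.of_forall fun t => by simp only [w₁]; ring)
  have p₂' : ∀ x, IsPrimitive (u₂ x) fun t => q x t * w₂ x t := fun x =>
    (((hd₁ x).const_mul (C x)).add ((hd₂ x).const_mul (D x))).congr (fun _ _ => rfl)
      (Filter.Eventually.of_forall fun t => by simp only [w₂]; ring)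
  have e : ∀ x, Real.exp (-α x / 2) * Real.exp (α x / 2) = 1 := fun x => by
    rw [← Real.exp_add]; ring_nf; exact Real.exp_zero
  have w₁0 : ∀ x, w₁ x t₀ = Real.exp (-α x / 2) := fun x => by
    simp only [w₁, A, B]
    linear_combination Real.exp (-α x / 2) * W x
  have u₁0 : ∀ x, u₁ x t₀ = -β x / 2 * Real.exp (-α x / 2) := fun x => by
    simp only [u₁, A, B]
    linear_combination -β x / 2 * Real.exp (-α x / 2) * W x
  have w₂0 : ∀ x, w₂ x t₀ = 0 := fun x => by
    simp only [w₂, C, D]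
    ring
  have u₂0 : ∀ x, u₂ x t₀ = Real.exp (α x / 2) := fun x => by
    simp only [u₂, C, D]
    linear_combination Real.exp (α x / 2) * W x
  have hW : ∀ x, ∀ t ∈ Icc 0 (2 * Real.pi), w₁ x t * u₂ x t - u₁ x t * w₂ x t = 1 := fun x t ht => by
    rw [wronskian_eq (p₁ x) (p₁' x) (p₂ x) (p₂' x) ht₀ ht, w₁0, w₂0, u₂0, mul_zero, sub_zero, e]
  have hm : ∀ x, ∀ t ∈ Icc 0 (2 * Real.pi), w₁ x t ^ 2 + w₂ x t ^ 2 ≠ 0 := fun x t ht h0 => by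
    have h1 : w₁ x t = 0 := by nlinarith [sq_nonneg (w₁ x t), sq_nonneg (w₂ x t)]
    have h2 : w₂ x t = 0 := by nlinarith [sq_nonneg (w₁ x t), sq_nonneg (w₂ x t)]
    have := hW x t ht
    simp [h1, h2] at this
  have K := fun x => keplerEq_of_linear (p₁ x) (p₁' x) (p₂ x) (p₂' x) (hW x)
  have cm : CFamily fun x t => w₁ x t ^ 2 + w₂ x t ^ 2 :=
    ((cw₁.mul cw₁).add (cw₂.mul cw₂)).congr fun x t _ => by ring
  have cη : CFamily fun x t =>
      -2 * (w₁ x t * u₁ x t + w₂ x t * u₂ x t) * (w₁ x t ^ 2 + w₂ x t ^ 2)⁻¹ :=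
    (((cw₁.mul cu₁).add (cw₂.mul cu₂)).const_mul (-2)).mul (cm.inv hm)
  have ψ0 : ∀ x, -Real.log (w₁ x t₀ ^ 2 + w₂ x t₀ ^ 2) = α x := fun x => by
    rw [w₁0, w₂0]
    simp only [ne_eq, OfNat.ofNat_ne_zero, not_false_eq_true, zero_pow, add_zero, Real.log_pow,
      Real.log_exp]
    push_cast
    ring
  refine ⟨_, _, CFamily.of_primitive cη.l2Family (fun x => (K x).1) ht₀ ?_, cη, K, ψ0, fun x => ?_⟩
  · simp only [ψ0]
    exact hα
  · simp only [w₁0, w₂0, u₁0]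
    have := Real.exp_pos (-α x / 2)
    field_simp
    ring

/-- Bootstrap: the right-hand side of the equation for `η'` is as regular as `q` while `ψ` and `η`
are at least that regular. -/
theorem SobFamily.kepler {q ψ η : E → ℝ → ℝ} {n : ℕ} (hq : SobFamily ∅ n q) (hψ : CFamily ψ)
    (hη : CFamily η) (h : ∀ x, KeplerEq (q x) (ψ x) (η x)) :
    SobFamily ∅ (n + 1) η ∧ SobFamily ∅ (n + 2) ψ := by
  have key : SobFamily ∅ (n + 1) η := by
    induction n with
    | zero =>
      refine SobFamily.of_primitive ?_ (fun x => (h x).2) hη (by simp)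
      have := (((hη.mul hη).const_mul (1 / 2)).sub
        ((hψ.const_mul 2).exp.const_mul 2)).l2Family.add (SobFamily.const_mul (n := 0) (-2) hq)
      exact this.congr fun x => Filter.Eventually.of_forall fun t => by ring
    | succ n ih =>
      have a := ih hq.pred
      refine SobFamily.of_primitive ?_ (fun x => (h x).2) hη (by simp)
      have b := SobFamily.exp (hψ.const_mul 2) (hη.const_mul 2) (fun x => (h x).1.const_mul 2)
        (a.pred.const_mul 2)
      have := (((a.mul_free a le_rfl (by omega)).const_mul (1 / 2)).sub (b.const_mul 2)).add
        (hq.const_mul (-2))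
      exact this.congr fun x t _ => by ring
  exact ⟨key, SobFamily.of_primitive key (fun x => (h x).1) hψ (by simp)⟩

/-- Solutions with the same data at `S`, for potentials in contact of maximal order there, are in
contact two orders higher. Subtracting the equations, `(η₁ - η₂)'` is a sum of terms each containing
`η₁ - η₂`, `e^{2ψ₁} - e^{2ψ₂}` or `q₁ - q₂`. -/
theorem SobFamily.kepler_sub {S : Set ℝ} {q₁ ψ₁ η₁ q₂ ψ₂ η₂ : E → ℝ → ℝ} {n : ℕ}
    (hq₁ : SobFamily ∅ n q₁) (hψ₁ : CFamily ψ₁) (hη₁ : CFamily η₁)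
    (h₁ : ∀ x, KeplerEq (q₁ x) (ψ₁ x) (η₁ x)) (hq₂ : SobFamily ∅ n q₂) (hψ₂ : CFamily ψ₂)
    (hη₂ : CFamily η₂) (h₂ : ∀ x, KeplerEq (q₂ x) (ψ₂ x) (η₂ x))
    (hq : SobFamily S n fun x t => q₁ x t - q₂ x t)
    (hψ : ∀ x, ∀ t ∈ S ∩ Icc 0 (2 * Real.pi), ψ₁ x t - ψ₂ x t = 0)
    (hη : ∀ x, ∀ t ∈ S ∩ Icc 0 (2 * Real.pi), η₁ x t - η₂ x t = 0) :
    SobFamily S (n + 2) fun x t => ψ₁ x t - ψ₂ x t := by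
  have hp : ∀ x, IsPrimitive (fun t => η₁ x t - η₂ x t) (fun t =>
      (((η₁ x t - η₂ x t) * (1 / 2 * (η₁ x t + η₂ x t))) -
        2 * (Real.exp (2 * ψ₁ x t) - Real.exp (2 * ψ₂ x t))) + -2 * (q₁ x t - q₂ x t)) := fun x =>
    ((h₁ x).2.add ((h₂ x).2.const_mul (-1))).congr (fun t _ => by ring)
      (Filter.Eventually.of_forall fun t => by ring)
  have hψ' : ∀ x, ∀ t ∈ S ∩ Icc 0 (2 * Real.pi), 2 * ψ₁ x t - 2 * ψ₂ x t = 0 := fun x t ht => by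
    linear_combination 2 * hψ x t ht
  have key : SobFamily S (n + 1) fun x t => η₁ x t - η₂ x t := by
    induction n with
    | zero =>
      refine SobFamily.of_primitive ?_ hp (hη₁.sub hη₂) hη
      exact L2Family.add ((((hη₁.sub hη₂).mul ((hη₁.add hη₂).const_mul (1 / 2))).sub
        (((hψ₁.const_mul 2).exp.sub (hψ₂.const_mul 2).exp).const_mul 2)).l2Family)
        (SobFamily.const_mul (n := 0) (-2) hq)
    | succ n ih =>
      have a := ih hq₁.pred hq₂.pred hq.pred
      have a₁ := (hq₁.kepler hψ₁ hη₁ h₁).1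
      have a₂ := (hq₂.kepler hψ₂ hη₂ h₂).1
      have b := SobFamily.exp_sub_exp (hψ₁.const_mul 2) (hη₁.const_mul 2)
        (fun x => (h₁ x).1.const_mul 2) (hψ₂.const_mul 2) (hη₂.const_mul 2)
        (fun x => (h₂ x).1.const_mul 2) (a₁.pred.pred.const_mul 2) (a₂.pred.pred.const_mul 2)
        ((a.pred.const_mul 2).congr fun x t _ => by ring) hψ'
      refine SobFamily.of_primitive ?_ hp (hη₁.sub hη₂) hη
      exact ((a.mul_free ((a₁.add a₂).const_mul (1 / 2)) (by omega) (by omega)).sub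
        (b.const_mul 2)).add (hq.const_mul (-2))
  refine SobFamily.of_primitive key (fun x => ?_) (hψ₁.sub hψ₂) hψ
  exact ((h₁ x).1.add ((h₂ x).1.const_mul (-1))).congr (fun t _ => by ring)
      (Filter.Eventually.of_forall fun t => by ring)

/-- The converse of `SobFamily.kepler_sub`, with `κ` standing for `ψ''`: contact of the solutions
forces contact of the potentials read off from them. -/
theorem SobFamily.potential_sub {S : Set ℝ} {ψ₁ η₁ κ₁ ψ₂ η₂ κ₂ : E → ℝ → ℝ} {n : ℕ}
    (hψ₁ : CFamily ψ₁) (hη₁ : CFamily η₁) (h₁ : ∀ x, IsPrimitive (ψ₁ x) (η₁ x))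
    (hψ₂ : CFamily ψ₂) (hη₂ : CFamily η₂) (h₂ : ∀ x, IsPrimitive (ψ₂ x) (η₂ x))
    (hη₁n : SobFamily ∅ (n + 1) η₁) (hη₂n : SobFamily ∅ (n + 1) η₂)
    (hκ : SobFamily S n fun x t => κ₁ x t - κ₂ x t)
    (hη : SobFamily S n fun x t => η₁ x t - η₂ x t)
    (hψ : ∀ x, ∀ t ∈ S ∩ Icc 0 (2 * Real.pi), ψ₁ x t - ψ₂ x t = 0) :
    SobFamily S n fun x t =>
      1 / 2 * (η₁ x t ^ 2 / 2 - 2 * Real.exp (2 * ψ₁ x t) - κ₁ x t) -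
      1 / 2 * (η₂ x t ^ 2 / 2 - 2 * Real.exp (2 * ψ₂ x t) - κ₂ x t) := by
  have b := SobFamily.exp_sub_exp (hψ₁.const_mul 2) (hη₁.const_mul 2)
    (fun x => (h₁ x).const_mul 2) (hψ₂.const_mul 2) (hη₂.const_mul 2)
    (fun x => (h₂ x).const_mul 2) (hη₁n.pred.const_mul 2) (hη₂n.pred.const_mul 2)
    ((hη.const_mul 2).congr fun x t _ => by ring) fun x t ht => by
      linear_combination 2 * hψ x t ht
  exact ((((hη.mul_free ((hη₁n.add hη₂n).const_mul (1 / 2)) (by omega) (by omega)).sub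
    (b.pred.const_mul 2)).sub hκ).const_mul (1 / 2)).congr fun x t _ => by ring

end Families

end

noncomputable section

/-! ### Periodic Sobolev spaces as spaces of functions -/

/-- The primitive of `g` with the same mean as `f`. -/
def meanPrimitive : L2Circle × L2Circle →L[ℝ] CircleC :=
  let V := CircleC.volterra
  let e : CircleC →L[ℝ] ℝ := ContinuousMap.evalCLM ℝ ⟨2 * Real.pi, right_mem_circle⟩
  let fst := ContinuousLinearMap.fst ℝ L2Circle L2Circle
  let snd := ContinuousLinearMap.snd ℝ L2Circle L2Circle
  V ∘L snd + ((2 * Real.pi)⁻¹ •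
    (e ∘L V ∘L fst - e ∘L CircleC.primitive ∘L V ∘L snd)).smulRight (1 : CircleC)

theorem meanPrimitive_apply (f g : L2Circle) (t : Icc (0 : ℝ) (2 * Real.pi)) :
    meanPrimitive (f, g) t = (∫ s in (0 : ℝ)..t, g s) + (2 * Real.pi)⁻¹ *
      ((∫ s in (0 : ℝ)..(2 * Real.pi), f s) -
        ∫ s in (0 : ℝ)..(2 * Real.pi), ∫ r in (0 : ℝ)..s, g r) := by
  rw [← CircleC.primitive_apply (F := CircleC.volterra g)
    (f := fun s => ∫ r in (0 : ℝ)..s, g r) (fun s hs => rfl) ⟨2 * Real.pi, right_mem_circle⟩]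
  simp [meanPrimitive, CircleC.volterra_apply]

/-- The constant of integration is recovered from the mean of `f`, so the continuous representative
is a bounded linear function of the pair `(f, g)` in `L²`. -/
theorem meanPrimitive_eq {f g : L2Circle} {w : ℝ → ℝ} (hw : IsPrimitive w g)
    (hf : f =ᵐ[circleMeasure] w) (t : Icc (0 : ℝ) (2 * Real.pi)) :
    meanPrimitive (f, g) t = w t := by
  have h := intervalIntegral_congr_circle hf left_mem_circle right_mem_circle
  have h' : ∫ s in (0 : ℝ)..(2 * Real.pi), w s = 2 * Real.pi * w 0 +
      ∫ s in (0 : ℝ)..(2 * Real.pi), ∫ r in (0 : ℝ)..s, g r := by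
    have e : ∫ s in (0 : ℝ)..(2 * Real.pi), w s =
        ∫ s in (0 : ℝ)..(2 * Real.pi), (w 0 + ∫ r in (0 : ℝ)..s, g r) :=
      intervalIntegral_congr_circle (ae_circle_of_forall hw.2) left_mem_circle right_mem_circle
    rw [e, intervalIntegral.integral_add (by simp)
      (IsPrimitive.integral hw.1).continuousOn.intervalIntegrable_circle]
    simp
  rw [meanPrimitive_apply, h, h', hw.2 t t.2]
  field_simp
  ring

theorem isPrimitive_meanPrimitive (f g : L2Circle) : IsPrimitive (meanPrimitive (f, g)).ext g := by
  refine ⟨CircleC.intervalIntegrable_coeFn g, fun t ht => ?_⟩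
  rw [CircleC.ext_apply _ ht, CircleC.ext_apply _ left_mem_circle, meanPrimitive_apply,
    meanPrimitive_apply]
  simp
  ring

/-- Turns the existence of a periodic absolutely continuous representative into two continuous
linear equations. This makes the Sobolev space closed, hence complete. -/
theorem hasPeriodicDeriv_coeFn_iff {f g : L2Circle} : HasPeriodicDeriv f g ↔
    CircleC.toL2 (meanPrimitive (f, g)) = f ∧
      CircleC.volterra g ⟨2 * Real.pi, right_mem_circle⟩ = 0 := by
  rw [hasPeriodicDeriv_iff, CircleC.volterra_apply]
  constructor
  · rintro ⟨w, h1, h2, h3⟩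
    refine ⟨Lp.ext ?_, ?_⟩
    · refine (CircleC.coeFn_toL2 _).trans (Filter.EventuallyEq.trans ?_ h3.symm)
      refine ae_circle_of_forall fun t ht => ?_
      rw [CircleC.ext_apply _ ht, meanPrimitive_eq h1 h3]
    · have := h1.2 _ right_mem_circle
      simp only
      linarith
  · rintro ⟨h1, h2⟩
    refine ⟨_, isPrimitive_meanPrimitive f g, ?_, ?_⟩
    · have := (isPrimitive_meanPrimitive f g).2 _ right_mem_circle
      simp only at h2
      rw [this, h2, add_zero]
    · have := CircleC.coeFn_toL2 (meanPrimitive (f, g))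
      rwa [h1] at this

/-- A map into `F` is its own composition with the orthogonal projection to `F`. -/
theorem Submodule.contDiff_mk {X E : Type*} [NormedAddCommGroup X] [InnerProductSpace ℝ X]
    (F : Submodule ℝ X) [F.HasOrthogonalProjection] [NormedAddCommGroup E] [NormedSpace ℝ E]
    {u : E → X} (hu : ContDiff ℝ ∞ u) (hm : ∀ x, u x ∈ F) :
    ContDiff ℝ ∞ fun x => (⟨u x, hm x⟩ : F) := by
  have h2 := F.orthogonalProjectionOnto.contDiff.comp hu
  convert h2 using 1
  ext1 x
  exact (F.orthogonalProjectionOnto_mem_subspace_eq_self ⟨u x, hm x⟩).symm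

theorem Submodule.contDiff_coe {X : Type*} [NormedAddCommGroup X] [NormedSpace ℝ X]
    (F : Submodule ℝ X) : ContDiff ℝ ∞ fun u : F => (u : X) := F.subtypeL.contDiff

/-! ### Elements of the Sobolev space as functions -/

namespace Hper

variable {n : ℕ}

/-- The inherited norm of `H^n`, named for instance search. -/
abbrev normedGroup (n : ℕ) : NormedAddCommGroup (Hper n) := inferInstance

attribute [local instance] normedGroup

/-- The inherited Hilbert space structure of `H^n`, named for instance search. -/
abbrev innerProduct (n : ℕ) : InnerProductSpace ℝ (Hper n) := inferInstance

/-- The inherited normed space structure of `H^n`, named for instance search. -/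
abbrev normedSpace (n : ℕ) : NormedSpace ℝ (Hper n) := inferInstance

attribute [local instance] innerProduct normedSpace

/-- The derivative `u ↦ u^(j)` as a continuous linear map. -/
def derL (j : Fin (n + 1)) : Hper n →L[ℝ] L2Circle :=
  (PiLp.proj 2 (fun _ : Fin (n + 1) => L2Circle) j) ∘L (periodicSobolev n).subtypeL

theorem isClosed_periodicSobolev (n : ℕ) :
    IsClosed (periodicSobolev n : Set (PiLp 2 fun _ : Fin (n + 1) => L2Circle)) := by
  have : (periodicSobolev n : Set (PiLp 2 fun _ : Fin (n + 1) => L2Circle)) =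
      ⋂ j : Fin n, {u | CircleC.toL2 (meanPrimitive (u j.castSucc, u j.succ)) = u j.castSucc} ∩
        {u | CircleC.volterra (u j.succ) ⟨2 * Real.pi, right_mem_circle⟩ = 0} := by
    ext u
    rw [mem_iInter]
    exact forall_congr' fun j => hasPeriodicDeriv_coeFn_iff
  rw [this]
  have hc : ∀ j, Continuous fun u : PiLp 2 fun _ : Fin (n + 1) => L2Circle => u j := fun j =>
    (PiLp.proj (𝕜 := ℝ) 2 (fun _ : Fin (n + 1) => L2Circle) j).continuous
  refine isClosed_iInter fun j => IsClosed.inter (isClosed_eq ?_ (hc _)) (isClosed_eq ?_ ?_)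
  · exact CircleC.toL2.continuous.comp (meanPrimitive.continuous.comp ((hc _).prodMk (hc _)))
  · exact (continuous_eval_const _).comp (CircleC.volterra.continuous.comp (hc _))
  · exact continuous_const

instance : CompleteSpace (Hper n) := (isClosed_periodicSobolev n).completeSpace_coe

/-- The derivative `H^{n+1} → H^n`. -/
def shift : Hper (n + 1) →L[ℝ] Hper n :=
  (((PiLp.continuousLinearEquiv 2 ℝ fun _ : Fin (n + 1) => L2Circle).symm :
      (Fin (n + 1) → L2Circle) →L[ℝ] PiLp 2 fun _ : Fin (n + 1) => L2Circle) ∘L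
    ContinuousLinearMap.pi fun j : Fin (n + 1) => derL (n := n + 1) j.succ).codRestrict
      (periodicSobolev n) fun u j => u.2 j.succ

theorem shift_der (u : Hper (n + 1)) (j : Fin (n + 1)) : (shift u).der j = u.der j.succ := rfl

/-- The continuous representative of an element of `H^{n+1}`. -/
def valC : Hper (n + 1) →L[ℝ] CircleC := meanPrimitive ∘L ((derL 0).prod (derL 1))

/-- The function represented by an element of `H^n`; it is continuous on `[0, 2π]` for `n ≥ 1`. -/
def val : {n : ℕ} → Hper n → ℝ → ℝ
  | 0, u => u.der 0
  | _ + 1, u => (valC u).ext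

theorem ext_der {u v : Hper n} (h : ∀ j, u.der j = v.der j) : u = v :=
  Subtype.ext (PiLp.ext h)

theorem val_ae (u : Hper n) : val u =ᵐ[circleMeasure] u.der 0 := by
  cases n with
  | zero => exact ae_eq_rfl
  | succ n =>
    have h := (hasPeriodicDeriv_coeFn_iff.1 (u.2 0)).1
    have := CircleC.coeFn_toL2 (meanPrimitive (u.der 0, u.der 1))
    have h' : CircleC.toL2 (meanPrimitive (u.der 0, u.der 1)) = u.der 0 := h
    rw [h'] at this
    exact this.symm

theorem isPrimitive_val (u : Hper (n + 1)) : IsPrimitive (val u) (val (shift u)) :=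
  (isPrimitive_meanPrimitive (u.der 0) (u.der 1)).congr (fun _ _ => rfl) (val_ae (shift u)).symm

theorem val_two_pi (u : Hper (n + 1)) : val u (2 * Real.pi) = val u 0 := by
  have h : CircleC.volterra (u.der 1) ⟨2 * Real.pi, right_mem_circle⟩ = 0 :=
    (hasPeriodicDeriv_coeFn_iff.1 (u.2 0)).2
  have h1 := (isPrimitive_meanPrimitive (u.der 0) (u.der 1)).2 _ right_mem_circle
  rw [CircleC.volterra_apply] at h
  simp only at h
  rw [h, add_zero] at h1
  exact h1

theorem cFamily_val : CFamily (val : Hper (n + 1) → ℝ → ℝ) :=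
  ⟨valC, valC.contDiff, fun _ _ ht => ((valC _).ext_apply ht).symm⟩

theorem sobFamily_val : SobFamily ∅ n (val : Hper n → ℝ → ℝ) := by
  induction n with
  | zero => exact ⟨derL 0, (derL 0).contDiff, fun u => ae_eq_rfl⟩
  | succ n ih =>
    exact SobFamily.of_primitive (ih.comp shift.contDiff) isPrimitive_val cFamily_val (by simp)

/-- The continuous representatives coincide, hence so do their derivatives, order by order. -/
theorem ext_ae {u v : Hper n} (h : u.der 0 =ᵐ[circleMeasure] v.der 0) : u = v := by
  induction n with
  | zero =>
    refine ext_der fun j => ?_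
    rw [Fin.fin_one_eq_zero j]
    exact Lp.ext h
  | succ n ih =>
    have hv : EqOn (val u) (val v) (Icc 0 (2 * Real.pi)) :=
      eqOn_circle_of_ae (isPrimitive_val u).continuousOn (isPrimitive_val v).continuousOn
        ((val_ae u).trans (h.trans (val_ae v).symm))
    have := ((isPrimitive_val u).congr hv ae_eq_rfl).unique (isPrimitive_val v)
    have hs := ih ((val_ae (shift u)).symm.trans (this.trans (val_ae (shift v))))
    refine ext_der fun j => Fin.cases (Lp.ext h) (fun i => ?_) j
    rw [← shift_der, ← shift_der, hs]

theorem ext_val {u v : Hper n} (h : EqOn (val u) (val v) (Icc 0 (2 * Real.pi))) : u = v :=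
  ext_ae ((val_ae u).symm.trans (Filter.EventuallyEq.trans (ae_circle_of_forall h) (val_ae v)))

theorem val_add_ae (u v : Hper n) :
    val (u + v) =ᵐ[circleMeasure] fun t => val u t + val v t := by
  filter_upwards [val_ae (u + v), val_ae u, val_ae v, Lp.coeFn_add (u.der 0) (v.der 0)]
    with t h1 h2 h3 h4
  rw [h1, h2, h3]
  exact h4

theorem val_add (u v : Hper (n + 1)) {t : ℝ} (ht : t ∈ Icc 0 (2 * Real.pi)) :
    val (u + v) t = val u t + val v t := by
  simp [val, CircleC.ext_apply _ ht]

theorem val_sub (u v : Hper (n + 1)) {t : ℝ} (ht : t ∈ Icc 0 (2 * Real.pi)) :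
    val (u - v) t = val u t - val v t := by
  simp [val, CircleC.ext_apply _ ht]

theorem val_smul (c : ℝ) (u : Hper (n + 1)) {t : ℝ} (ht : t ∈ Icc 0 (2 * Real.pi)) :
    val (c • u) t = c * val u t := by
  simp [val, CircleC.ext_apply _ ht]

theorem memHper_val (u : Hper n) : MemHper n (val u) := by
  induction n with
  | zero => exact Lp.memLp _
  | succ n ih =>
    exact ⟨_, hasPeriodicDeriv_iff.2 ⟨_, isPrimitive_val u, (val_two_pi u).symm, ae_eq_rfl⟩,
      ih (shift u)⟩

section Families

variable {E : Type*} [NormedAddCommGroup E] [NormedSpace ℝ E]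

/-- The components of the jet are the successive derivatives of the family, by uniqueness of
derivatives; each depends smoothly on the parameter in `L²`. -/
theorem contDiff_der {f : E → ℝ → ℝ} (hf : SobFamily ∅ n f) {u : E → Hper n}
    (h : ∀ x, (u x).der 0 =ᵐ[circleMeasure] f x) (j : Fin (n + 1)) :
    ContDiff ℝ ∞ fun x => (u x).der j := by
  have h0 : ContDiff ℝ ∞ fun x => (u x).der 0 := by
    obtain ⟨F, hF, hFf⟩ := hf.l2Family
    convert hF using 1
    ext1 x
    exact Lp.ext ((h x).trans (hFf x).symm)
  induction n generalizing f with
  | zero => rwa [Fin.fin_one_eq_zero j]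
  | succ n ih =>
    refine Fin.cases h0 (fun i => ?_) j
    obtain ⟨h1, h2, g, h3, h4⟩ := hf
    have hs : ∀ x, (shift (u x)).der 0 =ᵐ[circleMeasure] g x := fun x => by
      have hv : EqOn (val (u x)) (f x) (Icc 0 (2 * Real.pi)) :=
        eqOn_circle_of_ae (isPrimitive_val _).continuousOn (h1.continuousOn x)
          ((val_ae (u x)).trans (h x))
      exact (val_ae _).symm.trans (((isPrimitive_val (u x)).congr hv ae_eq_rfl).unique (h4 x))
    refine ih h3 hs i ?_
    obtain ⟨F, hF, hFf⟩ := h3.l2Family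
    convert hF using 1
    ext1 x
    exact Lp.ext ((hs x).trans (hFf x).symm)

theorem contDiff_of_sobFamily {f : E → ℝ → ℝ} (hf : SobFamily ∅ n f) {u : E → Hper n}
    (h : ∀ x, (u x).der 0 =ᵐ[circleMeasure] f x) : ContDiff ℝ ∞ u := by
  have h1 : ContDiff ℝ ∞ fun x => (u x).1 := by
    have := (PiLp.continuousLinearEquiv 2 ℝ fun _ : Fin (n + 1) => L2Circle).symm.contDiff.comp
      (contDiff_pi.2 fun j => contDiff_der hf h j)
    exact this
  exact (periodicSobolev n).contDiff_mk h1 fun x => (u x).2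

theorem exists_contDiff {f : E → ℝ → ℝ} (hf : SobFamily ∅ n f) (hm : ∀ x, MemHper n (f x)) :
    ∃ u : E → Hper n, ContDiff ℝ ∞ u ∧ ∀ x, val (u x) =ᵐ[circleMeasure] f x := by
  choose u hu using fun x => (hm x).exists_jet
  exact ⟨u, contDiff_of_sobFamily hf hu, fun x => (val_ae _).trans (hu x)⟩

end Families

/-! ### Functions which vanish to maximal order at the base point -/

/-- The elements of `H^n(𝕊¹)` whose derivatives of order less than `n` vanish at the endpoints. -/
def flat : (n : ℕ) → Submodule ℝ (Hper n)
  | 0 => ⊤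
  | n + 1 => (((ContinuousMap.evalCLM ℝ ⟨0, left_mem_circle⟩ : CircleC →L[ℝ] ℝ) ∘L
      valC).ker) ⊓ (flat n).comap (shift : Hper (n + 1) →L[ℝ] Hper n).toLinearMap

theorem mem_flat_succ {u : Hper (n + 1)} : u ∈ flat (n + 1) ↔ val u 0 = 0 ∧ shift u ∈ flat n := by
  rw [flat, Submodule.mem_inf]
  refine and_congr ?_ Iff.rfl
  rw [LinearMap.mem_ker]
  simp [val, CircleC.ext_apply _ left_mem_circle]

theorem flat_zero : flat 0 = ⊤ := rfl

theorem isClosed_flat (n : ℕ) : IsClosed (flat n : Set (Hper n)) := by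
  induction n with
  | zero => exact isClosed_univ
  | succ n ih =>
    refine IsClosed.inter ?_ (ih.preimage shift.continuous)
    exact isClosed_eq (ContinuousLinearMap.continuous _) continuous_const

attribute [irreducible] flat

instance : CompleteSpace (flat n) := (isClosed_flat n).completeSpace_coe

/-- The subspace `flat n` as a type. -/
def FlatSpace (n : ℕ) : Type := flat n

instance : NormedAddCommGroup (FlatSpace n) :=
  Submodule.normedAddCommGroup (flat n)

instance : InnerProductSpace ℝ (FlatSpace n) :=
  Submodule.innerProductSpace (flat n)

instance : CompleteSpace (FlatSpace n) :=
  (isClosed_flat n).completeSpace_coe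

/-- The inclusion of `FlatSpace n` in `H^n`. -/
def FlatSpace.toHper (u : FlatSpace n) : Hper n := u.1

theorem FlatSpace.mem (u : FlatSpace n) : u.toHper ∈ flat n := u.2

/-- The element of `FlatSpace n` given by an element of `flat n`. -/
def FlatSpace.mk (u : Hper n) (hu : u ∈ flat n) : FlatSpace n := ⟨u, hu⟩

theorem contDiff_toHper : ContDiff ℝ ∞ (FlatSpace.toHper : FlatSpace n → Hper n) :=
  (flat n).contDiff_coe

theorem contDiff_flat_mk {E : Type*} [NormedAddCommGroup E] [NormedSpace ℝ E] {u : E → Hper n}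
    (hu : ContDiff ℝ ∞ u) (hm : ∀ x, u x ∈ flat n) :
    ContDiff ℝ ∞ fun x => FlatSpace.mk (u x) (hm x) :=
  (flat n).contDiff_mk hu hm

/-- Vanishing is imposed at `0` only; periodicity carries it to `2π`. -/
theorem sobFamily_flat : SobFamily {0, 2 * Real.pi} n fun u : FlatSpace n => val u.toHper := by
  induction n with
  | zero => exact (sobFamily_val (n := 0)).comp contDiff_toHper
  | succ n ih =>
    refine SobFamily.of_primitive (ih.comp (contDiff_flat_mk (shift.contDiff.comp contDiff_toHper) fun u =>
      (mem_flat_succ.1 u.mem).2)) (fun u => isPrimitive_val u.toHper)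
      (cFamily_val.comp contDiff_toHper) fun u t ht => ?_
    obtain rfl | rfl := ht.1
    · exact (mem_flat_succ.1 u.mem).1
    · rw [val_two_pi]
      exact (mem_flat_succ.1 u.mem).1

/-- The orthogonal complement of `flat n` as a type. -/
def FlatPerp (n : ℕ) : Type := ((flat n)ᗮ : Submodule ℝ (Hper n))

instance : NormedAddCommGroup (FlatPerp n) :=
  Submodule.normedAddCommGroup ((flat n)ᗮ : Submodule ℝ (Hper n))

instance : InnerProductSpace ℝ (FlatPerp n) :=
  Submodule.innerProductSpace ((flat n)ᗮ : Submodule ℝ (Hper n))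

instance : CompleteSpace (FlatPerp n) :=
  (Submodule.isClosed_orthogonal (flat n)).completeSpace_coe

/-- The inclusion of `FlatPerp n` in `H^n`. -/
def FlatPerp.toHper (u : FlatPerp n) : Hper n := u.1

theorem FlatPerp.contDiff_toHper : ContDiff ℝ ∞ (FlatPerp.toHper : FlatPerp n → Hper n) :=
  ((flat n)ᗮ : Submodule ℝ (Hper n)).contDiff_coe

/-- The orthogonal projection to `FlatPerp n`. -/
def perpProj (u : Hper n) : FlatPerp n := (flat n)ᗮ.orthogonalProjectionOnto u

theorem contDiff_perpProj : ContDiff ℝ ∞ (perpProj : Hper n → FlatPerp n) :=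
  ((flat n)ᗮ.orthogonalProjectionOnto).contDiff

theorem _root_.Submodule.sub_projOrthogonal_mem {X : Type*} [NormedAddCommGroup X] [InnerProductSpace ℝ X]
    (F : Submodule ℝ X) [F.HasOrthogonalProjection] (u : X) :
    u - (Fᗮ.orthogonalProjectionOnto u : X) ∈ F := by
  have := Submodule.sub_starProjection_mem_orthogonal (K := Fᗮ) u
  rwa [Submodule.orthogonal_orthogonal] at this

theorem _root_.Submodule.projOrthogonal_add {X : Type*} [NormedAddCommGroup X] [InnerProductSpace ℝ X]
    (F : Submodule ℝ X) [F.HasOrthogonalProjection] (y : Fᗮ) {u : X} (hu : u ∈ F) :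
    Fᗮ.orthogonalProjectionOnto (y + u) = y := by
  rw [map_add, Submodule.orthogonalProjectionOnto_mem_subspace_eq_self,
    Submodule.orthogonalProjectionOnto_eq_zero_iff.2, add_zero]
  exact Submodule.le_orthogonal_orthogonal F hu

theorem sub_perpProj_mem (u : Hper n) : u - (perpProj u).toHper ∈ flat n :=
  (flat n).sub_projOrthogonal_mem u

theorem perpProj_add (y : FlatPerp n) {u : Hper n} (hu : u ∈ flat n) :
    perpProj (y.toHper + u) = y := (flat n).projOrthogonal_add y hu

variable {E : Type*} [NormedAddCommGroup E] [NormedSpace ℝ E]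

theorem mem_flat {S : Set ℝ} (hS : 0 ∈ S) {f : E → ℝ → ℝ} (hf : SobFamily S n f) {u : Hper n} {x : E}
    (h : val u =ᵐ[circleMeasure] f x) : u ∈ flat n := by
  induction n generalizing f with
  | zero => rw [flat_zero]; exact Submodule.mem_top
  | succ n ih =>
    obtain ⟨h1, h2, g, h3, h4⟩ := hf
    have hv : EqOn (val u) (f x) (Icc 0 (2 * Real.pi)) :=
      eqOn_circle_of_ae (isPrimitive_val _).continuousOn (h1.continuousOn x) h
    refine mem_flat_succ.2 ⟨?_, ih h3 (((isPrimitive_val u).congr hv ae_eq_rfl).unique (h4 x))⟩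
    rw [hv left_mem_circle, h2 x 0 ⟨hS, left_mem_circle⟩]

theorem memHper_of_sobFamily {f : E → ℝ → ℝ} (hf : SobFamily {0, 2 * Real.pi} n f) (x : E) :
    MemHper n (f x) := by
  induction n generalizing f with
  | zero => exact L2Family.memLp hf x
  | succ n ih =>
    obtain ⟨h1, h2, g, h3, h4⟩ := hf
    refine ⟨g x, hasPeriodicDeriv_iff.2 ⟨f x, h4 x, ?_, ae_eq_rfl⟩, ih h3⟩
    rw [h2 x 0 ⟨by simp, left_mem_circle⟩, h2 x _ ⟨by simp, right_mem_circle⟩]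

/-- Derivatives that vanish at both ends match there, so periodicity is automatic. This is how
nonlinear constructions on the interval return to the periodic space. -/
theorem exists_contDiff_flat {f : E → ℝ → ℝ} (hf : SobFamily {0, 2 * Real.pi} n f) :
    ∃ u : E → FlatSpace n, ContDiff ℝ ∞ u ∧ ∀ x, val (u x).toHper =ᵐ[circleMeasure] f x := by
  obtain ⟨u, hu, h⟩ := exists_contDiff hf.free (memHper_of_sobFamily hf)
  have hm : ∀ x, u x ∈ flat n := fun x => mem_flat (by simp) hf (h x)
  exact ⟨fun x => FlatSpace.mk (u x) (hm x), contDiff_flat_mk hu hm, h⟩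

end Hper

end

noncomputable section

/-! ### Gluing two solutions of the Kepler type equation -/

/-- A smooth cutoff on `[0, 2π]`, flat at both endpoints. -/
def cutoff (t : ℝ) : ℝ := Real.smoothTransition (t / (2 * Real.pi))

theorem contDiff_cutoff : ContDiff ℝ ∞ cutoff :=
  Real.smoothTransition.contDiff.comp (contDiff_id.div_const _)

theorem cutoff_of_le {t : ℝ} (ht : t ≤ 0) : cutoff t = 0 :=
  Real.smoothTransition.zero_of_nonpos (div_nonpos_of_nonpos_of_nonneg ht two_pi_nonneg)

theorem cutoff_of_ge {t : ℝ} (ht : 2 * Real.pi ≤ t) : cutoff t = 1 :=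
  Real.smoothTransition.one_of_one_le ((one_le_div (by positivity)).2 ht)

theorem isPrimitive_of_contDiff {c : ℝ → ℝ} (hc : ContDiff ℝ ∞ c) : IsPrimitive c (deriv c) :=
  IsPrimitive.of_hasDerivAt (hc.continuous_deriv (by simp))
    fun t => (hc.differentiable (by simp) t).hasDerivAt

theorem ContDiff.deriv_infty {c : ℝ → ℝ} (hc : ContDiff ℝ ∞ c) : ContDiff ℝ ∞ (deriv c) :=
  (contDiff_infty_iff_deriv.1 hc).2

/-- `f₁ + χ (f₂ - f₁)` for the cutoff `χ`. -/
def glue (f₁ f₂ : ℝ → ℝ) (t : ℝ) : ℝ := f₁ t + cutoff t * (f₂ t - f₁ t)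

/-- The derivative of `glue f₁ f₂` in terms of the derivatives `g₁`, `g₂`. -/
def glueDeriv (f₁ g₁ f₂ g₂ : ℝ → ℝ) (t : ℝ) : ℝ :=
  glue g₁ g₂ t + deriv cutoff t * (f₂ t - f₁ t)

/-- The second derivative of `glue f₁ f₂` in terms of the derivatives `gᵢ`, `kᵢ`. -/
def glueDeriv₂ (f₁ g₁ k₁ f₂ g₂ k₂ : ℝ → ℝ) (t : ℝ) : ℝ :=
  glue k₁ k₂ t + 2 * (deriv cutoff t * (g₂ t - g₁ t)) + deriv (deriv cutoff) t * (f₂ t - f₁ t)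

theorem IsPrimitive.sub {f g f' g' : ℝ → ℝ} (h : IsPrimitive f g) (h' : IsPrimitive f' g') :
    IsPrimitive (fun t => f t - f' t) (fun t => g t - g' t) :=
  (h.add (h'.const_mul (-1))).congr (fun t _ => by ring) (Filter.Eventually.of_forall fun t => by ring)

theorem isPrimitive_glue {f₁ g₁ f₂ g₂ : ℝ → ℝ} (h₁ : IsPrimitive f₁ g₁) (h₂ : IsPrimitive f₂ g₂) :
    IsPrimitive (glue f₁ f₂) (glueDeriv f₁ g₁ f₂ g₂) :=
  (h₁.add ((isPrimitive_of_contDiff contDiff_cutoff).mul (h₂.sub h₁))).congr (fun t _ => rfl)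
    (Filter.Eventually.of_forall fun t => by simp only [glueDeriv, glue]; ring)

theorem isPrimitive_glueDeriv {f₁ g₁ k₁ f₂ g₂ k₂ : ℝ → ℝ} (h₁ : IsPrimitive f₁ g₁)
    (h₂ : IsPrimitive f₂ g₂) (i₁ : IsPrimitive g₁ k₁) (i₂ : IsPrimitive g₂ k₂) :
    IsPrimitive (glueDeriv f₁ g₁ f₂ g₂) (glueDeriv₂ f₁ g₁ k₁ f₂ g₂ k₂) :=
  ((isPrimitive_glue i₁ i₂).add ((isPrimitive_of_contDiff contDiff_cutoff.deriv_infty).mul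
    (h₂.sub h₁))).congr (fun t _ => rfl)
    (Filter.Eventually.of_forall fun t => by simp only [glueDeriv, glue, glueDeriv₂]; ring)

section Glue

variable {E : Type*} [NormedAddCommGroup E] [NormedSpace ℝ E] {f₁ f₂ g₁ g₂ k₁ k₂ : E → ℝ → ℝ}
  {n : ℕ}

theorem CFamily.glue (h₁ : CFamily f₁) (h₂ : CFamily f₂) : CFamily fun x => glue (f₁ x) (f₂ x) :=
  h₁.add ((CFamily.of_continuous contDiff_cutoff.continuous).mul (h₂.sub h₁))

theorem CFamily.glueDeriv (h₁ : CFamily f₁) (h₂ : CFamily f₂) (i₁ : CFamily g₁) (i₂ : CFamily g₂) :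
    CFamily fun x => glueDeriv (f₁ x) (g₁ x) (f₂ x) (g₂ x) :=
  (i₁.glue i₂).add ((CFamily.of_continuous contDiff_cutoff.deriv_infty.continuous).mul (h₂.sub h₁))

theorem CFamily.glueDeriv₂ (h₁ : CFamily f₁) (h₂ : CFamily f₂) (i₁ : CFamily g₁) (i₂ : CFamily g₂)
    (j₁ : CFamily k₁) (j₂ : CFamily k₂) :
    CFamily fun x => glueDeriv₂ (f₁ x) (g₁ x) (k₁ x) (f₂ x) (g₂ x) (k₂ x) :=
  ((j₁.glue j₂).add (((CFamily.of_continuous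
    contDiff_cutoff.deriv_infty.continuous).mul (i₂.sub i₁)).const_mul 2)).add
    ((CFamily.of_continuous contDiff_cutoff.deriv_infty.deriv_infty.continuous).mul (h₂.sub h₁))

/-- The difference is `χ (f₂ - f₁)`, and `χ` vanishes for `t ≤ 0`. -/
theorem SobFamily.glue_sub_left (h₁ : SobFamily ∅ (n + 1) f₁) (h₂ : SobFamily ∅ (n + 1) f₂) :
    SobFamily {0} (n + 1) fun x t => _root_.glue (f₁ x) (f₂ x) t - f₁ x t := by
  have hc : SobFamily {0} (n + 1) fun _ : E => cutoff :=
    SobFamily.of_contDiff contDiff_cutoff fun t ht => Or.inl fun s hs =>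
      cutoff_of_le (by rw [mem_singleton_iff.1 ht] at hs; exact hs)
  exact (hc.mul_free (h₂.sub h₁) le_rfl (by omega)).congr fun x t _ => by
    simp only [_root_.glue]; ring

theorem SobFamily.glue_sub_right (h₁ : SobFamily ∅ (n + 1) f₁) (h₂ : SobFamily ∅ (n + 1) f₂) :
    SobFamily {2 * Real.pi} (n + 1) fun x t => _root_.glue (f₁ x) (f₂ x) t - f₂ x t := by
  have hc : SobFamily {2 * Real.pi} (n + 1) fun _ : E => fun t => cutoff t - 1 :=
    SobFamily.of_contDiff (contDiff_cutoff.sub contDiff_const) fun t ht => Or.inr fun s hs => by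
      rw [mem_singleton_iff.1 ht] at hs
      rw [cutoff_of_ge hs, sub_self]
  exact (hc.mul_free (h₂.sub h₁) le_rfl (by omega)).congr fun x t _ => by
    simp only [_root_.glue]; ring

end Glue

/-! ### Kepler solutions from both endpoints and their gluing -/

namespace Hper

variable (n : ℕ)

attribute [local instance] normedGroup innerProduct normedSpace

theorem exists_keplerStart : ∃ ψ η : Hper (n + 1) → ℝ → ℝ, CFamily ψ ∧ CFamily η ∧
    (∀ q, KeplerEq (val q) (ψ q) (η q)) ∧ (∀ q, ψ q 0 = 0) ∧ ∀ q, η q 0 = 0 :=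
  exists_kepler cFamily_val left_mem_circle (α := fun _ => 0) (β := fun _ => 0) contDiff_const
    contDiff_const

theorem exists_keplerEnd : ∃ ψ η : ℝ × ℝ × Hper (n + 1) → ℝ → ℝ, CFamily ψ ∧ CFamily η ∧
    (∀ x, KeplerEq (val x.2.2) (ψ x) (η x)) ∧ (∀ x, ψ x (2 * Real.pi) = x.1) ∧
      ∀ x, η x (2 * Real.pi) = x.2.1 :=
  exists_kepler (cFamily_val.comp (contDiff_snd.comp contDiff_snd)) right_mem_circle
    contDiff_fst (contDiff_fst.comp contDiff_snd)

variable {n}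

/-- The solution with vanishing data at `0`. -/
def startψ : Hper (n + 1) → ℝ → ℝ := (exists_keplerStart n).choose

/-- The derivative of `startψ`. -/
def startη : Hper (n + 1) → ℝ → ℝ := (exists_keplerStart n).choose_spec.choose

theorem startψ_spec : CFamily (startψ (n := n)) ∧ CFamily (startη (n := n)) ∧
    (∀ q : Hper (n + 1), KeplerEq (val q) (startψ q) (startη q)) ∧
    (∀ q : Hper (n + 1), startψ q 0 = 0) ∧ ∀ q : Hper (n + 1), startη q 0 = 0 :=
  (exists_keplerStart n).choose_spec.choose_spec

/-- The solution with prescribed data at `2π`. -/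
def endψ : ℝ × ℝ × Hper (n + 1) → ℝ → ℝ := (exists_keplerEnd n).choose

/-- The derivative of `endψ`. -/
def endη : ℝ × ℝ × Hper (n + 1) → ℝ → ℝ := (exists_keplerEnd n).choose_spec.choose

theorem endψ_spec : CFamily (endψ (n := n)) ∧ CFamily (endη (n := n)) ∧
    (∀ x : ℝ × ℝ × Hper (n + 1), KeplerEq (val x.2.2) (endψ x) (endη x)) ∧
    (∀ x : ℝ × ℝ × Hper (n + 1), endψ x (2 * Real.pi) = x.1) ∧
    ∀ x : ℝ × ℝ × Hper (n + 1), endη x (2 * Real.pi) = x.2.1 :=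
  (exists_keplerEnd n).choose_spec.choose_spec

/-- The parameter space of the glued solutions. -/
abbrev Par (n : ℕ) : Type := ℝ × ℝ × FlatPerp (n + 1)

/-- The parameters of the solution at the right endpoint. -/
def endPar (x : Par n) : ℝ × ℝ × Hper (n + 1) := (x.1, x.2.1, x.2.2.toHper)

theorem contDiff_endPar : ContDiff ℝ ∞ (endPar (n := n)) :=
  contDiff_fst.prodMk ((contDiff_fst.comp contDiff_snd).prodMk
    (FlatPerp.contDiff_toHper.comp (contDiff_snd.comp contDiff_snd)))

/-- The potential of the parameter. -/
def parPot (x : Par n) : ℝ → ℝ := val x.2.2.toHper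

/-- The solution at the left endpoint. -/
def leftψ (x : Par n) : ℝ → ℝ := startψ x.2.2.toHper
/-- The derivative of the solution at the left endpoint. -/
def leftη (x : Par n) : ℝ → ℝ := startη x.2.2.toHper
/-- The solution at the right endpoint. -/
def rightψ (x : Par n) : ℝ → ℝ := endψ (endPar x)
/-- The derivative of the solution at the right endpoint. -/
def rightη (x : Par n) : ℝ → ℝ := endη (endPar x)
/-- The second derivative of the solution at the left endpoint. -/
def leftκ (x : Par n) (t : ℝ) : ℝ :=
  leftη x t ^ 2 / 2 - 2 * Real.exp (2 * leftψ x t) - 2 * parPot x t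
/-- The second derivative of the solution at the right endpoint. -/
def rightκ (x : Par n) (t : ℝ) : ℝ :=
  rightη x t ^ 2 / 2 - 2 * Real.exp (2 * rightψ x t) - 2 * parPot x t
/-- The glued solution. -/
def gluedψ (x : Par n) : ℝ → ℝ := glue (leftψ x) (rightψ x)
/-- The derivative of the glued solution. -/
def gluedη (x : Par n) : ℝ → ℝ := glueDeriv (leftψ x) (leftη x) (rightψ x) (rightη x)
/-- The second derivative of the glued solution. -/
def gluedκ (x : Par n) : ℝ → ℝ :=
  glueDeriv₂ (leftψ x) (leftη x) (leftκ x) (rightψ x) (rightη x) (rightκ x)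

theorem contDiff_parPot : ContDiff ℝ ∞ fun x : Par n => x.2.2.toHper :=
  FlatPerp.contDiff_toHper.comp (contDiff_snd.comp contDiff_snd)

theorem sobFamily_parPot : SobFamily ∅ (n + 1) (parPot (n := n)) :=
  sobFamily_val.comp contDiff_parPot

theorem cFamily_left : CFamily (leftψ (n := n)) ∧ CFamily (leftη (n := n)) :=
  ⟨startψ_spec.1.comp contDiff_parPot, startψ_spec.2.1.comp contDiff_parPot⟩

theorem cFamily_right : CFamily (rightψ (n := n)) ∧ CFamily (rightη (n := n)) :=
  ⟨endψ_spec.1.comp contDiff_endPar, endψ_spec.2.1.comp contDiff_endPar⟩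

theorem keplerEq_left (x : Par n) : KeplerEq (parPot x) (leftψ x) (leftη x) :=
  startψ_spec.2.2.1 _

theorem keplerEq_right (x : Par n) : KeplerEq (parPot x) (rightψ x) (rightη x) :=
  endψ_spec.2.2.1 (endPar x)

theorem CFamily_kepler {E : Type*} [NormedAddCommGroup E] [NormedSpace ℝ E] {q ψ η : E → ℝ → ℝ}
    (hq : CFamily q) (hψ : CFamily ψ) (hη : CFamily η) :
    CFamily fun x t => η x t ^ 2 / 2 - 2 * Real.exp (2 * ψ x t) - 2 * q x t :=
  ((((hη.mul hη).const_mul (1 / 2)).sub ((hψ.const_mul 2).exp.const_mul 2)).sub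
    (hq.const_mul 2)).congr fun x t _ => by ring

theorem sobFamily_left : SobFamily ∅ (n + 2) (leftη (n := n)) ∧
    SobFamily ∅ (n + 3) (leftψ (n := n)) :=
  SobFamily.kepler sobFamily_parPot cFamily_left.1 cFamily_left.2 keplerEq_left

theorem sobFamily_right : SobFamily ∅ (n + 2) (rightη (n := n)) ∧
    SobFamily ∅ (n + 3) (rightψ (n := n)) :=
  SobFamily.kepler sobFamily_parPot cFamily_right.1 cFamily_right.2 keplerEq_right

theorem cFamily_leftκ : CFamily (leftκ (n := n)) :=
  CFamily_kepler sobFamily_parPot.cFamily cFamily_left.1 cFamily_left.2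

theorem cFamily_rightκ : CFamily (rightκ (n := n)) :=
  CFamily_kepler sobFamily_parPot.cFamily cFamily_right.1 cFamily_right.2

theorem cFamily_gluedψ : CFamily (gluedψ (n := n)) := cFamily_left.1.glue cFamily_right.1

theorem cFamily_gluedη : CFamily (gluedη (n := n)) :=
  cFamily_left.1.glueDeriv cFamily_right.1 cFamily_left.2 cFamily_right.2

theorem cFamily_gluedκ : CFamily (gluedκ (n := n)) :=
  cFamily_left.1.glueDeriv₂ cFamily_right.1 cFamily_left.2 cFamily_right.2 cFamily_leftκ
    cFamily_rightκ

theorem isPrimitive_gluedψ (x : Par n) : IsPrimitive (gluedψ x) (gluedη x) :=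
  isPrimitive_glue (keplerEq_left x).1 (keplerEq_right x).1

theorem isPrimitive_gluedη (x : Par n) : IsPrimitive (gluedη x) (gluedκ x) :=
  isPrimitive_glueDeriv (keplerEq_left x).1 (keplerEq_right x).1 (keplerEq_left x).2
    (keplerEq_right x).2

/-- Near `0` the glued function has the endpoint jet of the left solution; each differentiation
costs one order. -/
theorem sobFamily_glued_left :
    SobFamily {0} (n + 3) (fun (x : Par n) t => gluedψ x t - leftψ x t) ∧
    SobFamily {0} (n + 2) (fun (x : Par n) t => gluedη x t - leftη x t) ∧
    SobFamily {0} (n + 1) (fun (x : Par n) t => gluedκ x t - leftκ x t) := by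
  have h := SobFamily.glue_sub_left (sobFamily_left (n := n)).2 sobFamily_right.2
  have h' := SobFamily.derivative h (fun x => (isPrimitive_gluedψ x).sub (keplerEq_left x).1)
    (cFamily_gluedη.sub cFamily_left.2)
  exact ⟨h, h', SobFamily.derivative h' (fun x => (isPrimitive_gluedη x).sub (keplerEq_left x).2)
    (cFamily_gluedκ.sub cFamily_leftκ)⟩

theorem sobFamily_glued_right :
    SobFamily {2 * Real.pi} (n + 3) (fun (x : Par n) t => gluedψ x t - rightψ x t) ∧
    SobFamily {2 * Real.pi} (n + 2) (fun (x : Par n) t => gluedη x t - rightη x t) ∧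
    SobFamily {2 * Real.pi} (n + 1) (fun (x : Par n) t => gluedκ x t - rightκ x t) := by
  have h := SobFamily.glue_sub_right (sobFamily_left (n := n)).2 sobFamily_right.2
  have h' := SobFamily.derivative h (fun x => (isPrimitive_gluedψ x).sub (keplerEq_right x).1)
    (cFamily_gluedη.sub cFamily_right.2)
  exact ⟨h, h', SobFamily.derivative h' (fun x => (isPrimitive_gluedη x).sub (keplerEq_right x).2)
    (cFamily_gluedκ.sub cFamily_rightκ)⟩

end Hper
end

noncomputable section

namespace Hper

variable {n : ℕ}

attribute [local instance] normedGroup innerProduct normedSpace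

/-! ### The coordinates `(a, b, y, h)` on `H^{n+1}` -/

/-- The parameters `(a, b, y)` of a potential. -/
def parOf (q : Hper (n + 1)) : Par n :=
  (startψ q (2 * Real.pi), startη q (2 * Real.pi), perpProj q)

theorem contDiff_parOf : ContDiff ℝ ∞ (parOf (n := n)) :=
  (startψ_spec.1.contDiff_eval right_mem_circle).prodMk
    ((startψ_spec.2.1.contDiff_eval right_mem_circle).prodMk contDiff_perpProj)

theorem sobFamily_sub_parPot :
    SobFamily {0, 2 * Real.pi} (n + 1) fun (q : Hper (n + 1)) t => val q t - parPot (parOf q) t := by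
  have := (sobFamily_flat (n := n + 1)).comp (contDiff_flat_mk
    (contDiff_id.sub (FlatPerp.contDiff_toHper.comp contDiff_perpProj))
    (fun q : Hper (n + 1) => sub_perpProj_mem q))
  exact this.congr fun q t ht => val_sub _ _ ht

/-- A potential and its component `y` differ by a flat function, so at `0` the true solution has
contact of order `n + 3` with the left solution, and at `2π` with the right one, whose data `(a, b)`
were chosen accordingly. The glued function has the same contacts. -/
theorem sobFamily_startψ_sub_gluedψ : SobFamily {0, 2 * Real.pi} (n + 3)
    fun (q : Hper (n + 1)) t => startψ q t - gluedψ (parOf q) t := by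
  have c := (contDiff_parOf (n := n))
  have h0 : SobFamily {0} (n + 3) fun (q : Hper (n + 1)) t => startψ q t - leftψ (parOf q) t :=
    SobFamily.kepler_sub sobFamily_val startψ_spec.1 startψ_spec.2.1 startψ_spec.2.2.1
      (sobFamily_parPot.comp c) (cFamily_left.1.comp c) (cFamily_left.2.comp c)
      (fun q => keplerEq_left (parOf q)) (sobFamily_sub_parPot.mono_set (by simp))
      (fun q t ht => by
        rw [mem_singleton_iff.1 ht.1, leftψ, startψ_spec.2.2.2.1, startψ_spec.2.2.2.1, sub_self])
      (fun q t ht => by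
        rw [mem_singleton_iff.1 ht.1, leftη, startψ_spec.2.2.2.2, startψ_spec.2.2.2.2, sub_self])
  have h1 : SobFamily {2 * Real.pi} (n + 3)
      fun (q : Hper (n + 1)) t => startψ q t - rightψ (parOf q) t :=
    SobFamily.kepler_sub sobFamily_val startψ_spec.1 startψ_spec.2.1 startψ_spec.2.2.1
      (sobFamily_parPot.comp c) (cFamily_right.1.comp c) (cFamily_right.2.comp c)
      (fun q => keplerEq_right (parOf q)) (sobFamily_sub_parPot.mono_set (by simp))
      (fun q t ht => by
        rw [mem_singleton_iff.1 ht.1, rightψ, endψ_spec.2.2.2.1]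
        exact sub_self _)
      (fun q t ht => by
        rw [mem_singleton_iff.1 ht.1, rightη, endψ_spec.2.2.2.2]
        exact sub_self _)
  have a0 := (h0.sub (sobFamily_glued_left.1.comp c)).congr
    (g := fun (q : Hper (n + 1)) t => startψ q t - gluedψ (parOf q) t) fun q t _ => by ring
  have a1 := (h1.sub (sobFamily_glued_right.1.comp c)).congr
    (g := fun (q : Hper (n + 1)) t => startψ q t - gluedψ (parOf q) t) fun q t _ => by ring
  exact (a0.union a1).mono_set (by rw [singleton_union])

theorem exists_flatOf : ∃ h : Hper (n + 1) → FlatSpace (n + 3), ContDiff ℝ ∞ h ∧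
    ∀ q, val (h q).toHper =ᵐ[circleMeasure] fun t => startψ q t - gluedψ (parOf q) t :=
  exists_contDiff_flat sobFamily_startψ_sub_gluedψ

/-- The solution with coordinates `(a, b, y, h)`. -/
def coordψ (x : Par n × FlatSpace (n + 3)) (t : ℝ) : ℝ := gluedψ x.1 t + val x.2.toHper t

/-- The derivative of `coordψ`. -/
def coordη (x : Par n × FlatSpace (n + 3)) (t : ℝ) : ℝ := gluedη x.1 t + val (shift x.2.toHper) t

/-- The second derivative of `coordψ`. -/
def coordκ (x : Par n × FlatSpace (n + 3)) (t : ℝ) : ℝ :=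
  gluedκ x.1 t + val (shift (shift x.2.toHper)) t

/-- The potential of the solution `coordψ`. -/
def coordPot (x : Par n × FlatSpace (n + 3)) (t : ℝ) : ℝ :=
  1 / 2 * (coordη x t ^ 2 / 2 - 2 * Real.exp (2 * coordψ x t) - coordκ x t)

theorem sobFamily_flat_shift : SobFamily {0, 2 * Real.pi} (n + 2)
      (fun u : FlatSpace (n + 3) => val (shift u.toHper)) ∧
    SobFamily {0, 2 * Real.pi} (n + 1)
      (fun u : FlatSpace (n + 3) => val (shift (shift u.toHper))) := by
  have h := SobFamily.derivative (sobFamily_flat (n := n + 3)) (fun u => isPrimitive_val u.toHper)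
    (cFamily_val.comp (shift.contDiff.comp contDiff_toHper))
  exact ⟨h, SobFamily.derivative h (fun u => isPrimitive_val _)
    (cFamily_val.comp (shift.contDiff.comp (shift.contDiff.comp contDiff_toHper)))⟩

theorem isPrimitive_coordψ (x : Par n × FlatSpace (n + 3)) : IsPrimitive (coordψ x) (coordη x) :=
  (isPrimitive_gluedψ x.1).add (isPrimitive_val _)

theorem isPrimitive_coordη (x : Par n × FlatSpace (n + 3)) : IsPrimitive (coordη x) (coordκ x) :=
  (isPrimitive_gluedη x.1).add (isPrimitive_val _)

theorem keplerEq_coord (x : Par n × FlatSpace (n + 3)) :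
    KeplerEq (coordPot x) (coordψ x) (coordη x) :=
  ⟨isPrimitive_coordψ x, (isPrimitive_coordη x).congr (fun _ _ => rfl)
    (Filter.Eventually.of_forall fun t => by simp only [coordPot]; ring)⟩

theorem cFamily_coordψ : CFamily (coordψ (n := n)) :=
  (cFamily_gluedψ.comp contDiff_fst).add (sobFamily_flat.cFamily.comp contDiff_snd)

theorem cFamily_coordη : CFamily (coordη (n := n)) :=
  (cFamily_gluedη.comp contDiff_fst).add (sobFamily_flat_shift.1.cFamily.comp contDiff_snd)

theorem cFamily_coordκ : CFamily (coordκ (n := n)) :=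
  (cFamily_gluedκ.comp contDiff_fst).add (sobFamily_flat_shift.2.cFamily.comp contDiff_snd)

theorem continuousOn_coordPot (x : Par n × FlatSpace (n + 3)) :
    ContinuousOn (coordPot x) (Icc 0 (2 * Real.pi)) := by
  have h1 := cFamily_coordψ.continuousOn x
  have h2 := cFamily_coordη.continuousOn x
  have h3 := cFamily_coordκ.continuousOn x
  unfold coordPot
  fun_prop

theorem val_flat_endpoint (u : FlatSpace (n + 3)) {t : ℝ} (ht : t = 0 ∨ t = 2 * Real.pi) :
    val u.toHper t = 0 ∧ val (shift u.toHper) t = 0 := by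
  have hm : t ∈ ({0, 2 * Real.pi} : Set ℝ) ∩ Icc 0 (2 * Real.pi) := by
    obtain rfl | rfl := ht
    · exact ⟨by simp, left_mem_circle⟩
    · exact ⟨by simp, right_mem_circle⟩
  exact ⟨(sobFamily_flat (n := n + 3)).2.1 u t hm,
    (sobFamily_flat_shift (n := n)).1.2.1 u t hm⟩

/-- At each endpoint `coordψ` has maximal contact with a Kepler solution of potential `y`, so the
potential read off from `coordψ` has maximal contact with `y`. The nonlinear periodicity condition
thus holds for every flat `h`. -/
theorem sobFamily_coordPot_sub : SobFamily {0, 2 * Real.pi} (n + 1)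
    fun (x : Par n × FlatSpace (n + 3)) t => coordPot x t - parPot x.1 t := by
  have c : ContDiff ℝ ∞ fun x : Par n × FlatSpace (n + 3) => x.1 := contDiff_fst
  have c' : ContDiff ℝ ∞ fun x : Par n × FlatSpace (n + 3) => x.2 := contDiff_snd
  have l := sobFamily_glued_left (n := n)
  have r := sobFamily_glued_right (n := n)
  have f0 := (sobFamily_flat (n := n + 3)).comp c'
  have f1 := (sobFamily_flat_shift (n := n)).1.comp c'
  have f2 := (sobFamily_flat_shift (n := n)).2.comp c'
  have s0 : ({0} : Set ℝ) ⊆ {0, 2 * Real.pi} := by simp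
  have s1 : ({2 * Real.pi} : Set ℝ) ⊆ {0, 2 * Real.pi} := by simp
  have hη : SobFamily ∅ (n + 2) (coordη (n := n)) :=
    ((((l.2.1.free.add sobFamily_left.1).comp c).add f1.free)).congr fun x t _ => by
      simp only [coordη]; ring
  have a0 := SobFamily.potential_sub (S := {0}) (n := n + 1) cFamily_coordψ cFamily_coordη
    (κ₁ := coordκ) (κ₂ := fun x : Par n × FlatSpace (n + 3) => leftκ x.1)
    isPrimitive_coordψ (cFamily_left.1.comp c) (cFamily_left.2.comp c)
    (fun x => (keplerEq_left x.1).1) hη (sobFamily_left.1.comp c)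
    (((l.2.2.comp c).add (f2.mono_set s0)).congr fun x t _ => by simp only [coordκ]; ring)
    (((l.2.1.pred.comp c).add (f1.pred.mono_set s0)).congr fun x t _ => by
      simp only [coordη]; ring)
    (fun x t ht => by
      have e1 := l.1.2.1 x.1 t ht
      have e2 := f0.2.1 x t ⟨s0 ht.1, ht.2⟩
      simp only at e2
      simp only [coordψ, e2]
      linarith)
  have a1 := SobFamily.potential_sub (S := {2 * Real.pi}) (n := n + 1) cFamily_coordψ cFamily_coordη
    (κ₁ := coordκ) (κ₂ := fun x : Par n × FlatSpace (n + 3) => rightκ x.1)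
    isPrimitive_coordψ (cFamily_right.1.comp c) (cFamily_right.2.comp c)
    (fun x => (keplerEq_right x.1).1) hη (sobFamily_right.1.comp c)
    (((r.2.2.comp c).add (f2.mono_set s1)).congr fun x t _ => by simp only [coordκ]; ring)
    (((r.2.1.pred.comp c).add (f1.pred.mono_set s1)).congr fun x t _ => by
      simp only [coordη]; ring)
    (fun x t ht => by
      have e1 := r.1.2.1 x.1 t ht
      have e2 := f0.2.1 x t ⟨s1 ht.1, ht.2⟩
      simp only at e2
      simp only [coordψ, e2]
      linarith)
  have b0 := a0.congr (g := fun (x : Par n × FlatSpace (n + 3)) t => coordPot x t - parPot x.1 t)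
    fun x t _ => by simp only [coordPot, leftκ]; ring
  have b1 := a1.congr (g := fun (x : Par n × FlatSpace (n + 3)) t => coordPot x t - parPot x.1 t)
    fun x t _ => by simp only [coordPot, rightκ]; ring
  exact (b0.union b1).mono_set (by rw [singleton_union])

/-- The potential of `coordψ` is `y` plus a flat function, hence periodic, and its component
orthogonal to the flat functions is again `y`. -/
theorem exists_potOf : ∃ q : Par n × FlatSpace (n + 3) → Hper (n + 1), ContDiff ℝ ∞ q ∧
    (∀ x, EqOn (val (q x)) (coordPot x) (Icc 0 (2 * Real.pi))) ∧
    ∀ x, perpProj (q x) = x.1.2.2 := by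
  obtain ⟨u, hu, h⟩ := exists_contDiff_flat (sobFamily_coordPot_sub (n := n))
  refine ⟨fun x => x.1.2.2.toHper + (u x).toHper,
    (contDiff_parPot.comp contDiff_fst).add (contDiff_toHper.comp hu), fun x => ?_,
    fun x => perpProj_add _ (u x).mem⟩
  refine eqOn_circle_of_ae (isPrimitive_val _).continuousOn (continuousOn_coordPot x) ?_
  filter_upwards [h x, val_add_ae x.1.2.2.toHper (u x).toHper] with t h1 h2
  rw [h2, h1, parPot]
  ring

/-- The coordinates `(a, b, y, h)` as a smooth equivalence. -/
theorem exists_coordEquiv : ∃ Φ : Hper (n + 1) ≃ Par n × FlatSpace (n + 3),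
    ContDiff ℝ ∞ Φ ∧ ContDiff ℝ ∞ Φ.symm ∧
    ∀ q, EqOn (startψ q) (coordψ (Φ q)) (Icc 0 (2 * Real.pi)) ∧ (Φ q).1 = parOf q := by
  obtain ⟨h, hh, eh⟩ := exists_flatOf (n := n)
  obtain ⟨Q, hQ, eQ, pQ⟩ := exists_potOf (n := n)
  have gl : ∀ x : Par n, gluedψ x 0 = 0 ∧ gluedη x 0 = 0 := fun x => by
    have e1 := sobFamily_glued_left.1.2.1 x 0 ⟨rfl, left_mem_circle⟩
    have e2 := sobFamily_glued_left.2.1.2.1 x 0 ⟨rfl, left_mem_circle⟩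
    have e3 : leftψ x 0 = 0 := startψ_spec.2.2.2.1 _
    have e4 : leftη x 0 = 0 := startψ_spec.2.2.2.2 _
    constructor <;> linarith
  have gr : ∀ x : Par n, gluedψ x (2 * Real.pi) = x.1 ∧ gluedη x (2 * Real.pi) = x.2.1 :=
    fun x => by
      have e1 := sobFamily_glued_right.1.2.1 x (2 * Real.pi) ⟨rfl, right_mem_circle⟩
      have e2 := sobFamily_glued_right.2.1.2.1 x (2 * Real.pi) ⟨rfl, right_mem_circle⟩
      have e3 : rightψ x (2 * Real.pi) = x.1 := endψ_spec.2.2.2.1 (endPar x)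
      have e4 : rightη x (2 * Real.pi) = x.2.1 := endψ_spec.2.2.2.2 (endPar x)
      constructor <;> linarith
  have hψ : ∀ q : Hper (n + 1), EqOn (startψ q) (coordψ (parOf q, h q)) (Icc 0 (2 * Real.pi)) :=
    fun q => eqOn_circle_of_ae (startψ_spec.1.continuousOn q) (cFamily_coordψ.continuousOn _) (by
      filter_upwards [eh q] with t ht
      simp only [coordψ, ht]
      ring)
  refine ⟨⟨fun q => (parOf q, h q), Q, fun q => ?_, fun x => ?_⟩, contDiff_parOf.prodMk hh, hQ,
    fun q => ⟨hψ q, rfl⟩⟩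
  -- Left inverse: both potentials are read off from the same function `ψ`, since `startψ q` equals
  -- `coordψ (parOf q, h q)` together with its derivatives.
  · have k := startψ_spec.2.2.1 q
    have e1 := (k.1.congr (hψ q) ae_eq_rfl).unique (isPrimitive_coordψ _)
    have e2 := eqOn_circle_of_ae (startψ_spec.2.1.continuousOn q) (cFamily_coordη.continuousOn _) e1
    have e3 := (k.2.congr e2 ae_eq_rfl).unique (isPrimitive_coordη _)
    refine ext_val (eqOn_circle_of_ae (isPrimitive_val _).continuousOn
      (isPrimitive_val _).continuousOn ?_)
    filter_upwards [e3, ae_circle_of_forall (eQ (parOf q, h q)), ae_circle_of_forall (hψ q),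
      ae_circle_of_forall e2] with t i1 i2 i3 i4
    rw [i2, coordPot, ← i1, ← i3, ← i4]
    ring
  -- Right inverse: `coordψ x` solves the Kepler equation of `Q x` with zero data at `0`, so by
  -- uniqueness it is `startψ (Q x)`; the coordinates are then read at `2π` and by subtracting the
  -- glued function.
  · have k := startψ_spec.2.2.1 (Q x)
    have k' : KeplerEq (val (Q x)) (coordψ x) (coordη x) :=
      ⟨(keplerEq_coord x).1, (keplerEq_coord x).2.congr (fun _ _ => rfl)
        (ae_circle_of_forall fun t ht => by simp only [eQ x ht])⟩
    have f0 := val_flat_endpoint x.2 (Or.inl rfl)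
    have f1 := val_flat_endpoint x.2 (Or.inr rfl)
    have u := keplerEq_unique (isPrimitive_val _).continuousOn k k'
      (by rw [startψ_spec.2.2.2.1, coordψ, (gl _).1, f0.1, add_zero])
      (by rw [startψ_spec.2.2.2.2, coordη, (gl _).2, f0.2, add_zero])
    have hp : parOf (Q x) = x.1 := by
      refine Prod.ext ?_ (Prod.ext ?_ (pQ x))
      · change startψ (Q x) (2 * Real.pi) = _
        rw [u.1 right_mem_circle, coordψ, (gr _).1, f1.1, add_zero]
      · change startη (Q x) (2 * Real.pi) = _
        rw [u.2 right_mem_circle, coordη, (gr _).2, f1.2, add_zero]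
    refine Prod.ext hp ?_
    have : (h (Q x)).toHper = x.2.toHper := ext_val (eqOn_circle_of_ae
      (isPrimitive_val _).continuousOn (isPrimitive_val _).continuousOn (by
        filter_upwards [eh (Q x), ae_circle_of_forall u.1] with t i1 i2
        rw [i1, i2, hp, coordψ]
        ring))
    exact Subtype.ext this

end Hper
end

noncomputable section

/-! ### Changing one real coordinate fibrewise -/

/-- The map `(x, s) ↦ (x, f (x, s))` is a smooth bijection whose derivative is block triangular with
invertible diagonal, so the inverse function theorem applies at every point. -/
theorem exists_fibre_equiv {E : Type*} [NormedAddCommGroup E] [NormedSpace ℝ E] [CompleteSpace E]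
    {f : E × ℝ → ℝ} (hf : ContDiff ℝ ∞ f)
    (hd : ∀ x s, ∃ d ≠ 0, HasDerivAt (fun r => f (x, r)) d s)
    (hb : ∀ x, Function.Bijective fun s => f (x, s)) :
    ∃ Φ : E × ℝ ≃ E × ℝ, ContDiff ℝ ∞ Φ ∧ ContDiff ℝ ∞ Φ.symm ∧ ∀ x, Φ x = (x.1, f x) := by
  set F : E × ℝ → E × ℝ := fun x => (x.1, f x) with hF
  have hFb : Function.Bijective F := by
    constructor
    · rintro ⟨x, s⟩ ⟨x', s'⟩ h
      obtain ⟨h1, h2⟩ := Prod.mk.inj h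
      simp only at h1
      subst h1
      exact Prod.ext rfl ((hb x).1 h2)
    · rintro ⟨x, s⟩
      obtain ⟨r, hr⟩ := (hb x).2 s
      exact ⟨(x, r), Prod.ext rfl hr⟩
  have hFc : ContDiff ℝ ∞ F := contDiff_fst.prodMk hf
  refine ⟨Equiv.ofBijective F hFb, hFc, ?_, fun x => rfl⟩
  rw [contDiff_iff_contDiffAt]
  intro y
  obtain ⟨⟨x, s⟩, rfl⟩ := hFb.2 y
  obtain ⟨d, hd0, hd⟩ := hd x s
  set L := fderiv ℝ f (x, s) with hL
  have hfd : HasFDerivAt f L (x, s) := (hf.differentiable (by simp) _).hasFDerivAt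
  have hL1 : L (0, 1) = d := by
    have h1 : HasDerivAt (fun r : ℝ => (x, r)) ((0 : E), (1 : ℝ)) s :=
      (hasDerivAt_const s x).prodMk (hasDerivAt_id s)
    exact (hfd.comp_hasDerivAt s h1).unique hd
  have hLs : ∀ v r, L (v, r) = L (v, 0) + r * d := fun v r => by
    rw [← hL1, ← smul_eq_mul, ← map_smul, ← map_add]
    simp
  let e : (E × ℝ) ≃L[ℝ] (E × ℝ) := ContinuousLinearEquiv.equivOfInverse
    ((ContinuousLinearMap.fst ℝ E ℝ).prod L)
    ((ContinuousLinearMap.fst ℝ E ℝ).prod (d⁻¹ • (ContinuousLinearMap.snd ℝ E ℝ -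
      L ∘L (ContinuousLinearMap.inl ℝ E ℝ) ∘L (ContinuousLinearMap.fst ℝ E ℝ))))
    (fun ⟨v, r⟩ => by
      simp [hLs v r]
      field_simp)
    (fun ⟨v, r⟩ => by
      simp [hLs v (d⁻¹ * (r - L (v, 0)))]
      field_simp
      ring)
  have hFd : HasFDerivAt F (e : (E × ℝ) →L[ℝ] (E × ℝ)) (x, s) := hasFDerivAt_fst.prodMk hfd
  have h1 := hFc.contDiffAt.to_localInverse hFd (by simp)
  have h2 := (hFc.contDiffAt.hasStrictFDerivAt' hFd (by simp)).eventually_right_inverse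
  -- The local inverse is a right inverse near the point, so by injectivity it coincides there with
  -- the global one.
  refine h1.congr_of_eventuallyEq ?_
  filter_upwards [h2] with y hy
  rw [Equiv.symm_apply_eq]
  exact hy.symm

/-- The vector `e` is not normalized, so the coefficient along it is `⟨e, v⟩ / ⟨e, e⟩`. -/
theorem exists_line_split {V : Type*} [NormedAddCommGroup V] [InnerProductSpace ℝ V] {e : V}
    (he : e ≠ 0) : ∃ Φ : V ≃ ((ℝ ∙ e)ᗮ : Submodule ℝ V) × ℝ, ContDiff ℝ ∞ Φ ∧
      ContDiff ℝ ∞ Φ.symm ∧ ∀ x, Φ.symm x = (x.1 : V) + x.2 • e := by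
  have hn : inner ℝ e e ≠ 0 := inner_self_ne_zero.2 he
  have hz : ∀ z : ((ℝ ∙ e)ᗮ : Submodule ℝ V), inner ℝ e (z : V) = 0 := fun z =>
    z.2 e (Submodule.mem_span_singleton_self e)
  refine ⟨⟨fun v => ((ℝ ∙ e)ᗮ.orthogonalProjectionOnto v, (inner ℝ e e)⁻¹ * inner ℝ e v),
    fun x => (x.1 : V) + x.2 • e, fun v => ?_, fun ⟨z, s⟩ => ?_⟩, ?_, ?_, fun x => rfl⟩
  · have h := (ℝ ∙ e).sub_projOrthogonal_mem v
    obtain ⟨r, hr⟩ := Submodule.mem_span_singleton.1 h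
    have hv : v = ((ℝ ∙ e)ᗮ.orthogonalProjectionOnto v : V) + r • e := by rw [hr]; abel
    have hi : inner ℝ e v = r * inner ℝ e e := by
      conv_lhs => rw [hv]
      rw [inner_add_right, hz, inner_smul_right, zero_add]
    simp only
    rw [hi, mul_comm r, inv_mul_cancel_left₀ hn]
    exact hv.symm
  · refine Prod.ext ?_ ?_
    · exact (ℝ ∙ e).projOrthogonal_add z (Submodule.smul_mem _ s (Submodule.mem_span_singleton_self e))
    · simp only
      rw [inner_add_right, hz, inner_smul_right, zero_add, mul_comm s, inv_mul_cancel_left₀ hn]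
  · exact ((ℝ ∙ e)ᗮ.orthogonalProjectionOnto).contDiff.prodMk
      (contDiff_const.mul (contDiff_const.inner ℝ contDiff_id))
  · exact (((ℝ ∙ e)ᗮ.subtypeL).contDiff.comp contDiff_fst).add (contDiff_snd.smul contDiff_const)

/-! ### A flat positive function -/

/-- A nonnegative smooth function, positive exactly on `(0, 2π)`. -/
def bump (t : ℝ) : ℝ := expNegInvGlue t * expNegInvGlue (2 * Real.pi - t)

theorem contDiff_bump : ContDiff ℝ ∞ bump :=
  expNegInvGlue.contDiff.mul (expNegInvGlue.contDiff.comp (contDiff_const.sub contDiff_id))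

theorem bump_pos {t : ℝ} (ht : t ∈ Ioo 0 (2 * Real.pi)) : 0 < bump t :=
  mul_pos (expNegInvGlue.pos_of_pos ht.1) (expNegInvGlue.pos_of_pos (sub_pos.2 ht.2))

theorem sobFamily_mul_bump {E : Type*} [NormedAddCommGroup E] [NormedSpace ℝ E] {c : ℝ → ℝ}
    (hc : ContDiff ℝ ∞ c) (n : ℕ) :
    SobFamily {0, 2 * Real.pi} n fun _ : E => fun t => c t * bump t := by
  refine SobFamily.of_contDiff (hc.mul contDiff_bump) fun t ht => ?_
  obtain rfl | ht := ht
  · exact Or.inl fun s hs => by rw [bump, expNegInvGlue.zero_of_nonpos hs, zero_mul, mul_zero]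
  · rw [mem_singleton_iff.1 ht]
    exact Or.inr fun s hs => by
      rw [bump, expNegInvGlue.zero_of_nonpos (x := 2 * Real.pi - s) (by linarith), mul_zero, mul_zero]

section ExpIntegral

variable {ψ β : ℝ → ℝ}

/-- Integrate `1 + x ≤ eˣ`: a convex function of the amplitude lies above its tangents. This one
inequality yields the derivative, strict monotonicity and growth at infinity. -/
theorem integral_exp_tangent (hψ : ContinuousOn ψ (Icc 0 (2 * Real.pi)))
    (hβ : ContinuousOn β (Icc 0 (2 * Real.pi))) (s r : ℝ) :
    (∫ t in (0 : ℝ)..(2 * Real.pi), Real.exp (ψ t + s * β t)) +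
      (r - s) * (∫ t in (0 : ℝ)..(2 * Real.pi), β t * Real.exp (ψ t + s * β t)) ≤
    ∫ t in (0 : ℝ)..(2 * Real.pi), Real.exp (ψ t + r * β t) := by
  have c : ∀ s, ContinuousOn (fun t => Real.exp (ψ t + s * β t)) (Icc 0 (2 * Real.pi)) := fun s => by
    fun_prop
  have c' : ContinuousOn (fun t => (r - s) * (β t * Real.exp (ψ t + s * β t)))
      (Icc 0 (2 * Real.pi)) := continuousOn_const.mul (hβ.mul (c s))
  rw [← intervalIntegral.integral_const_mul, ← intervalIntegral.integral_add
    (c s).intervalIntegrable_circle c'.intervalIntegrable_circle]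
  refine intervalIntegral.integral_mono_on two_pi_nonneg
    ((c s).add c').intervalIntegrable_circle
    (c r).intervalIntegrable_circle fun t _ => ?_
  have h := Real.add_one_le_exp ((r - s) * β t)
  have e : Real.exp (ψ t + r * β t) = Real.exp (ψ t + s * β t) * Real.exp ((r - s) * β t) := by
    rw [← Real.exp_add]; congr 1; ring
  rw [e]
  have := mul_le_mul_of_nonneg_left h (Real.exp_pos (ψ t + s * β t)).le
  linarith

theorem integral_exp_pos (hψ : ContinuousOn ψ (Icc 0 (2 * Real.pi))) :
    0 < ∫ t in (0 : ℝ)..(2 * Real.pi), Real.exp (ψ t) :=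
  intervalIntegral.intervalIntegral_pos_of_pos_on
    (Real.continuous_exp.comp_continuousOn hψ).intervalIntegrable_circle
    (fun _ _ => Real.exp_pos _) (by positivity)

/-- The difference between the integral and its supporting line has a minimum at `s`, so the
derivative is the slope of that line; no differentiation under the integral sign is needed. -/
theorem deriv_integral_exp (hψ : ContinuousOn ψ (Icc 0 (2 * Real.pi)))
    (hβ : ContinuousOn β (Icc 0 (2 * Real.pi))) {d s : ℝ}
    (hd : HasDerivAt (fun r => ∫ t in (0 : ℝ)..(2 * Real.pi), Real.exp (ψ t + r * β t)) d s) :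
    d = ∫ t in (0 : ℝ)..(2 * Real.pi), β t * Real.exp (ψ t + s * β t) := by
  set K := ∫ t in (0 : ℝ)..(2 * Real.pi), β t * Real.exp (ψ t + s * β t)
  have h := hd.sub (((hasDerivAt_id s).sub_const s).mul_const K)
  have hm : IsLocalMin ((fun r => ∫ t in (0 : ℝ)..(2 * Real.pi), Real.exp (ψ t + r * β t)) -
      fun r => (id r - s) * K) s := by
    refine Filter.Eventually.of_forall fun r => ?_
    have := integral_exp_tangent hψ hβ s r
    simp only [Pi.sub_apply, id]
    linarith
  have := hm.hasDerivAt_eq_zero h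
  linarith

theorem integral_mul_exp_pos (hψ : ContinuousOn ψ (Icc 0 (2 * Real.pi)))
    (hβ : ContinuousOn β (Icc 0 (2 * Real.pi))) (hpos : ∀ t ∈ Ioo 0 (2 * Real.pi), 0 < β t) (s : ℝ) :
    0 < ∫ t in (0 : ℝ)..(2 * Real.pi), β t * Real.exp (ψ t + s * β t) :=
  intervalIntegral.intervalIntegral_pos_of_pos_on
    (ContinuousOn.intervalIntegrable_circle (by fun_prop))
    (fun t ht => mul_pos (hpos t ht) (Real.exp_pos _)) (by positivity)

/-- The integral increases strictly. It is unbounded as `s → ∞`, by the tangent at `0`, and tends to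
zero as `s → -∞`, by dominated convergence, because `β > 0` on the open interval. -/
theorem bijective_log_integral_exp (hψ : ContinuousOn ψ (Icc 0 (2 * Real.pi)))
    (hβ : ContinuousOn β (Icc 0 (2 * Real.pi))) (hpos : ∀ t ∈ Ioo 0 (2 * Real.pi), 0 < β t)
    (hc : Continuous fun s => ∫ t in (0 : ℝ)..(2 * Real.pi), Real.exp (ψ t + s * β t)) :
    Function.Bijective fun s => Real.log (∫ t in (0 : ℝ)..(2 * Real.pi), Real.exp (ψ t + s * β t)) := by
  set J : ℝ → ℝ := fun s => ∫ t in (0 : ℝ)..(2 * Real.pi), Real.exp (ψ t + s * β t) with hJ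
  have hJp : ∀ s, 0 < J s := fun s => integral_exp_pos (by fun_prop)
  have hJm : StrictMono J := fun s r hsr => by
    have := integral_exp_tangent hψ hβ s r
    have := mul_pos (sub_pos.2 hsr) (integral_mul_exp_pos hψ hβ hpos s)
    simp only [hJ]
    linarith
  have htop : Filter.Tendsto J Filter.atTop Filter.atTop := by
    have h1 : ∀ r, J 0 + r * (∫ t in (0 : ℝ)..(2 * Real.pi), β t * Real.exp (ψ t + 0 * β t)) ≤ J r :=
      fun r => by
      have := integral_exp_tangent hψ hβ 0 r
      rwa [sub_zero] at this
    exact Filter.tendsto_atTop_mono h1 (Filter.tendsto_atTop_add_const_left _ _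
      (Filter.tendsto_id.atTop_mul_const (integral_mul_exp_pos hψ hβ hpos 0)))
  have hbot : Filter.Tendsto J Filter.atBot (𝓝 0) := by
    have h0 : (0 : ℝ) = ∫ t in (0 : ℝ)..(2 * Real.pi), (0 : ℝ) := by simp
    rw [h0]
    have hae : ∀ᵐ t ∂volume, t ∈ Set.uIoc 0 (2 * Real.pi) → t ∈ Ioo 0 (2 * Real.pi) := by
      filter_upwards [Measure.ae_ne volume (2 * Real.pi)] with t ht hu
      rw [uIoc_of_le two_pi_nonneg] at hu
      exact ⟨hu.1, lt_of_le_of_ne hu.2 ht⟩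
    refine intervalIntegral.tendsto_integral_filter_of_dominated_convergence
      (fun t => Real.exp (ψ t)) ?_ ?_ ?_ ?_
    · refine Filter.Eventually.of_forall fun s => ?_
      exact (ContinuousOn.intervalIntegrable_circle
        (g := fun t => Real.exp (ψ t + s * β t)) (by fun_prop)).def'.aestronglyMeasurable
    · filter_upwards [Filter.eventually_le_atBot (0 : ℝ)] with s hs
      filter_upwards [hae] with t ht hu
      rw [Real.norm_eq_abs, Real.abs_exp]
      have := mul_nonpos_of_nonpos_of_nonneg hs (hpos t (ht hu)).le
      exact Real.exp_le_exp.2 (by linarith)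
    · exact (Real.continuous_exp.comp_continuousOn hψ).intervalIntegrable_circle
    · filter_upwards [hae] with t ht hu
      refine Real.tendsto_exp_atBot.comp ?_
      exact Filter.tendsto_atBot_add_const_left _ _
        (Filter.tendsto_id.atBot_mul_const (hpos t (ht hu)))
  refine ⟨fun s r h => hJm.injective (Real.log_injOn_pos (hJp s) (hJp r) h), fun y => ?_⟩
  obtain ⟨s, hs⟩ := ((hbot.eventually (gt_mem_nhds (Real.exp_pos y))).exists)
  obtain ⟨r, hr⟩ := ((htop.eventually (Filter.eventually_gt_atTop (Real.exp y))).exists)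
  obtain ⟨x, hx⟩ := mem_range_of_exists_le_of_exists_ge hc ⟨s, hs.le⟩ ⟨r, hr.le⟩
  exact ⟨x, (congrArg Real.log hx).trans (Real.log_exp y)⟩

end ExpIntegral
end

/-! ### The total angle as a coordinate -/

noncomputable section

namespace Hper

variable {n : ℕ}

attribute [local instance] normedGroup innerProduct normedSpace

theorem exists_flat_mul_bump (n : ℕ) {c : ℝ → ℝ} (hc : ContDiff ℝ ∞ c) :
    ∃ u : FlatSpace n, val u.toHper =ᵐ[circleMeasure] fun t => c t * bump t := by
  obtain ⟨u, -, h⟩ := exists_contDiff_flat (sobFamily_mul_bump (E := ℝ) hc n)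
  exact ⟨u 0, h 0⟩

/-- The function `bump` as an element of `FlatSpace n`. -/
def flatBump (n : ℕ) : FlatSpace n := (exists_flat_mul_bump n (c := fun _ => 1) contDiff_const).choose

theorem val_flatBump : EqOn (val (flatBump (n + 1)).toHper) bump (Icc 0 (2 * Real.pi)) := by
  have h := (exists_flat_mul_bump (n + 1) (c := fun _ => 1) contDiff_const).choose_spec
  refine eqOn_circle_of_ae (isPrimitive_val _).continuousOn contDiff_bump.continuous.continuousOn ?_
  filter_upwards [h] with t ht
  exact ht.trans (one_mul _)

theorem flatBump_ne_zero : flatBump (n + 1) ≠ 0 := fun h => by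
  have hm : Real.pi ∈ Ioo 0 (2 * Real.pi) := ⟨Real.pi_pos, by linarith [Real.pi_pos]⟩
  have h1 := val_flatBump (n := n) (Ioo_subset_Icc_self hm)
  have h2 : val (0 : Hper (n + 1)) Real.pi = 0 := by
    have := val_smul (0 : ℝ) (0 : Hper (n + 1)) (Ioo_subset_Icc_self hm)
    rwa [zero_smul, zero_mul] at this
  rw [h] at h1
  exact (bump_pos hm).ne' (h1.symm.trans h2)

/-- The orthogonal complement of `flatBump n` in `FlatSpace n`. -/
def FlatRest (n : ℕ) : Type := ((ℝ ∙ flatBump n)ᗮ : Submodule ℝ (FlatSpace n))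

instance : NormedAddCommGroup (FlatRest n) :=
  Submodule.normedAddCommGroup ((ℝ ∙ flatBump n)ᗮ : Submodule ℝ (FlatSpace n))

instance : InnerProductSpace ℝ (FlatRest n) :=
  Submodule.innerProductSpace ((ℝ ∙ flatBump n)ᗮ : Submodule ℝ (FlatSpace n))

instance : CompleteSpace (FlatRest n) :=
  (Submodule.isClosed_orthogonal (ℝ ∙ flatBump n)).completeSpace_coe

/-- Moving in the last coordinate adds multiples of `bump` to the function, without changing its
jets at the endpoints. -/
theorem exists_flat_split : ∃ Φ : FlatSpace (n + 1) ≃ FlatRest (n + 1) × ℝ, ContDiff ℝ ∞ Φ ∧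
    ContDiff ℝ ∞ Φ.symm ∧ ∀ z s t, t ∈ Icc 0 (2 * Real.pi) →
      val (Φ.symm (z, s)).toHper t = val (Φ.symm (z, 0)).toHper t + s * bump t := by
  obtain ⟨Φ, h1, h2, h3⟩ := exists_line_split (flatBump_ne_zero (n := n))
  refine ⟨Φ, h1, h2, fun z s t ht => ?_⟩
  have e : (Φ.symm (z, s)) = Φ.symm (z, 0) + s • flatBump (n + 1) := by rw [h3, h3]; simp
  change val ((show FlatSpace (n + 1) from Φ.symm (z, s)).toHper) t = _
  rw [e]
  refine (val_add (Φ.symm (z, 0)).toHper (s • flatBump (n + 1)).toHper ht).trans ?_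
  congr 1
  refine (val_smul s (flatBump (n + 1)).toHper ht).trans ?_
  rw [val_flatBump ht]

/-- The Hilbert space complementary to the three real coordinates. -/
abbrev Rest (n : ℕ) : Type := WithLp 2 (FlatPerp (n + 1) × FlatRest (n + 3))

/-- The total angle of the potential. -/
def totalAngle (q : Hper (n + 1)) : ℝ := ∫ t in (0 : ℝ)..(2 * Real.pi), Real.exp (startψ q t)

theorem totalAngle_pos (q : Hper (n + 1)) : 0 < totalAngle q :=
  integral_exp_pos (startψ_spec.1.continuousOn q)

/-- The coordinates `(a, b, log c)` and a complementary Hilbert space. -/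
theorem exists_realCoordEquiv (n : ℕ) : ∃ Φ : Hper (n + 1) ≃ (ℝ × ℝ × ℝ) × Rest n,
    ContDiff ℝ ∞ Φ ∧ ContDiff ℝ ∞ Φ.symm ∧ ∀ q, (Φ q).1 =
      (startψ q (2 * Real.pi), startη q (2 * Real.pi), Real.log (totalAngle q)) := by
  obtain ⟨Φ₁, c₁, c₁', e₁⟩ := exists_coordEquiv (n := n)
  obtain ⟨Φ₂, c₂, c₂', e₂⟩ := exists_flat_split (n := n + 2)
  let g : (Par n × FlatRest (n + 3)) × ℝ → Par n × FlatSpace (n + 3) :=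
    fun x => (x.1.1, Φ₂.symm (x.1.2, x.2))
  have hg : ContDiff ℝ ∞ g := (contDiff_fst.comp contDiff_fst).prodMk
    (c₂'.comp ((contDiff_snd.comp contDiff_fst).prodMk contDiff_snd))
  have hψ := cFamily_coordψ.comp hg
  have hJ : ContDiff ℝ ∞ fun x => ∫ t in (0 : ℝ)..(2 * Real.pi), Real.exp (coordψ (g x) t) :=
    hψ.exp.l2Family.integral.contDiff_eval right_mem_circle
  have hJp : ∀ x, 0 < ∫ t in (0 : ℝ)..(2 * Real.pi), Real.exp (coordψ (g x) t) := fun x =>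
    integral_exp_pos (hψ.continuousOn x)
  have hs : ∀ x s, EqOn (coordψ (g (x, s))) (fun t => coordψ (g (x, 0)) t + s * bump t)
      (Icc 0 (2 * Real.pi)) := fun x s t ht => by
    simp only [coordψ, g]
    rw [e₂ x.2 s t ht]
    ring
  have hi : ∀ x s, ∫ t in (0 : ℝ)..(2 * Real.pi), Real.exp (coordψ (g (x, s)) t) =
      ∫ t in (0 : ℝ)..(2 * Real.pi), Real.exp (coordψ (g (x, 0)) t + s * bump t) := fun x s =>
    intervalIntegral.integral_congr fun t ht => by
      rw [uIcc_of_le two_pi_nonneg] at ht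
      simp only [hs x s ht]
  have hb : ContinuousOn bump (Icc 0 (2 * Real.pi)) := contDiff_bump.continuous.continuousOn
  have hsl : ∀ x, ContDiff ℝ ∞ fun s : ℝ =>
      ∫ t in (0 : ℝ)..(2 * Real.pi), Real.exp (coordψ (g (x, 0)) t + s * bump t) := fun x => by
    simp only [← hi]
    exact hJ.comp (contDiff_const.prodMk contDiff_id)
  -- On each line parallel to `bump` the amplitude is replaced by the logarithm of the total angle;
  -- the endpoint values `a`, `b` are constant on these lines because `bump` is flat.
  obtain ⟨Φ₃, c₃, c₃', e₃⟩ := exists_fibre_equiv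
    (f := fun x => Real.log (∫ t in (0 : ℝ)..(2 * Real.pi), Real.exp (coordψ (g x) t)))
    (hJ.log fun x => (hJp x).ne')
    (fun x s => by
      have h1 := ((hsl x).differentiable (by simp) s).hasDerivAt
      have h2 := deriv_integral_exp (hψ.continuousOn (x, 0)) hb h1
      have h3 := integral_mul_exp_pos (hψ.continuousOn (x, 0)) hb (fun t => bump_pos) s
      have h4 := integral_exp_pos (ψ := fun t => coordψ (g (x, 0)) t + s * bump t)
        ((hψ.continuousOn (x, 0)).add (continuousOn_const.mul hb))
      refine ⟨_, ?_, by simpa only [hi] using h1.log h4.ne'⟩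
      rw [h2]
      exact (div_pos h3 h4).ne')
    (fun x => by
      simp only [hi]
      exact bijective_log_integral_exp (hψ.continuousOn (x, 0)) hb (fun t => bump_pos)
        (hsl x).continuous)
  let Φ₄ : (Par n × FlatRest (n + 3)) × ℝ ≃ (ℝ × ℝ × ℝ) × Rest n :=
    { toFun := fun x => ((x.1.1.1, x.1.1.2.1, x.2), WithLp.toLp 2 (x.1.1.2.2, x.1.2))
      invFun := fun y => (((y.1.1, y.1.2.1, (WithLp.ofLp y.2).1), (WithLp.ofLp y.2).2), y.1.2.2)
      left_inv := fun x => rfl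
      right_inv := fun y => rfl }
  have c₄ : ContDiff ℝ ∞ Φ₄ := by
    have := (WithLp.prodContinuousLinearEquiv 2 ℝ (FlatPerp (n + 1)) (FlatRest (n + 3))).symm.contDiff
      (n := ∞)
    refine ContDiff.prodMk (by fun_prop) (this.comp ?_)
    fun_prop
  have c₄' : ContDiff ℝ ∞ Φ₄.symm := by
    have := (WithLp.prodContinuousLinearEquiv 2 ℝ (FlatPerp (n + 1)) (FlatRest (n + 3))).contDiff
      (n := ∞)
    have h := this.comp (contDiff_snd (𝕜 := ℝ) (E := ℝ × ℝ × ℝ) (F := Rest n))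
    exact ((contDiff_fst.fst.prodMk (contDiff_fst.snd.fst.prodMk h.fst)).prodMk h.snd).prodMk
      contDiff_fst.snd.snd
  let Φ₅ : Par n × FlatSpace (n + 3) ≃ (Par n × FlatRest (n + 3)) × ℝ :=
    { toFun := fun x => ((x.1, (Φ₂ x.2).1), (Φ₂ x.2).2)
      invFun := g
      left_inv := fun x => Prod.ext rfl (Φ₂.symm_apply_apply x.2)
      right_inv := fun y => by simp [g] }
  have c₅ : ContDiff ℝ ∞ Φ₅ := by
    have := c₂.comp (contDiff_snd (𝕜 := ℝ) (E := Par n) (F := FlatSpace (n + 3)))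
    exact (contDiff_fst.prodMk this.fst).prodMk this.snd
  refine ⟨((Φ₁.trans Φ₅).trans Φ₃).trans Φ₄, c₄.comp (c₃.comp (c₅.comp c₁)),
    c₁'.comp (hg.comp (c₃'.comp c₄')), fun q => ?_⟩
  have hgq : g (Φ₅ (Φ₁ q)) = Φ₁ q := Φ₅.symm_apply_apply (Φ₁ q)
  have h := e₃ (Φ₅ (Φ₁ q))
  rw [hgq] at h
  change ((Φ₃ (Φ₅ (Φ₁ q))).1.1.1, (Φ₃ (Φ₅ (Φ₁ q))).1.1.2.1, (Φ₃ (Φ₅ (Φ₁ q))).2) = _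
  rw [h]
  have hp : (Φ₅ (Φ₁ q)).1.1 = parOf q := (e₁ q).2
  simp only
  rw [hp]
  refine Prod.ext rfl (Prod.ext rfl ?_)
  refine congrArg Real.log (intervalIntegral.integral_congr fun t ht => ?_)
  rw [uIcc_of_le two_pi_nonneg] at ht
  simp only [(e₁ q).1 ht]

end Hper
end

noncomputable section

/-! ### The critical set -/

theorem HasPeriodicDeriv.memHper_zero {f g : ℝ → ℝ} (h : HasPeriodicDeriv f g) : MemHper 0 f := by
  obtain ⟨w, hw, hf⟩ := h.bounded
  exact (memLp_congr_ae hf).2 (hw.mono_exponent le_top)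

theorem IsPrimitive.hasPeriodicDeriv {f g : ℝ → ℝ} (h : IsPrimitive f g)
    (hf : f 0 = f (2 * Real.pi)) : HasPeriodicDeriv f g :=
  hasPeriodicDeriv_iff.2 ⟨f, h, hf, ae_eq_rfl⟩

/-- Bootstrap: `w'' = q w + g` gains two orders over its right-hand side as long as those of `q` and
`g` permit. -/
theorem memHper_of_linear_ode {m : ℕ} {q w d g : ℝ → ℝ} (hq : MemHper (m + 2) q) (hg : MemHper m g)
    (hw : HasPeriodicDeriv w d) (hd : HasPeriodicDeriv d fun t => q t * w t + g t) :
    MemHper (m + 2) w := by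
  have key : ∀ j ≤ m, MemHper (j + 2) w := by
    intro j
    induction j with
    | zero =>
      intro _
      have h1 : MemHper 1 w := ⟨d, hw, hd.memHper_zero⟩
      exact ⟨d, hw, _, hd, (MemHper.mul (n := 0) (hq.mono (by omega)) h1).add (hg.mono (by omega))⟩
    | succ j ih =>
      intro hj
      have h1 := ih (by omega)
      exact ⟨d, hw, _, hd, (MemHper.mul (hq.mono (by omega)) (h1.mono (by omega))).add
        (hg.mono hj)⟩
  exact key m le_rfl

namespace Hper

attribute [local instance] normedGroup innerProduct normedSpace

variable {m : ℕ}

/-- The operator `u ↦ -u'' + u² / 2` from `H^{m+2}` to `H^m`. -/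
def sturm (m : ℕ) : Hper (m + 2) → Hper m := sturmLiouville (m + 2) (Nat.le_add_left 2 m)

theorem sturm_spec (u : Hper (m + 2)) : (sturm m u).der 0 =ᵐ[circleMeasure]
    fun t => -(val (shift (shift u)) t) + val u t ^ 2 / 2 := by
  filter_upwards [sturmLiouville_spec (m + 2) (Nat.le_add_left 2 m) u, val_ae u,
    val_ae (shift (shift u))] with t h1 h2 h3
  rw [h2, h3]
  exact h1

theorem contDiff_sturm : ContDiff ℝ ∞ (sturm m) := by
  have h0 : SobFamily ∅ (m + 2) (val : Hper (m + 2) → ℝ → ℝ) := sobFamily_val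
  have h2 : SobFamily ∅ m fun u : Hper (m + 2) => val (shift (shift u)) :=
    sobFamily_val.comp (shift.contDiff.comp shift.contDiff)
  refine contDiff_of_sobFamily (f := fun u t => -1 * val (shift (shift u)) t +
    1 / 2 * (val u t * val u t)) ?_ fun u => ?_
  · exact (h2.const_mul (-1)).add (((h0.mul_free h0 le_rfl (by omega)).of_le (by omega)).const_mul
      (1 / 2))
  · filter_upwards [sturm_spec u] with t ht
    rw [ht]
    ring

theorem exists_bilinear (q w : Hper (m + 2)) : ∃ l : Hper m, val l =ᵐ[circleMeasure]
    fun t => -(val (shift (shift w)) t) + val q t * val w t := by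
  have h : MemHper m fun t => val q t * val w t :=
    (memHper_val q).mono (by omega) |>.mul ((memHper_val w).mono (by omega))
  obtain ⟨l, hl⟩ := (((memHper_val (shift (shift w))).const_mul (-1)).add h).exists_jet
  refine ⟨l, ?_⟩
  filter_upwards [val_ae l, hl] with t h1 h2
  rw [h1, h2]
  ring

theorem exists_square (w : Hper (m + 2)) : ∃ l : Hper m, val l =ᵐ[circleMeasure]
    fun t => val w t ^ 2 / 2 := by
  have h : MemHper m fun t => val w t * val w t :=
    (memHper_val w).mono (by omega) |>.mul ((memHper_val w).mono (by omega))
  obtain ⟨l, hl⟩ := (h.const_mul (1 / 2)).exists_jet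
  refine ⟨l, ?_⟩
  filter_upwards [val_ae l, hl] with t h1 h2
  rw [h1, h2]
  ring

theorem val_smul_ae {n : ℕ} (c : ℝ) (u : Hper n) :
    val (c • u) =ᵐ[circleMeasure] fun t => c * val u t := by
  filter_upwards [val_ae (c • u), val_ae u, Lp.coeFn_smul c (u.der 0)] with t h1 h2 h3
  rw [h1, h2]
  exact h3

/-- The operator is a quadratic polynomial, so along a line it is `F(q) + s l + s² k` with explicit
`l`, `k`, and the directional derivative at `s = 0` is `l`. -/
theorem fderiv_sturm (q w : Hper (m + 2)) : val (fderiv ℝ (sturm m) q w) =ᵐ[circleMeasure]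
    fun t => -(val (shift (shift w)) t) + val q t * val w t := by
  obtain ⟨l, hl⟩ := exists_bilinear q w
  obtain ⟨k, hk⟩ := exists_square w
  have hs : (fun s : ℝ => sturm m (q + s • w)) = fun s => sturm m q + (s • l + s ^ 2 • k) := by
    ext1 s
    refine ext_ae ((val_ae _).symm.trans (Filter.EventuallyEq.trans ?_ (val_ae _)))
    have e1 := (val_ae (sturm m (q + s • w))).trans (sturm_spec (q + s • w))
    have e2 := (val_ae (sturm m q)).trans (sturm_spec q)
    have e3 : shift (shift (q + s • w)) = shift (shift q) + s • shift (shift w) := by simp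
    rw [e3] at e1
    filter_upwards [e1, e2, hl, hk, val_add_ae (sturm m q) (s • l + s ^ 2 • k),
      val_add_ae (s • l) (s ^ 2 • k), val_smul_ae s l, val_smul_ae (s ^ 2) k, val_add_ae q (s • w),
      val_smul_ae s w, val_add_ae (shift (shift q)) (s • shift (shift w)),
      val_smul_ae s (shift (shift w))] with t a1 a2 a3 a4 a5 a6 a7 a8 a9 a10 a11 a12
    rw [a1, a5, a6, a7, a8, a2, a3, a4, a9, a10, a11, a12]
    ring
  have h1 : HasDerivAt (fun s : ℝ => sturm m (q + s • w)) l 0 := by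
    rw [hs]
    have := ((hasDerivAt_id (0 : ℝ)).smul_const l).add
      (((hasDerivAt_id (0 : ℝ)).pow 2).smul_const k)
    simpa using this.const_add (sturm m q)
  have h2 : HasDerivAt (fun s : ℝ => q + s • w) w 0 := by
    simpa using ((hasDerivAt_id (0 : ℝ)).smul_const w).const_add q
  have h3 : HasFDerivAt (sturm m) (fderiv ℝ (sturm m) q) (q + (0 : ℝ) • w) := by
    rw [zero_smul, add_zero]
    exact (contDiff_sturm.differentiable (by simp) q).hasFDerivAt
  have h4 := (h3.comp_hasDerivAt 0 h2).unique h1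
  rw [h4]
  exact hl

/-- The trace of the monodromy matrix in the coordinates `(a, b, c)`. -/
def monodromyTrace (a b c : ℝ) : ℝ :=
  2 * Real.cosh (a / 2) * Real.cos c - b / 2 * Real.exp (-a / 2) * Real.sin c

/-- With `ψ(0) = ψ'(0) = 0` the polar form yields the normalized fundamental solutions. Their values
at `2π` involve only `a`, `b` and the total angle. -/
theorem exists_monodromy (q : Hper (m + 2)) : ∃ v₁ d₁ v₂ d₂ : ℝ → ℝ, IsPrimitive v₁ d₁ ∧
    IsPrimitive d₁ (fun t => val q t * v₁ t) ∧ IsPrimitive v₂ d₂ ∧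
    IsPrimitive d₂ (fun t => val q t * v₂ t) ∧ v₁ 0 = 1 ∧ d₁ 0 = 0 ∧ v₂ 0 = 0 ∧ d₂ 0 = 1 ∧
    (v₁ (2 * Real.pi) * d₂ (2 * Real.pi) - d₁ (2 * Real.pi) * v₂ (2 * Real.pi) = 1) ∧
    v₁ (2 * Real.pi) + d₂ (2 * Real.pi) = monodromyTrace (startψ q (2 * Real.pi))
      (startη q (2 * Real.pi)) (totalAngle q) := by
  obtain ⟨θ, v₁, d₁, v₂, d₂, hθ, h1, h2, h3, h4, e1, e2, e3, e4⟩ :=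
    linear_of_keplerEq (startψ_spec.2.2.1 q)
  have t0 : θ 0 = 0 := by rw [hθ, intervalIntegral.integral_same]
  have t1 : θ (2 * Real.pi) = totalAngle q := hθ _
  have p0 := startψ_spec.2.2.2.1 q
  have n0 := startψ_spec.2.2.2.2 q
  have i1 : v₁ 0 = 1 := by rw [e1, t0, p0]; simp
  have i2 : d₁ 0 = 0 := by rw [e3, t0, p0, n0]; simp
  have i3 : v₂ 0 = 0 := by rw [e2, t0]; simp
  have i4 : d₂ 0 = 1 := by rw [e4, t0, p0, n0]; simp
  refine ⟨v₁, d₁, v₂, d₂, h1, h2, h3, h4, i1, i2, i3, i4, ?_, ?_⟩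
  · rw [wronskian_eq h1 h2 h3 h4 left_mem_circle right_mem_circle, i1, i2, i3, i4]
    norm_num
  · rw [e1, e4, t1, monodromyTrace, Real.cosh_eq, neg_div]
    ring

/-- Add to a particular solution of `w'' = q w - g` the homogeneous one that makes its data
periodic. This is a linear system with matrix `1 - M`, where `M` is the monodromy. -/
theorem exists_solution {q : Hper (m + 2)} (hq : monodromyTrace (startψ q (2 * Real.pi))
    (startη q (2 * Real.pi)) (totalAngle q) ≠ 2) (g : Hper m) :
    ∃ w, fderiv ℝ (sturm m) q w = g := by
  obtain ⟨v₁, d₁, v₂, d₂, h1, h2, h3, h4, i1, i2, i3, i4, hW, hT⟩ := exists_monodromy q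
  rw [← hT] at hq
  have hg : MemHper m fun t => -1 * val g t := (memHper_val g).const_mul (-1)
  -- The solver works with families, so a single equation is treated as a constant family over `ℝ`
  -- and evaluated at `0`.
  obtain ⟨w, d, -, -, hw, hd, w0, d0⟩ := exists_linear_solution (E := ℝ)
    (q := fun _ => val q) (g := fun _ t => -1 * val g t) (α := fun _ => 0) (β := fun _ => 0)
    (cFamily_val.comp contDiff_const)
    ((sobFamily_val.comp contDiff_const).l2Family.congr (f := fun _ => val ((-1 : ℝ) • g))
      fun _ => val_smul_ae _ _)
    contDiff_const contDiff_const
  replace hw := hw 0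
  replace hd := hd 0
  replace w0 := w0 0
  replace d0 := d0 0
  set A := v₁ (2 * Real.pi)
  set B := v₂ (2 * Real.pi)
  set C := d₁ (2 * Real.pi)
  set D := d₂ (2 * Real.pi)
  set r := w 0 (2 * Real.pi) with hr
  set s := d 0 (2 * Real.pi) with hs
  -- Since `det M = 1`, this is `det (1 - M)`, the denominator in Cramer's rule.
  have hδ : 2 - (A + D) ≠ 0 := fun h => hq (by linarith)
  -- the initial data of the periodic solution
  set α := ((1 - D) * r + B * s) / (2 - (A + D)) with hα
  set β := (C * r + (1 - A) * s) / (2 - (A + D)) with hβ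
  have e1 : α * A + β * B + r = α := by
    rw [hα, hβ]
    field_simp
    linear_combination (-r) * hW
  have e2 : α * C + β * D + s = β := by
    rw [hα, hβ]
    field_simp
    linear_combination (-s) * hW
  have pw : IsPrimitive (fun t => α * v₁ t + β * v₂ t + w 0 t)
      (fun t => α * d₁ t + β * d₂ t + d 0 t) :=
    ((h1.const_mul α).add (h3.const_mul β)).add hw
  have pd : IsPrimitive (fun t => α * d₁ t + β * d₂ t + d 0 t)
      (fun t => val q t * (α * v₁ t + β * v₂ t + w 0 t) + -1 * val g t) :=
    (((h2.const_mul α).add (h4.const_mul β)).add hd).congr (fun _ _ => rfl)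
      (Filter.Eventually.of_forall fun t => by ring)
  have hp1 := pw.hasPeriodicDeriv (by simp only [i1, i3, w0]; linarith)
  have hp2 := pd.hasPeriodicDeriv (by simp only [i2, i4, d0]; linarith)
  obtain ⟨z, hz⟩ := (memHper_of_linear_ode (memHper_val q) hg hp1 hp2).exists_jet
  have z0 := eqOn_circle_of_ae (isPrimitive_val z).continuousOn pw.continuousOn ((val_ae z).trans hz)
  have z1 := eqOn_circle_of_ae (isPrimitive_val (shift z)).continuousOn pd.continuousOn
    (((isPrimitive_val z).congr z0 ae_eq_rfl).unique pw)
  have z2 := ((isPrimitive_val (shift z)).congr z1 ae_eq_rfl).unique pd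
  refine ⟨z, ext_ae ((val_ae _).symm.trans (Filter.EventuallyEq.trans ?_ (val_ae g)))⟩
  filter_upwards [fderiv_sturm q z, z2, ae_circle_of_forall z0] with t a1 a2 a3
  rw [a1, a2, a3]
  ring

/-- Determinant one and trace two force the eigenvalue 1, and an eigenvector provides the initial
data. -/
theorem exists_periodic_of_trace {q : Hper (m + 2)} (hq : monodromyTrace (startψ q (2 * Real.pi))
    (startη q (2 * Real.pi)) (totalAngle q) = 2) : ∃ w d : ℝ → ℝ, IsPrimitive w d ∧
      IsPrimitive d (fun t => val q t * w t) ∧ w 0 = w (2 * Real.pi) ∧ d 0 = d (2 * Real.pi) ∧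
      (w 0 ≠ 0 ∨ d 0 ≠ 0) := by
  obtain ⟨v₁, d₁, v₂, d₂, h1, h2, h3, h4, i1, i2, i3, i4, hW, hT⟩ := exists_monodromy q
  rw [← hT] at hq
  have key : ∀ α β : ℝ, α * v₁ (2 * Real.pi) + β * v₂ (2 * Real.pi) = α →
      α * d₁ (2 * Real.pi) + β * d₂ (2 * Real.pi) = β → (α ≠ 0 ∨ β ≠ 0) → ∃ w d : ℝ → ℝ,
      IsPrimitive w d ∧ IsPrimitive d (fun t => val q t * w t) ∧ w 0 = w (2 * Real.pi) ∧
      d 0 = d (2 * Real.pi) ∧ (w 0 ≠ 0 ∨ d 0 ≠ 0) := fun α β e1 e2 h0 =>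
    ⟨fun t => α * v₁ t + β * v₂ t, fun t => α * d₁ t + β * d₂ t,
      (h1.const_mul α).add (h3.const_mul β),
      ((h2.const_mul α).add (h4.const_mul β)).congr (fun _ _ => rfl)
        (Filter.Eventually.of_forall fun t => by ring),
      by simp only [i1, i3]; linarith, by simp only [i2, i4]; linarith,
      by simpa [i1, i2, i3, i4] using h0⟩
  -- If the upper right entry `B` is nonzero, `(B, 1 - A)` is fixed. If `B = 0`, both diagonal
  -- entries are 1 and `(0, 1)` is fixed.
  by_cases hB : v₂ (2 * Real.pi) = 0
  · by_cases hD : d₂ (2 * Real.pi) = 1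
    · exact key 0 1 (by rw [hB]; ring) (by rw [hD]; ring) (Or.inr one_ne_zero)
    · refine absurd ?_ hD
      rw [hB] at hW
      have : (d₂ (2 * Real.pi) - 1) ^ 2 = 0 := by
        have e : v₁ (2 * Real.pi) = 2 - d₂ (2 * Real.pi) := by linarith
        rw [e] at hW
        linarith
      linarith [pow_eq_zero_iff (two_ne_zero) |>.1 this]
  · refine key (v₂ (2 * Real.pi)) (1 - v₁ (2 * Real.pi)) (by ring) ?_ (Or.inl hB)
    have e : d₂ (2 * Real.pi) = 2 - v₁ (2 * Real.pi) := by linarith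
    rw [e] at hW ⊢
    linarith

/-- The operator is symmetric, so its range is orthogonal to a periodic solution `w`. If `w` were
itself in the range, then `∫ w² = 0`. -/
theorem not_surjective_of_trace {q : Hper (m + 2)} (hq : monodromyTrace (startψ q (2 * Real.pi))
    (startη q (2 * Real.pi)) (totalAngle q) = 2) :
    ¬ Function.Surjective (fderiv ℝ (sturm m) q) := fun hs => by
  obtain ⟨w, d, hw, hd, w1, d1, h0⟩ := exists_periodic_of_trace hq
  have hz : MemHper 0 fun _ : ℝ => (0 : ℝ) := (MemLp.zero : MemLp (0 : ℝ → ℝ) 2 circleMeasure)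
  have hz' : ∀ n, MemHper n fun _ : ℝ => (0 : ℝ) := fun n => by
    induction n with
    | zero => exact hz
    | succ n ih => exact ⟨_, (IsPrimitive.const 0).hasPeriodicDeriv rfl, ih⟩
  have hm : MemHper (m + 2) w := memHper_of_linear_ode (memHper_val q) (hz' m)
    (hw.hasPeriodicDeriv w1) ((hd.hasPeriodicDeriv d1).congr ae_eq_rfl (by simp))
  obtain ⟨g, hg⟩ := (hm.mono (n := m) (by omega)).exists_jet
  obtain ⟨z, hz⟩ := hs g
  have hF := fderiv_sturm q z
  rw [hz] at hF
  -- Green's formula: `z' w - z w'` has equal values at both ends, and its derivative is `-(-z'' + q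
  -- z) w`.
  have p := ((isPrimitive_val (shift z)).mul hw).sub ((isPrimitive_val z).mul hd)
  have hi := p.sub_eq_integral left_mem_circle right_mem_circle
  simp only [val_two_pi, ← w1, ← d1, sub_self] at hi
  have hsq : ∫ t in (0 : ℝ)..(2 * Real.pi), w t * w t = 0 := by
    rw [← neg_eq_zero, ← intervalIntegral.integral_neg]
    refine Eq.trans ?_ hi.symm
    refine intervalIntegral_congr_circle ?_ left_mem_circle right_mem_circle
    filter_upwards [hF, val_ae g, hg] with t a1 a2 a3
    rw [a2, a3] at a1
    linear_combination (-w t) * a1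
  have hw0 : EqOn (fun t => w t * w t) 0 (Icc 0 (2 * Real.pi)) := by
    refine eqOn_circle_of_ae (hw.continuousOn.mul hw.continuousOn) continuousOn_const ?_
    have hint : IntervalIntegrable (fun t => w t * w t) volume 0 (2 * Real.pi) :=
      (hw.continuousOn.mul hw.continuousOn).intervalIntegrable_circle
    have := (intervalIntegral.integral_eq_zero_iff_of_le_of_nonneg_ae two_pi_nonneg
      (Filter.Eventually.of_forall fun t => mul_self_nonneg (w t)) hint).1 hsq
    rwa [restrict_Ioc_eq_restrict_Icc] at this
  have hw0' : EqOn w (fun _ => 0) (Icc 0 (2 * Real.pi)) := fun t ht => by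
    simpa using hw0 ht
  have hd0 := eqOn_circle_of_ae hd.continuousOn continuousOn_const
    ((hw.congr hw0' ae_eq_rfl).unique (IsPrimitive.const 0))
  rcases h0 with h | h
  · exact h (hw0' left_mem_circle)
  · exact h (hd0 left_mem_circle)

theorem mem_criticalSet_iff (hp : 2 ≤ m + 2) (q : Hper (m + 2)) :
    q ∈ criticalSet (sturmLiouville (m + 2) hp) ↔ monodromyTrace (startψ q (2 * Real.pi))
      (startη q (2 * Real.pi)) (totalAngle q) = 2 := by
  change q ∈ criticalSet (sturm m) ↔ _
  have hd : HasFDerivAt (sturm m) (fderiv ℝ (sturm m) q) q :=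
    (contDiff_sturm.differentiable (by simp) q).hasFDerivAt
  constructor
  · rintro ⟨F', hF', hs⟩
    by_contra hq
    rw [hF'.unique hd] at hs
    exact hs fun g => exists_solution hq g
  · exact fun h => ⟨_, hd, not_surjective_of_trace h⟩

end Hper
end

noncomputable section

/-! ### Straightening the trace surface in `ℝ³` -/

theorem Real.smoothTransition_add_one_sub (x : ℝ) :
    smoothTransition x + smoothTransition (1 - x) = 1 := by
  have h := smoothTransition.pos_denom x
  rw [smoothTransition, smoothTransition, sub_sub_cancel, add_comm (expNegInvGlue (1 - x)),
    ← add_div, div_self h.ne']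

theorem Real.smoothTransition_hasDerivAt (x : ℝ) :
    ∃ d, 0 ≤ d ∧ HasDerivAt smoothTransition d x :=
  ⟨_, smoothTransition.monotone.deriv_nonneg,
    ((smoothTransition.contDiff (n := 1)).differentiable (by simp) x).hasDerivAt⟩

/-- The derivative of `ramp`. -/
def rampSlope (t : ℝ) : ℝ := Real.smoothTransition (4 * t + 1 / 2)

/-- A smooth approximation of `max r 0`, equal to it for `|r| ≥ 1/8`. -/
def ramp (r : ℝ) : ℝ := 1 + ∫ t in (1 : ℝ)..r, rampSlope t

theorem contDiff_rampSlope : ContDiff ℝ ∞ rampSlope :=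
  Real.smoothTransition.contDiff.comp ((contDiff_const.mul contDiff_id).add contDiff_const)

theorem hasDerivAt_ramp (r : ℝ) : HasDerivAt ramp (rampSlope r) r :=
  (intervalIntegral.integral_hasDerivAt_right
    (contDiff_rampSlope.continuous.intervalIntegrable _ _)
    contDiff_rampSlope.continuous.aestronglyMeasurable.stronglyMeasurableAtFilter
    contDiff_rampSlope.continuous.continuousAt).const_add 1

theorem contDiff_ramp : ContDiff ℝ ∞ ramp := by
  have h : deriv ramp = rampSlope := funext fun r => (hasDerivAt_ramp r).deriv
  exact contDiff_infty_iff_deriv.2 ⟨fun r => (hasDerivAt_ramp r).differentiableAt, by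
    rw [h]; exact contDiff_rampSlope⟩

theorem ramp_of_ge {r : ℝ} (hr : 1 / 8 ≤ r) : ramp r = r := by
  have : ∫ t in (1 : ℝ)..r, rampSlope t = ∫ t in (1 : ℝ)..r, 1 :=
    intervalIntegral.integral_congr fun t ht => by
      have : 1 / 8 ≤ t := le_trans (le_inf (by norm_num) hr) ht.1
      exact Real.smoothTransition.one_of_one_le (by linarith)
  rw [ramp, this]
  simp

/-- The slope satisfies `s(t) + s(-t) = 1`, so its integral over `[-1/8, 1/8]` is exactly `1/8`, and
`ramp` descends from `1/8` to `0` there. -/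
theorem ramp_of_le {r : ℝ} (hr : r ≤ -(1 / 8)) : ramp r = 0 := by
  have i : ∀ a b, IntervalIntegrable rampSlope volume a b := fun a b =>
    contDiff_rampSlope.continuous.intervalIntegrable a b
  have h1 : ramp (1 / 8) = 1 / 8 := ramp_of_ge le_rfl
  have h2 : ∫ t in (-(1 / 8) : ℝ)..(1 / 8), rampSlope t = 1 / 8 := by
    have e : ∫ t in (-(1 / 8) : ℝ)..(1 / 8), rampSlope (-t) =
        ∫ t in (-(1 / 8) : ℝ)..(1 / 8), rampSlope t := by
      rw [intervalIntegral.integral_comp_neg, neg_neg]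
    have e2 : ∫ t in (-(1 / 8) : ℝ)..(1 / 8), (rampSlope t + rampSlope (-t)) = 1 / 4 := by
      have : ∀ t, rampSlope t + rampSlope (-t) = 1 := fun t => by
        have h := Real.smoothTransition_add_one_sub (4 * t + 1 / 2)
        rwa [show 1 - (4 * t + 1 / 2) = 4 * -t + 1 / 2 by ring] at h
      simp only [this]
      norm_num
    rw [intervalIntegral.integral_add (g := fun t => rampSlope (-t)) (i _ _)
      ((contDiff_rampSlope.continuous.comp continuous_neg).intervalIntegrable _ _), e] at e2
    linarith
  have h3 : ∫ t in r..(-(1 / 8) : ℝ), rampSlope t = 0 := by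
    have : ∫ t in r..(-(1 / 8) : ℝ), rampSlope t = ∫ t in r..(-(1 / 8) : ℝ), 0 :=
      intervalIntegral.integral_congr fun t ht => by
        have : t ≤ -(1 / 8) := le_trans ht.2 (sup_le hr le_rfl)
        exact Real.smoothTransition.zero_of_nonpos (by linarith)
    rw [this]
    simp
  have h4 := intervalIntegral.integral_add_adjacent_intervals (i 1 (-(1 / 8))) (i _ (1 / 8))
  have h5 := intervalIntegral.integral_add_adjacent_intervals (i 1 r) (i r (-(1 / 8)))
  rw [ramp] at h1 ⊢
  linarith

theorem monotone_ramp : Monotone ramp :=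
  monotone_of_hasDerivAt_nonneg hasDerivAt_ramp fun _ => Real.smoothTransition.nonneg _

theorem ramp_nonneg (r : ℝ) : 0 ≤ ramp r := by
  rcases le_total r (-(1 / 8)) with h | h
  · exact (ramp_of_le h).ge
  · rw [← ramp_of_le (le_refl (-(1 / 8)))]
    exact monotone_ramp h

theorem le_ramp (r : ℝ) : r ≤ ramp r := by
  rcases le_total (1 / 8) r with h | h
  · exact (ramp_of_ge h).ge
  · have hm : Monotone fun r => r - ramp r :=
      monotone_of_hasDerivAt_nonneg (fun r => (hasDerivAt_id r).sub (hasDerivAt_ramp r)) fun r =>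
        sub_nonneg.2 (Real.smoothTransition.le_one _)
    have := hm h
    simp only [ramp_of_ge le_rfl] at this
    linarith

/-- The expression `w - ramp (w - u)` is a smooth minimum of `w` and `u`. As `w` exceeds the
smoothing width, the minimum can vanish only where it equals `u` exactly. -/
theorem ramp_eq_iff {w u : ℝ} (hw : 1 / 8 < w) : w - ramp (w - u) = 0 ↔ u = 0 := by
  constructor
  · intro h
    have h1 : ramp (w - u) = w := by linarith
    have h2 : 1 / 8 ≤ w - u := by
      by_contra! hlt
      have := monotone_ramp hlt.le
      rw [ramp_of_ge le_rfl, h1] at this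
      linarith
    rw [ramp_of_ge h2] at h1
    linarith
  · rintro rfl
    rw [sub_zero, ramp_of_ge hw.le, sub_self]

/-- A decreasing function on `(0, ∞)` which blows up at `0` and vanishes for `c ≥ 2`. -/
def shear (c : ℝ) : ℝ := (1 - Real.smoothTransition (c - 1)) / c

theorem shear_of_ge {c : ℝ} (hc : 2 ≤ c) : shear c = 0 := by
  rw [shear, Real.smoothTransition.one_of_one_le (by linarith), sub_self, zero_div]

theorem shear_of_le {c : ℝ} (hc : c ≤ 1) : shear c = c⁻¹ := by
  rw [shear, Real.smoothTransition.zero_of_nonpos (by linarith), sub_zero, one_div]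

theorem contDiffAt_shear {c : ℝ} (hc : 0 < c) : ContDiffAt ℝ ∞ shear c := by
  refine ContDiffAt.div ?_ contDiffAt_id hc.ne'
  exact contDiffAt_const.sub (Real.smoothTransition.contDiffAt.comp c
    (contDiffAt_id.sub contDiffAt_const))

theorem hasDerivAt_shear {c : ℝ} (hc : 0 < c) : ∃ d ≤ 0, HasDerivAt shear d c := by
  obtain ⟨d, hd, h⟩ := Real.smoothTransition_hasDerivAt (c - 1)
  have h1 : HasDerivAt (fun c : ℝ => Real.smoothTransition (c - 1)) d c :=
    h.comp_sub_const c 1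
  refine ⟨_, ?_, ((h1.const_sub 1).div (hasDerivAt_id c) hc.ne')⟩
  have h2 := Real.smoothTransition.le_one (c - 1)
  have h3 : 0 ≤ d * c := by positivity
  refine div_nonpos_of_nonpos_of_nonneg ?_ (by positivity)
  linarith

/-- The function whose zero set in `0 < c < π` is the first component of the trace surface. -/
def lowerHeight (R y c : ℝ) : ℝ := 2 * (1 - R * Real.cos c) / Real.sin c - 2 * y - 2 * shear c

/-- The angle of the cone coordinates, modified near `c = 0`. -/
def upperHeight (R y c : ℝ) : ℝ :=
  (1 - Real.smoothTransition (c - 2)) * ((1 + c) / 8) +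
    Real.smoothTransition (c - 2) * (c - Real.arctan (y / R))

/-- The third coordinate straightening the trace surface. -/
def height (R y c : ℝ) : ℝ :=
  if c < Real.pi then upperHeight R y c - ramp (upperHeight R y c - lowerHeight R y c)
  else upperHeight R y c

theorem upperHeight_of_ge {R y c : ℝ} (hc : 3 ≤ c) :
    upperHeight R y c = c - Real.arctan (y / R) := by
  rw [upperHeight, Real.smoothTransition.one_of_one_le (by linarith)]
  ring

/-- The lower bound is what `ramp_eq_iff` needs; `c - arctan (y/R)` itself may be negative for small
`c`, hence the modification. The upper bound keeps this region below all the cones. -/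
theorem upperHeight_bounds {R y c : ℝ} (hc : 0 < c) (hc' : c < Real.pi) :
    1 / 8 < upperHeight R y c ∧ upperHeight R y c < 3 * Real.pi / 2 := by
  have h0 := Real.smoothTransition.nonneg (c - 2)
  have h1 := Real.smoothTransition.le_one (c - 2)
  have p1 := Real.pi_gt_three
  have p2 := Real.pi_lt_d2
  have a1 := Real.arctan_lt_pi_div_two (y / R)
  have a2 := Real.neg_pi_div_two_lt_arctan (y / R)
  rcases le_or_gt c 2 with h | h
  · rw [upperHeight, Real.smoothTransition.zero_of_nonpos (by linarith)]
    constructor <;> nlinarith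
  · set s := Real.smoothTransition (c - 2) with hs
    have b1 : 1 / 8 < (1 + c) / 8 := by linarith
    have b2 : (1 + c) / 8 < 3 * Real.pi / 2 := by linarith
    have b3 : 1 / 8 < c - Real.arctan (y / R) := by linarith
    have b4 : c - Real.arctan (y / R) < 3 * Real.pi / 2 := by linarith
    rw [upperHeight, ← hs]
    constructor <;> nlinarith

/-- Both interpolated functions increase, and where the transition moves, at `c ≥ 2`, the one being
switched on is the larger: `2 - π/2 > 3/8`. -/
theorem hasDerivAt_upperHeight (R y c : ℝ) : ∃ d > 0, HasDerivAt (upperHeight R y) d c := by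
  obtain ⟨d, hd, h⟩ := Real.smoothTransition_hasDerivAt (c - 2)
  have h1 : HasDerivAt (fun c : ℝ => Real.smoothTransition (c - 2)) d c :=
    h.comp_sub_const c 2
  have h0 := Real.smoothTransition.nonneg (c - 2)
  have h1' := Real.smoothTransition.le_one (c - 2)
  refine ⟨_, ?_, ((h1.const_sub 1).mul (((hasDerivAt_id c).const_add 1).div_const 8)).add
    (h1.mul ((hasDerivAt_id c).sub_const (Real.arctan (y / R))))⟩
  simp only [id]
  have hdc : 0 ≤ d * (c - Real.arctan (y / R) - (1 + c) / 8) := by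
    rcases le_or_gt 2 c with hc | hc
    · have a1 := Real.arctan_lt_pi_div_two (y / R)
      have p2 := Real.pi_lt_d2
      exact mul_nonneg hd (by linarith)
    · have : d = 0 := by
        refine h1.unique ((hasDerivAt_const c (0 : ℝ)).congr_of_eventuallyEq ?_)
        filter_upwards [eventually_lt_nhds hc] with t ht
        exact Real.smoothTransition.zero_of_nonpos (by linarith)
      rw [this, zero_mul]
  linarith

/-- The fraction has derivative `2 (R - cos c) / sin² c`, positive since `R ≥ 1 > cos c`, and
`shear` does not increase. -/
theorem hasDerivAt_lowerHeight {R y c : ℝ} (hR : 1 ≤ R) (hc : 0 < c) (hc' : c < Real.pi) :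
    ∃ d > 0, HasDerivAt (lowerHeight R y) d c := by
  obtain ⟨k, hk, h⟩ := hasDerivAt_shear hc
  have hs : 0 < Real.sin c := Real.sin_pos_of_pos_of_lt_pi hc hc'
  have h1 := ((((Real.hasDerivAt_cos c).const_mul R).const_sub 1).const_mul 2).div
    (Real.hasDerivAt_sin c) hs.ne'
  refine ⟨_, ?_, (h1.sub_const (2 * y)).sub (h.const_mul 2)⟩
  have hcos : Real.cos c < 1 := by
    have := Real.sin_sq_add_cos_sq c
    nlinarith [sq_pos_of_pos hs, Real.cos_le_one c]
  have : 0 < (2 * -(R * -Real.sin c) * Real.sin c - 2 * (1 - R * Real.cos c) * Real.cos c) /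
      Real.sin c ^ 2 := by
    refine div_pos ?_ (by positivity)
    have := Real.sin_sq_add_cos_sq c
    have e : 2 * -(R * -Real.sin c) * Real.sin c - 2 * (1 - R * Real.cos c) * Real.cos c =
        2 * (R - Real.cos c) := by linear_combination 2 * R * this
    rw [e]
    linarith
  linarith

/-- As `c` increases to `π` the lower height blows up, so the smooth minimum is the upper height.
Smoothness across `c = π` follows. -/
theorem eventually_height_eq {R₀ y₀ c₀ : ℝ} (hR : 1 ≤ R₀) (hc : Real.pi ≤ c₀) :
    ∀ᶠ p : ℝ × ℝ × ℝ in 𝓝 (R₀, y₀, c₀), height p.1 p.2.1 p.2.2 = upperHeight p.1 p.2.1 p.2.2 := by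
  rcases hc.eq_or_lt with rfl | hc
  -- Multiplying by `sin c` removes the pole; the resulting expression is continuous, with value `2
  -- (1 + R) > 0` at `c = π`.
  · have hG : ContinuousAt (fun p : ℝ × ℝ × ℝ => 2 * (1 - p.1 * Real.cos p.2.2) -
        (2 * p.2.1 + 2 * shear p.2.2) * Real.sin p.2.2 -
        (upperHeight p.1 p.2.1 p.2.2 + 1 / 8) * Real.sin p.2.2) (R₀, y₀, Real.pi) := by
      have c1 : ContinuousAt (fun p : ℝ × ℝ × ℝ => shear p.2.2) (R₀, y₀, Real.pi) :=
        ContinuousAt.comp (f := fun p : ℝ × ℝ × ℝ => p.2.2) (g := shear)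
          (contDiffAt_shear Real.pi_pos).continuousAt (by fun_prop)
      have c2 : ContinuousAt (fun p : ℝ × ℝ × ℝ => upperHeight p.1 p.2.1 p.2.2)
          (R₀, y₀, Real.pi) := by
        have hst := Real.smoothTransition.continuous
        have hd : ContinuousAt (fun p : ℝ × ℝ × ℝ => p.2.1 / p.1) (R₀, y₀, Real.pi) :=
          ContinuousAt.div (by fun_prop) (by fun_prop) (by simp only; linarith)
        have ha := Real.continuous_arctan.continuousAt.comp hd
        unfold upperHeight
        have h3 : Continuous fun p : ℝ × ℝ × ℝ => Real.smoothTransition (p.2.2 - 2) :=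
          hst.comp (by fun_prop)
        exact ((continuousAt_const.sub h3.continuousAt).mul (by fun_prop)).add
          (h3.continuousAt.mul (ContinuousAt.sub (by fun_prop) ha))
      fun_prop
    have hpos := hG.eventually (lt_mem_nhds (a := 0) (by
      simp only [Real.cos_pi, Real.sin_pi]
      linarith))
    have hz : ∀ᶠ p : ℝ × ℝ × ℝ in 𝓝 (R₀, y₀, Real.pi), 0 < p.2.2 :=
      (continuous_snd.snd.tendsto _).eventually (lt_mem_nhds Real.pi_pos)
    filter_upwards [hpos, hz] with p h1 h2
    rw [height]
    split_ifs with hp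
    · have hs : 0 < Real.sin p.2.2 := Real.sin_pos_of_pos_of_lt_pi h2 hp
      have e : lowerHeight p.1 p.2.1 p.2.2 * Real.sin p.2.2 = 2 * (1 - p.1 * Real.cos p.2.2) -
        (2 * p.2.1 + 2 * shear p.2.2) * Real.sin p.2.2 := by
        rw [lowerHeight]
        field_simp
        ring
      rw [← e, ← sub_mul] at h1
      have := pos_of_mul_pos_left h1 hs.le
      rw [ramp_of_le (by linarith), sub_zero]
    · rfl
  · have hz : ∀ᶠ p : ℝ × ℝ × ℝ in 𝓝 (R₀, y₀, c₀), Real.pi < p.2.2 :=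
      (continuous_snd.snd.tendsto _).eventually (lt_mem_nhds hc)
    filter_upwards [hz] with p hp
    rw [height, if_neg (not_lt.2 hp.le)]

/-- For `c < π` the slope is a convex combination of the two positive slopes, since `ramp` has slope
between 0 and 1. -/
theorem hasDerivAt_height {R y c : ℝ} (hR : 1 ≤ R) (hc : 0 < c) :
    ∃ d > 0, HasDerivAt (height R y) d c := by
  obtain ⟨w', hw', hw⟩ := hasDerivAt_upperHeight R y c
  rcases lt_or_ge c Real.pi with hlt | hge
  · obtain ⟨u', hu', hu⟩ := hasDerivAt_lowerHeight (y := y) hR hc hlt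
    have h := hw.sub (HasDerivAt.comp c (hasDerivAt_ramp (upperHeight R y c - lowerHeight R y c))
      (hw.sub hu))
    refine ⟨_, ?_, h.congr_of_eventuallyEq ?_⟩
    · set s := rampSlope (upperHeight R y c - lowerHeight R y c) with hs
      have h0 : 0 ≤ s := Real.smoothTransition.nonneg _
      have h1 : s ≤ 1 := Real.smoothTransition.le_one _
      rcases eq_or_lt_of_le h0 with h0 | h0
      · rw [← h0]; simpa using hw'
      · have := mul_pos h0 hu'
        have := mul_nonneg (sub_nonneg.2 h1) hw'.le
        linarith
    · filter_upwards [eventually_lt_nhds hlt] with t ht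
      rw [height, if_pos ht]
      rfl
  · refine ⟨w', hw', hw.congr_of_eventuallyEq ?_⟩
    have hc : Continuous fun t : ℝ => (R, y, t) := by fun_prop
    exact (hc.tendsto c).eventually (eventually_height_eq hR hge)

theorem contDiffAt_upperHeight {R₀ y₀ : ℝ} (c₀ : ℝ) (hR : 1 ≤ R₀) :
    ContDiffAt ℝ ∞ (fun p : ℝ × ℝ × ℝ => upperHeight p.1 p.2.1 p.2.2) (R₀, y₀, c₀) := by
  have h3 : ContDiff ℝ ∞ fun p : ℝ × ℝ × ℝ => Real.smoothTransition (p.2.2 - 2) :=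
    Real.smoothTransition.contDiff.comp (contDiff_snd.snd.sub contDiff_const)
  have hd : ContDiffAt ℝ ∞ (fun p : ℝ × ℝ × ℝ => p.2.1 / p.1) (R₀, y₀, c₀) :=
    ContDiffAt.div (by fun_prop) (by fun_prop) (by simp only; linarith)
  have ha := Real.contDiff_arctan.contDiffAt.comp (n := ∞) _ hd
  exact ((contDiffAt_const.sub h3.contDiffAt).mul (by fun_prop)).add
    (h3.contDiffAt.mul (ContDiffAt.sub (by fun_prop) ha))

theorem contDiffAt_height {R₀ y₀ c₀ : ℝ} (hR : 1 ≤ R₀) (hc : 0 < c₀) :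
    ContDiffAt ℝ ∞ (fun p : ℝ × ℝ × ℝ => height p.1 p.2.1 p.2.2) (R₀, y₀, c₀) := by
  have hw := contDiffAt_upperHeight (y₀ := y₀) c₀ hR
  rcases lt_or_ge c₀ Real.pi with hlt | hge
  · have hs : 0 < Real.sin c₀ := Real.sin_pos_of_pos_of_lt_pi hc hlt
    have hu : ContDiffAt ℝ ∞ (fun p : ℝ × ℝ × ℝ => lowerHeight p.1 p.2.1 p.2.2) (R₀, y₀, c₀) := by
      have h1 : ContDiffAt ℝ ∞ (fun p : ℝ × ℝ × ℝ => shear p.2.2) (R₀, y₀, c₀) :=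
        ContDiffAt.comp (f := fun p : ℝ × ℝ × ℝ => p.2.2) (g := shear) _
          (contDiffAt_shear hc) (by fun_prop)
      have h2 : ContDiffAt ℝ ∞ (fun p : ℝ × ℝ × ℝ =>
          2 * (1 - p.1 * Real.cos p.2.2) / Real.sin p.2.2) (R₀, y₀, c₀) :=
        ContDiffAt.div (by fun_prop) (by fun_prop) hs.ne'
      exact (h2.sub (by fun_prop)).sub (contDiffAt_const.mul h1)
    refine (hw.sub (contDiff_ramp.contDiffAt.comp _ (hw.sub hu))).congr_of_eventuallyEq ?_
    have hz : ∀ᶠ p : ℝ × ℝ × ℝ in 𝓝 (R₀, y₀, c₀), p.2.2 < Real.pi :=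
      (continuous_snd.snd.tendsto _).eventually (gt_mem_nhds hlt)
    filter_upwards [hz] with p hp
    rw [height, if_pos hp]
    rfl
  · exact hw.congr_of_eventuallyEq (eventually_height_eq hR hge)

theorem height_le_lowerHeight {R y c : ℝ} (hc : c < Real.pi) : height R y c ≤ lowerHeight R y c := by
  rw [height, if_pos hc]
  linarith [le_ramp (upperHeight R y c - lowerHeight R y c)]

/-- For large `c` the height is at least `c - π/2`. For `c ≤ 1` it is at most `2 - 2y - 2/c`; here
`shear` is essential, because for `R = 1` the fraction stays bounded as `c → 0`. -/
theorem bijective_height {R : ℝ} (hR : 1 ≤ R) (y : ℝ) :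
    Function.Bijective fun l => height R y (Real.exp l) := by
  have hd : ∀ l, ∃ d > 0, HasDerivAt (fun l => height R y (Real.exp l)) d l := fun l => by
    obtain ⟨d, h0, h⟩ := hasDerivAt_height (y := y) hR (Real.exp_pos l)
    exact ⟨_, mul_pos h0 (Real.exp_pos l), HasDerivAt.comp l h (Real.hasDerivAt_exp l)⟩
  choose d h0 h using hd
  have hc : Continuous fun l => height R y (Real.exp l) :=
    continuous_iff_continuousAt.2 fun l => (h l).continuousAt
  refine ⟨(strictMono_of_hasDerivAt_pos h h0).injective, hc.surjective ?_ ?_⟩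
  · have h1 : Filter.Tendsto (fun l => Real.exp l - Real.pi / 2) Filter.atTop Filter.atTop :=
      Filter.tendsto_atTop_add_const_right _ _ Real.tendsto_exp_atTop
    refine Filter.tendsto_atTop_mono' _ ?_ h1
    filter_upwards [Real.tendsto_exp_atTop.eventually (Filter.eventually_ge_atTop 4)] with l hl
    have := Real.pi_lt_d2
    rw [height, if_neg (by linarith), upperHeight_of_ge (by linarith)]
    linarith [Real.arctan_lt_pi_div_two (y / R)]
  · have h1 : Filter.Tendsto (fun l => 2 - 2 * y - 2 * Real.exp (-l)) Filter.atBot Filter.atBot := by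
      have := Real.tendsto_exp_atTop.comp Filter.tendsto_neg_atBot_atTop
      exact Filter.tendsto_atBot_add_const_left _ _ (Filter.tendsto_neg_atTop_atBot.comp
        (this.const_mul_atTop two_pos))
    refine Filter.tendsto_atBot_mono' _ ?_ h1
    filter_upwards [Filter.eventually_le_atBot (0 : ℝ)] with l hl
    have hl1 : Real.exp l ≤ 1 := Real.exp_le_one_iff.2 hl
    have hp := Real.exp_pos l
    have := Real.pi_gt_three
    refine (height_le_lowerHeight (by linarith)).trans ?_
    have hs : 0 < Real.sin (Real.exp l) := Real.sin_pos_of_pos_of_lt_pi hp (by linarith)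
    have hcos : 0 < Real.cos (Real.exp l) := Real.cos_pos_of_mem_Ioo ⟨by linarith, by linarith⟩
    rw [lowerHeight, shear_of_le hl1, ← Real.exp_neg]
    have : 2 * (1 - R * Real.cos (Real.exp l)) / Real.sin (Real.exp l) ≤ 2 := by
      rw [div_le_iff₀ hs]
      have e := Real.sin_sq_add_cos_sq (Real.exp l)
      have := mul_le_mul_of_nonneg_right hR hcos.le
      have h5 : 1 ≤ Real.sin (Real.exp l) + Real.cos (Real.exp l) := by
        nlinarith [mul_pos hs hcos]
      linarith
    linarith

end

/-! ### From the trace equation to the plane and the cones -/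

noncomputable section

/-- The condition for `(x, y, z)` to lie on the model surface. -/
def OnSigma (v : ℝ × ℝ × ℝ) : Prop :=
  v.2.2 = 0 ∨ ∃ n : ℕ, v.1 ^ 2 + v.2.1 ^ 2 = Real.tan v.2.2 ^ 2 ∧
    2 * Real.pi * (n + 1) - Real.pi / 2 < v.2.2 ∧ v.2.2 < 2 * Real.pi * (n + 1) + Real.pi / 2

/-- Rounding `φ/(2π)` to the nearest integer; the boundary of the interval is excluded because the
cosine vanishes there. -/
theorem exists_nat_of_cos_pos {φ : ℝ} (h : 0 < Real.cos φ) (hφ : Real.pi / 2 < φ) :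
    ∃ n : ℕ, 2 * Real.pi * (n + 1) - Real.pi / 2 < φ ∧ φ < 2 * Real.pi * (n + 1) + Real.pi / 2 := by
  have hp := Real.pi_pos
  set k := ⌊(φ + Real.pi / 2) / (2 * Real.pi)⌋ with hk
  have h1 : (k : ℝ) * (2 * Real.pi) ≤ φ + Real.pi / 2 :=
    (le_div_iff₀ (by positivity)).1 (Int.floor_le _)
  have h2 : φ + Real.pi / 2 < (k + 1) * (2 * Real.pi) :=
    (div_lt_iff₀ (by positivity)).1 (Int.lt_floor_add_one _)
  have hc : Real.cos (φ - k * (2 * Real.pi)) = Real.cos φ := Real.cos_sub_int_mul_two_pi φ k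
  have h3 : φ - k * (2 * Real.pi) < Real.pi / 2 := by
    by_contra! hle
    have := Real.cos_nonpos_of_pi_div_two_le_of_le hle (by linarith)
    linarith
  have h4 : -(Real.pi / 2) < φ - k * (2 * Real.pi) := by
    refine lt_of_le_of_ne (by linarith) fun he => ?_
    rw [← he, Real.cos_neg, Real.cos_pi_div_two] at hc
    linarith
  have hk1 : 1 ≤ k := by
    by_contra! hlt
    have : (k : ℝ) ≤ 0 := by exact_mod_cast Int.lt_add_one_iff.1 hlt
    nlinarith
  obtain ⟨n, hn⟩ := Int.eq_ofNat_of_zero_le (sub_nonneg.2 hk1)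
  have hkn : (k : ℝ) = n + 1 := by
    have : k = n + 1 := by linarith
    exact_mod_cast this
  rw [hkn] at h3 h4
  exact ⟨n, by linarith, by linarith⟩

/-- For `c < π` the equation says that the lower height vanishes, which is the plane. For `c ≥ π`
the shear is absent and the equation is `M cos φ = 1` with `M² = 1 + x² + y²`, that is `cos φ > 0`
and `tan² φ = x² + y²`. -/
theorem onSigma_height_iff (x y : ℝ) {c : ℝ} (hc : 0 < c) :
    √(1 + x ^ 2) * Real.cos c + (y + shear c) * Real.sin c = 1 ↔
      OnSigma (x, y, height √(1 + x ^ 2) y c) := by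
  have hp := Real.pi_pos
  set R := √(1 + x ^ 2) with hR
  have hR2 : R ^ 2 = 1 + x ^ 2 := Real.sq_sqrt (by positivity)
  have hR0 : 0 < R := Real.sqrt_pos.2 (by positivity)
  rcases lt_or_ge c Real.pi with hlt | hge
  · have hs : 0 < Real.sin c := Real.sin_pos_of_pos_of_lt_pi hc hlt
    obtain ⟨w1, w2⟩ := upperHeight_bounds (R := R) (y := y) hc hlt
    have e : lowerHeight R y c * Real.sin c =
        2 * (1 - (R * Real.cos c + (y + shear c) * Real.sin c)) := by
      rw [lowerHeight]
      field_simp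
      ring
    have i1 : R * Real.cos c + (y + shear c) * Real.sin c = 1 ↔ lowerHeight R y c = 0 := by
      constructor
      · intro h
        rw [h, sub_self, mul_zero] at e
        exact (mul_eq_zero.1 e).resolve_right hs.ne'
      · intro h
        rw [h, zero_mul] at e
        linarith
    rw [i1, ← ramp_eq_iff w1, OnSigma]
    simp only [height, if_pos hlt]
    -- The height is below `3π/2` here, where the first cone begins.
    refine ⟨Or.inl, fun h => h.resolve_right ?_⟩
    rintro ⟨n, -, h2, -⟩
    have := ramp_nonneg (upperHeight R y c - lowerHeight R y c)
    have hn : (0 : ℝ) ≤ n := n.cast_nonneg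
    nlinarith
  · have p3 := Real.pi_gt_three
    rw [shear_of_ge (by linarith), add_zero]
    have hz : height R y c = c - Real.arctan (y / R) := by
      rw [height, if_neg (not_lt.2 hge), upperHeight_of_ge (by linarith)]
    rw [hz]
    set φ := c - Real.arctan (y / R) with hφ
    have hφp : Real.pi / 2 < φ := by linarith [Real.arctan_lt_pi_div_two (y / R)]
    set M := √(R ^ 2 + y ^ 2) with hM
    have hM2 : M ^ 2 = R ^ 2 + y ^ 2 := Real.sq_sqrt (by positivity)
    have hM0 : 0 < M := Real.sqrt_pos.2 (by positivity)
    have hq : √(1 + (y / R) ^ 2) = M / R := by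
      rw [hM, show 1 + (y / R) ^ 2 = (R ^ 2 + y ^ 2) / R ^ 2 by field_simp,
        Real.sqrt_div (by positivity), Real.sqrt_sq hR0.le]
    have hT : R * Real.cos c + y * Real.sin c = M * Real.cos φ := by
      rw [hφ, Real.cos_sub, Real.cos_arctan, Real.sin_arctan, hq]
      field_simp
    rw [hT, OnSigma]
    simp only
    have hne : φ ≠ 0 := by linarith
    have htan : 0 < Real.cos φ → Real.tan φ ^ 2 * Real.cos φ ^ 2 = 1 - Real.cos φ ^ 2 := fun h => by
      rw [Real.tan_eq_sin_div_cos, div_pow, div_mul_cancel₀ _ (by positivity)]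
      linarith [Real.sin_sq_add_cos_sq φ]
    constructor
    · intro h
      have hcos : 0 < Real.cos φ := pos_of_mul_pos_right (by rw [h]; exact one_pos) hM0.le
      obtain ⟨n, h1, h2⟩ := exists_nat_of_cos_pos hcos hφp
      refine Or.inr ⟨n, ?_, h1, h2⟩
      have ht := htan hcos
      have h3 : M ^ 2 * Real.cos φ ^ 2 = 1 := by rw [← mul_pow, h, one_pow]
      have : (x ^ 2 + y ^ 2 - Real.tan φ ^ 2) * Real.cos φ ^ 2 = 0 := by
        rw [hM2, hR2] at h3
        linarith
      have := (mul_eq_zero.1 this).resolve_right (by positivity)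
      linarith
    · rintro (h | ⟨n, h1, h2, h3⟩)
      · exact absurd h hne
      · have hcos : 0 < Real.cos φ := by
          have e : Real.cos (φ - ((n + 1 : ℕ) : ℝ) * (2 * Real.pi)) = Real.cos φ :=
            Real.cos_sub_nat_mul_two_pi φ (n + 1)
          rw [← e]
          push_cast
          exact Real.cos_pos_of_mem_Ioo ⟨by linarith, by linarith⟩
        have ht := htan hcos
        have h4 : (M * Real.cos φ) ^ 2 = 1 := by
          rw [mul_pow, hM2, hR2]
          rw [← h1] at ht
          linarith
        nlinarith [mul_pos hM0 hcos]

theorem exists_straightening : ∃ Ξ : ℝ × ℝ × ℝ ≃ ℝ × ℝ × ℝ, ContDiff ℝ ∞ Ξ ∧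
    ContDiff ℝ ∞ Ξ.symm ∧
    ∀ a b l, Hper.monodromyTrace a b (Real.exp l) = 2 ↔ OnSigma (Ξ (a, b, l)) := by
  have hsh : ContDiff ℝ ∞ fun l => shear (Real.exp l) := contDiff_iff_contDiffAt.2 fun l =>
    (contDiffAt_shear (Real.exp_pos l)).comp l Real.contDiff_exp.contDiffAt
  have hsq : ContDiff ℝ ∞ fun x : ℝ => √(1 + x ^ 2) :=
    (contDiff_const.add (contDiff_id.pow 2)).sqrt fun x => by positivity
  have hR : ∀ x : ℝ, 1 ≤ √(1 + x ^ 2) := fun x => by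
    rw [Real.one_le_sqrt]
    nlinarith
  obtain ⟨Φ, c1, c2, e⟩ := exists_fibre_equiv (E := ℝ × ℝ)
    (f := fun p => height √(1 + p.1.1 ^ 2) p.1.2 (Real.exp p.2))
    (contDiff_iff_contDiffAt.2 fun p => by
      have h := contDiffAt_height (y₀ := p.1.2) (hR p.1.1) (Real.exp_pos p.2)
      have h' : ContDiff ℝ ∞ fun p : (ℝ × ℝ) × ℝ => (√(1 + p.1.1 ^ 2), p.1.2, Real.exp p.2) :=
        (hsq.comp contDiff_fst.fst).prodMk (contDiff_fst.snd.prodMk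
          (Real.contDiff_exp.comp contDiff_snd))
      exact ContDiffAt.comp (f := fun p : (ℝ × ℝ) × ℝ => (√(1 + p.1.1 ^ 2), p.1.2, Real.exp p.2))
        (g := fun p : ℝ × ℝ × ℝ => height p.1 p.2.1 p.2.2) p h h'.contDiffAt)
    (fun x s => by
      obtain ⟨d, h0, h⟩ := hasDerivAt_height (y := x.2) (hR x.1) (Real.exp_pos s)
      exact ⟨_, (mul_pos h0 (Real.exp_pos s)).ne', HasDerivAt.comp s h (Real.hasDerivAt_exp s)⟩)
    (fun x => bijective_height (hR x.1) x.2)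
  -- With these `x`, `y` the trace is `2 (√(1+x²) cos c + (y + shear c) sin c)`. Subtracting `shear`
  -- pushes the first component out over the whole `(x, y)` plane; unsheared it misses the ray `x =
  -- 0`, `y ≤ 0`.
  let A : ℝ × ℝ × ℝ ≃ (ℝ × ℝ) × ℝ :=
    { toFun := fun v => ((Real.sinh (v.1 / 2),
        -(1 / 4) * v.2.1 * Real.exp (-(v.1 / 2)) - shear (Real.exp v.2.2)), v.2.2)
      invFun := fun w => (2 * Real.arsinh w.1.1,
        -4 * (w.1.2 + shear (Real.exp w.2)) * Real.exp (Real.arsinh w.1.1), w.2)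
      left_inv := fun ⟨a, b, l⟩ => by
        simp only [Real.arsinh_sinh]
        refine Prod.ext (by simp only; ring) (Prod.ext ?_ rfl)
        simp only [sub_add_cancel]
        have : Real.exp (-(a / 2)) * Real.exp (a / 2) = 1 := by rw [← Real.exp_add]; simp
        linear_combination b * this
      right_inv := fun ⟨⟨x, y⟩, l⟩ => by
        simp only
        rw [mul_div_cancel_left₀ _ two_ne_zero, Real.sinh_arsinh]
        refine Prod.ext (Prod.ext rfl ?_) rfl
        simp only
        have : Real.exp (Real.arsinh x) * Real.exp (-Real.arsinh x) = 1 := by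
          rw [← Real.exp_add]; simp
        linear_combination (y + shear (Real.exp l)) * this }
  have a1 : ContDiff ℝ ∞ A := by
    have h := hsh.comp (contDiff_snd (𝕜 := ℝ) (E := ℝ) (F := ℝ × ℝ)).snd
    refine ContDiff.prodMk (ContDiff.prodMk ?_ (ContDiff.sub ?_ h)) ?_
    · exact Real.contDiff_sinh.comp (contDiff_fst.div_const 2)
    · exact (contDiff_const.mul contDiff_snd.fst).mul
        (Real.contDiff_exp.comp (contDiff_fst.div_const 2).neg)
    · exact contDiff_snd.snd
  have a2 : ContDiff ℝ ∞ A.symm := by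
    have h := hsh.comp (contDiff_snd (𝕜 := ℝ) (E := ℝ × ℝ) (F := ℝ))
    have h' := Real.contDiff_arsinh.comp (contDiff_fst (𝕜 := ℝ) (n := ∞) (E := ℝ × ℝ) (F := ℝ)).fst
    exact (contDiff_const.mul h').prodMk (((contDiff_const.mul (contDiff_fst.snd.add h)).mul
      (Real.contDiff_exp.comp h')).prodMk contDiff_snd)
  refine ⟨(A.trans Φ).trans (Equiv.prodAssoc ℝ ℝ ℝ), ?_, ?_, fun a b l => ?_⟩
  · have h := c1.comp a1
    exact h.fst.fst.prodMk (h.fst.snd.prodMk h.snd)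
  · refine a2.comp (c2.comp ?_)
    exact (contDiff_fst.prodMk contDiff_snd.fst).prodMk contDiff_snd.snd
  · change _ ↔ OnSigma ((Φ (A (a, b, l))).1.1, (Φ (A (a, b, l))).1.2, (Φ (A (a, b, l))).2)
    rw [e]
    refine Iff.trans ?_ (onSigma_height_iff (Real.sinh (a / 2))
      (-(1 / 4) * b * Real.exp (-(a / 2)) - shear (Real.exp l)) (Real.exp_pos l))
    have hc : √(1 + Real.sinh (a / 2) ^ 2) = Real.cosh (a / 2) := by
      rw [← Real.sqrt_sq (Real.cosh_pos (a / 2)).le, Real.cosh_sq]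
      congr 1
      ring
    rw [hc, show (A (a, b, l)).2 = l from rfl, sub_add_cancel, Hper.monodromyTrace, neg_div]
    constructor <;> intro h <;> linarith

end

noncomputable section

/-! ### Separable Hilbert spaces -/

/-- Distinct vectors are at distance `√2`, so the balls of radius `1/2` about them are disjoint. -/
theorem Orthonormal.countable_of_separable {V : Type*} [NormedAddCommGroup V]
    [InnerProductSpace ℝ V] [TopologicalSpace.SeparableSpace V] {ι : Type*} {v : ι → V}
    (hv : Orthonormal ℝ v) : Countable ι := by
  have hd : ∀ i j, i ≠ j → 1 ≤ dist (v i) (v j) := fun i j hij => by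
    have h : ‖v i - v j‖ ^ 2 = 2 := by
      rw [norm_sub_sq_real, hv.1, hv.1, hv.2 hij]
      norm_num
    rw [dist_eq_norm]
    nlinarith [norm_nonneg (v i - v j)]
  refine Pairwise.countable_of_isOpen_disjoint (s := fun i => Metric.ball (v i) (1 / 2))
    (fun i j hij => ?_) (fun i => Metric.isOpen_ball) fun i => ⟨v i, by simp⟩
  refine Metric.ball_disjoint_ball ?_
  linarith [hd i j hij]

theorem exists_nat_hilbertBasis (V : Type*) [NormedAddCommGroup V] [InnerProductSpace ℝ V]
    [CompleteSpace V] [TopologicalSpace.SeparableSpace V] (hV : ¬ FiniteDimensional ℝ V) :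
    Nonempty (HilbertBasis ℕ ℝ V) := by
  obtain ⟨s, b, -⟩ := exists_hilbertBasis ℝ V
  have hc : Countable s := b.orthonormal.countable_of_separable
  have hi : Infinite s := by
    by_contra hf
    rw [not_infinite_iff_finite] at hf
    have := Fintype.ofFinite s
    exact hV (Module.Finite.of_basis b.toOrthonormalBasis.toBasis)
  obtain ⟨e⟩ := nonempty_equiv_of_countable (α := ℕ) (β := s)
  refine ⟨HilbertBasis.mk (b.orthonormal.comp e e.injective) ?_⟩
  rw [EquivLike.range_comp, b.dense_span]

theorem exists_linearIsometryEquiv (V W : Type*) [NormedAddCommGroup V] [InnerProductSpace ℝ V]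
    [CompleteSpace V] [TopologicalSpace.SeparableSpace V] (hV : ¬ FiniteDimensional ℝ V)
    [NormedAddCommGroup W] [InnerProductSpace ℝ W] [CompleteSpace W]
    [TopologicalSpace.SeparableSpace W] (hW : ¬ FiniteDimensional ℝ W) : Nonempty (V ≃ₗᵢ[ℝ] W) := by
  obtain ⟨b⟩ := exists_nat_hilbertBasis V hV
  obtain ⟨b'⟩ := exists_nat_hilbertBasis W hW
  exact ⟨b.repr.trans b'.repr.symm⟩

/-! ### Separability and infinite dimension of the complementary space -/

namespace Hper

attribute [local instance] normedGroup innerProduct normedSpace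

variable (n : ℕ)

theorem secondCountable : SecondCountableTopology (Hper n) := by
  have : Fact ((2 : ENNReal) ≠ ⊤) := ⟨by simp⟩
  have : SecondCountableTopology (PiLp 2 fun _ : Fin (n + 1) => L2Circle) := inferInstance
  exact TopologicalSpace.Subtype.secondCountableTopology _

theorem secondCountable_flatSpace : SecondCountableTopology (FlatSpace n) :=
  have := secondCountable n
  TopologicalSpace.Subtype.secondCountableTopology (flat n : Set (Hper n))

instance : SecondCountableTopology (FlatPerp n) :=
  have := secondCountable n
  TopologicalSpace.Subtype.secondCountableTopology (((flat n)ᗮ : Submodule ℝ (Hper n)) : Set (Hper n))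

instance : SecondCountableTopology (FlatRest n) :=
  have := secondCountable_flatSpace n
  TopologicalSpace.Subtype.secondCountableTopology
    (((ℝ ∙ flatBump n)ᗮ : Submodule ℝ (FlatSpace n)) : Set (FlatSpace n))

theorem exists_polynomial_bump (P : Polynomial ℝ) : ∃ u : FlatSpace n,
    val u.toHper =ᵐ[circleMeasure] fun t => (Polynomial.X * P).eval t * bump t :=
  exists_flat_mul_bump n (by
    simpa only [Polynomial.coe_aeval_eq_eval] using Polynomial.contDiff_aeval (R := ℝ) (𝕜 := ℝ) (Polynomial.X * P) ∞)

theorem FlatSpace.ext_ae {u v : FlatSpace n} (h : val u.toHper =ᵐ[circleMeasure] val v.toHper) :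
    u = v :=
  Subtype.ext (Hper.ext_ae ((val_ae _).symm.trans (h.trans (val_ae _))))

theorem FlatSpace.val_add_ae (u v : FlatSpace n) : val (u + v).toHper =ᵐ[circleMeasure]
    fun t => val u.toHper t + val v.toHper t := Hper.val_add_ae u.toHper v.toHper

theorem FlatSpace.val_smul_ae (c : ℝ) (u : FlatSpace n) : val (c • u).toHper =ᵐ[circleMeasure]
    fun t => c * val u.toHper t := Hper.val_smul_ae c u.toHper

/-- The multiples of `bump` by polynomials without constant term. -/
def polynomialBump : Polynomial ℝ →ₗ[ℝ] FlatSpace n where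
  toFun P := (exists_polynomial_bump n P).choose
  map_add' P Q := by
    refine FlatSpace.ext_ae n ?_
    filter_upwards [(exists_polynomial_bump n (P + Q)).choose_spec,
      (exists_polynomial_bump n P).choose_spec, (exists_polynomial_bump n Q).choose_spec,
      FlatSpace.val_add_ae n (exists_polynomial_bump n P).choose
        (exists_polynomial_bump n Q).choose] with t h1 h2 h3 h4
    rw [h1, h4, h2, h3, mul_add, Polynomial.eval_add, add_mul]
  map_smul' c P := by
    refine FlatSpace.ext_ae n ?_
    filter_upwards [(exists_polynomial_bump n (c • P)).choose_spec,
      (exists_polynomial_bump n P).choose_spec,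
      FlatSpace.val_smul_ae n c (exists_polynomial_bump n P).choose] with t h1 h2 h3
    rw [h1, RingHom.id_apply, h3, h2, mul_smul_comm, Polynomial.eval_smul, smul_eq_mul, mul_assoc]

theorem polynomialBump_eq (P : Polynomial ℝ) : EqOn (val (polynomialBump (n + 1) P).toHper)
    (fun t => (Polynomial.X * P).eval t * bump t) (Icc 0 (2 * Real.pi)) :=
  eqOn_circle_of_ae (isPrimitive_val _).continuousOn
    ((Polynomial.continuous _).mul contDiff_bump.continuous).continuousOn
    (exists_polynomial_bump (n + 1) P).choose_spec

/-- The factor `X` excludes nonzero constants, so these functions meet the line spanned by `bump`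
only in zero. -/
theorem eq_zero_of_polynomialBump {P : Polynomial ℝ} {r : ℝ}
    (h : r • flatBump (n + 1) = polynomialBump (n + 1) P) : P = 0 := by
  have hp : ∀ t ∈ Ioo 0 (2 * Real.pi), (Polynomial.X * P).eval t = (Polynomial.C r).eval t := by
    intro t ht
    have ht' := Ioo_subset_Icc_self ht
    have h1 : val (r • flatBump (n + 1)).toHper t = r * val (flatBump (n + 1)).toHper t :=
      val_smul r (flatBump (n + 1)).toHper ht'
    rw [h, polynomialBump_eq n P ht', val_flatBump ht'] at h1
    rw [Polynomial.eval_C]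
    exact mul_right_cancel₀ (bump_pos ht).ne' h1
  have he : Polynomial.X * P = Polynomial.C r :=
    Polynomial.eq_of_infinite_eval_eq _ _ ((Ioo_infinite (by positivity)).mono hp)
  have hr : r = 0 := by simpa using (congrArg (Polynomial.eval 0) he).symm
  rw [hr, Polynomial.C_0] at he
  exact (mul_eq_zero.1 he).resolve_left Polynomial.X_ne_zero

/-- Projecting away from `bump` is therefore injective on an infinite-dimensional space of
polynomials. -/
theorem not_finiteDimensional_flatRest : ¬ FiniteDimensional ℝ (FlatRest (n + 1)) := fun hf => by
  let K : Submodule ℝ (FlatSpace (n + 1)) := (ℝ ∙ flatBump (n + 1))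
  let L : Polynomial ℝ →ₗ[ℝ] (Kᗮ : Submodule ℝ (FlatSpace (n + 1))) :=
    (Kᗮ.orthogonalProjectionOnto : FlatSpace (n + 1) →ₗ[ℝ] Kᗮ) ∘ₗ polynomialBump (n + 1)
  have hL : Function.Injective L := by
    rw [← LinearMap.ker_eq_bot, LinearMap.ker_eq_bot']
    intro P hP
    have hm := K.sub_projOrthogonal_mem (polynomialBump (n + 1) P)
    have h0 : Kᗮ.orthogonalProjectionOnto (polynomialBump (n + 1) P) = 0 := hP
    rw [h0, Submodule.coe_zero, sub_zero] at hm
    obtain ⟨r, hr⟩ := Submodule.mem_span_singleton.1 hm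
    exact eq_zero_of_polynomialBump n hr
  have hf' : FiniteDimensional ℝ (Kᗮ : Submodule ℝ (FlatSpace (n + 1))) := hf
  have : Module.Finite ℝ (Polynomial ℝ) := Module.Finite.of_injective L hL
  exact not_finite_iff_infinite.2 (inferInstance : Infinite ℕ)
    (Module.Finite.finite_basis (Polynomial.basisMonomials ℝ))

theorem not_finiteDimensional_rest : ¬ FiniteDimensional ℝ (Rest n) := fun hf => by
  refine not_finiteDimensional_flatRest (n + 2) ?_
  refine Module.Finite.of_injective (M := FlatRest (n + 3)) (N := Rest n)
    ((WithLp.linearEquiv 2 ℝ (FlatPerp (n + 1) × FlatRest (n + 3))).symm.toLinearMap ∘ₗ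
      LinearMap.inr ℝ (FlatPerp (n + 1)) (FlatRest (n + 3))) ?_
  exact (WithLp.linearEquiv 2 ℝ (FlatPerp (n + 1) × FlatRest (n + 3))).symm.injective.comp
    LinearMap.inr_injective

end Hper
end

noncomputable section

/-! ### Coordinates on `G₀` -/

namespace SLCover

theorem coord_iwasawa (x : ℝ × Ioi (0 : ℝ) × ℝ) : coord (iwasawa x) = (x.1, (x.2.1 : ℝ), x.2.2) := by
  simp [coord]

theorem iwasawa_mem_G₀ {x : ℝ × Ioi (0 : ℝ) × ℝ} : iwasawa x ∈ G₀ ↔ 0 < x.1 :=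
  ⟨fun ⟨y, hy, h⟩ => by rwa [← iwasawa.injective h], fun h => ⟨x, h, rfl⟩⟩

theorem trace_iwasawa (x : ℝ × Ioi (0 : ℝ) × ℝ) : trace (iwasawa x) =
    Real.cos x.1 * √x.2.1 + Real.sin x.1 * (1 / √x.2.1) * (x.2.2 / 2) +
      Real.cos x.1 * (1 / √x.2.1) := by
  change Matrix.trace (iwasawaMatrix _ _ _) = _
  rw [iwasawaMatrix_eq, Matrix.trace_fin_two]
  simp

theorem contMDiff_coord : ContMDiff 𝓘(ℝ, ℝ × ℝ × ℝ) 𝓘(ℝ, ℝ × ℝ × ℝ) ∞ coord :=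
  contMDiff_isOpenEmbedding isOpenEmbedding_coord

/-- The point of `G` with coordinates `c = e^l`, `ρ = e^{-a}`, `ν = -b e^{-a}`. -/
def ofReal (v : ℝ × ℝ × ℝ) : SLCover :=
  iwasawa (Real.exp v.2.2, ⟨Real.exp (-v.1), Real.exp_pos _⟩, -v.2.1 * Real.exp (-v.1))

theorem coord_ofReal (v : ℝ × ℝ × ℝ) :
    coord (ofReal v) = (Real.exp v.2.2, Real.exp (-v.1), -v.2.1 * Real.exp (-v.1)) :=
  coord_iwasawa _

theorem contMDiff_ofReal : ContMDiff 𝓘(ℝ, ℝ × ℝ × ℝ) 𝓘(ℝ, ℝ × ℝ × ℝ) ∞ ofReal := by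
  refine ContMDiff.of_comp_isOpenEmbedding isOpenEmbedding_coord ?_
  have : coord ∘ ofReal = fun v : ℝ × ℝ × ℝ =>
      (Real.exp v.2.2, Real.exp (-v.1), -v.2.1 * Real.exp (-v.1)) := funext coord_ofReal
  rw [this, contMDiff_iff_contDiff]
  fun_prop

/-- The monodromy is a lower triangular unipotent times `diag(e^{-a/2}, e^{a/2})` times a rotation
by `c`. Cycling the rotation to the front preserves the trace, and moving the unipotent past the
diagonal turns `-b` into `ν = -b e^{-a}`. -/
theorem trace_ofReal (v : ℝ × ℝ × ℝ) :
    trace (ofReal v) = Hper.monodromyTrace v.1 v.2.1 (Real.exp v.2.2) := by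
  rw [ofReal, trace_iwasawa, Hper.monodromyTrace, Real.cosh_eq]
  simp only
  have h : √(Real.exp (-v.1)) = Real.exp (-v.1 / 2) := (Real.exp_half _).symm
  have h1 : 1 / Real.exp (-v.1 / 2) = Real.exp (v.1 / 2) := by
    rw [one_div, ← Real.exp_neg]
    congr 1
    ring
  have h2 : Real.exp (v.1 / 2) * Real.exp (-v.1) = Real.exp (-v.1 / 2) := by
    rw [← Real.exp_add]
    congr 1
    ring
  rw [h, h1, neg_div] at *
  linear_combination (-v.2.1 / 2 * Real.sin (Real.exp v.2.2)) * h2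

/-- The real coordinates `(a, b, log c)` on `G₀`. -/
def toReal (g : G₀) : ℝ × ℝ × ℝ :=
  (-Real.log (coord g.1).2.1, -(coord g.1).2.2 / (coord g.1).2.1, Real.log (coord g.1).1)

theorem coord_pos (g : G₀) : 0 < (coord g.1).1 ∧ 0 < (coord g.1).2.1 := by
  obtain ⟨x, hx, h⟩ := g.2
  rw [← h, coord_iwasawa]
  exact ⟨hx, x.2.1.2⟩

theorem contMDiff_toReal : ContMDiff 𝓘(ℝ, ℝ × ℝ × ℝ) 𝓘(ℝ, ℝ × ℝ × ℝ) ∞ toReal := by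
  have h : ContMDiff 𝓘(ℝ, ℝ × ℝ × ℝ) 𝓘(ℝ, ℝ × ℝ × ℝ) ∞ fun g : G₀ => coord g.1 :=
    contMDiff_coord.comp contMDiff_subtype_val
  intro g
  obtain ⟨h1, h2⟩ := coord_pos g
  have hc : ContDiffAt ℝ ∞ (fun v : ℝ × ℝ × ℝ => (-Real.log v.2.1, -v.2.2 / v.2.1, Real.log v.1))
      (coord g.1) := by
    refine ContDiffAt.prodMk (ContDiffAt.neg (ContDiffAt.log ?_ h2.ne')) (ContDiffAt.prodMk
      (ContDiffAt.div ?_ ?_ h2.ne') (ContDiffAt.log ?_ h1.ne')) <;> fun_prop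
  exact hc.contMDiffAt.comp g (h g)

/-- The diffeomorphism from `G₀` to `ℝ³` given by the coordinates `(a, b, log c)`. -/
def realDiffeomorph : G₀ ≃ₘ⟮𝓘(ℝ, ℝ × ℝ × ℝ), 𝓘(ℝ, ℝ × ℝ × ℝ)⟯ (ℝ × ℝ × ℝ) where
  toFun := toReal
  invFun v := ⟨ofReal v, iwasawa_mem_G₀.2 (Real.exp_pos _)⟩
  left_inv g := by
    obtain ⟨h1, h2⟩ := coord_pos g
    refine Subtype.ext (isOpenEmbedding_coord.injective ?_)
    simp only [coord_ofReal, toReal, neg_neg, Real.exp_log h1, Real.exp_log h2]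
    refine Prod.ext rfl (Prod.ext rfl ?_)
    simp only
    field_simp
  right_inv v := by
    have h : Real.exp (-v.1) ≠ 0 := (Real.exp_pos _).ne'
    simp only [toReal, coord_ofReal, Real.log_exp, neg_neg]
    refine Prod.ext rfl (Prod.ext ?_ rfl)
    simp only
    field_simp
  contMDiff_toFun := contMDiff_toReal
  contMDiff_invFun := (ContMDiff.subtypeVal_comp_iff _ _).1 contMDiff_ofReal

theorem trace_eq_monodromyTrace (g : G₀) : trace g.1 = Hper.monodromyTrace (realDiffeomorph g).1
    (realDiffeomorph g).2.1 (Real.exp (realDiffeomorph g).2.2) := by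
  rw [← trace_ofReal]
  exact congrArg (fun g : G₀ => trace g.1) (realDiffeomorph.symm_apply_apply g).symm

end SLCover

/-! ### Assembling the diffeomorphisms -/

theorem mem_SigmaSet_iff (v : EuclideanSpace ℝ (Fin 3)) :
    v ∈ SigmaSet ↔ OnSigma (v 0, v 1, v 2) := by
  rw [SigmaSet, mem_iUnion, OnSigma]
  constructor
  · rintro ⟨n, hn⟩
    cases n with
    | zero => exact Or.inl hn
    | succ n => exact Or.inr ⟨n, hn⟩
  · rintro (h | ⟨n, h⟩)
    · exact ⟨0, h⟩
    · exact ⟨n + 1, h⟩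

/-- The triple of coordinates of a point of `ℝ³`. -/
def euclideanTriple : EuclideanSpace ℝ (Fin 3) ≃ ℝ × ℝ × ℝ where
  toFun v := (v 0, v 1, v 2)
  invFun x := !₂[x.1, x.2.1, x.2.2]
  left_inv v := by ext i; fin_cases i <;> rfl
  right_inv x := rfl

theorem contDiff_euclideanTriple : ContDiff ℝ ∞ euclideanTriple := by
  have h : ∀ i, ContDiff ℝ ∞ fun v : EuclideanSpace ℝ (Fin 3) => v i := fun i =>
    contDiff_piLp_apply 2
  exact (h 0).prodMk ((h 1).prodMk (h 2))

theorem contDiff_euclideanTriple_symm : ContDiff ℝ ∞ euclideanTriple.symm := by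
  rw [contDiff_piLp 2]
  intro i
  fin_cases i
  · exact contDiff_fst
  · exact contDiff_snd.fst
  · exact contDiff_snd.snd

namespace Hper

attribute [local instance] normedGroup innerProduct normedSpace

theorem exists_model (m : ℕ) (hp : 2 ≤ m + 2) (H : Type*) [NormedAddCommGroup H]
    [InnerProductSpace ℝ H] [CompleteSpace H] [TopologicalSpace.SeparableSpace H]
    (hH : ¬ FiniteDimensional ℝ H) : ∃ Φ : (ℝ × ℝ × ℝ) × H ≃ Hper (m + 2),
      ContDiff ℝ ∞ Φ ∧ ContDiff ℝ ∞ Φ.symm ∧ ∀ x : (ℝ × ℝ × ℝ) × H,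
        Φ x ∈ criticalSet (sturmLiouville (m + 2) hp) ↔
          monodromyTrace x.1.1 x.1.2.1 (Real.exp x.1.2.2) = 2 := by
  obtain ⟨Φ, h1, h2, h3⟩ := exists_realCoordEquiv (m + 1)
  obtain ⟨e⟩ := exists_linearIsometryEquiv (Rest (m + 1)) H (not_finiteDimensional_rest (m + 1)) hH
  let A : (ℝ × ℝ × ℝ) × Rest (m + 1) ≃ (ℝ × ℝ × ℝ) × H := (Equiv.refl _).prodCongr e.toEquiv
  refine ⟨(Φ.trans A).symm, ?_, ?_, fun x => ?_⟩
  · exact h2.comp (contDiff_fst.prodMk (e.symm.contDiff.comp contDiff_snd))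
  · exact contDiff_fst.prodMk (e.contDiff.comp contDiff_snd) |>.comp h1
  · have hx : x.1 = (Φ (Φ.symm (A.symm x))).1 := by
      rw [Φ.apply_symm_apply]
      rfl
    rw [mem_criticalSet_iff]
    change _ ↔ monodromyTrace x.1.1 x.1.2.1 (Real.exp x.1.2.2) = 2
    rw [hx, h3, Real.exp_log (totalAngle_pos _)]
    rfl

end Hper

end

/-! ### Diffeomorphisms of pairs -/

noncomputable section

namespace Hper

theorem exists_diffeomorph_of_equiv {X H B M V : Type*} [NormedAddCommGroup X] [NormedSpace ℝ X]
    [NormedAddCommGroup H] [NormedSpace ℝ H] [NormedAddCommGroup B] [NormedSpace ℝ B]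
    [NormedAddCommGroup V] [NormedSpace ℝ V] [TopologicalSpace M] [ChartedSpace B M]
    (D : M ≃ₘ⟮𝓘(ℝ, B), 𝓘(ℝ, V)⟯ V) {Φ : V × H ≃ X}
    (h1 : ContDiff ℝ ∞ Φ) (h2 : ContDiff ℝ ∞ Φ.symm) {S : Set M} {C : Set X}
    (h3 : ∀ x, x.1 ∈ D '' S ↔ Φ x ∈ C) :
    ∃ Ψ : (M × H) ≃ₘ⟮(𝓘(ℝ, B)).prod 𝓘(ℝ, H), 𝓘(ℝ, X)⟯ X, Ψ '' (S ×ˢ (univ : Set H)) = C := by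
  refine ⟨{ toEquiv := (D.toEquiv.prodCongr (Equiv.refl H)).trans Φ
            contMDiff_toFun := ?_
            contMDiff_invFun := ?_ }, ?_⟩
  · exact h1.contMDiff.comp ((D.contMDiff_toFun.comp contMDiff_fst).prodMk_space contMDiff_snd)
  · exact (D.contMDiff_invFun.comp (contDiff_fst.comp h2).contMDiff).prodMk
      (contDiff_snd.comp h2).contMDiff
  · ext q
    constructor
    · rintro ⟨⟨x, w⟩, ⟨hx, -⟩, rfl⟩
      exact (h3 (D x, w)).1 ⟨x, hx, rfl⟩
    · intro hq
      rw [← Φ.apply_symm_apply q] at hq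
      obtain ⟨x, hx, e⟩ := (h3 _).2 hq
      refine ⟨(x, (Φ.symm q).2), ⟨hx, mem_univ _⟩, ?_⟩
      change Φ (D x, (Φ.symm q).2) = q
      rw [e]
      exact Φ.apply_symm_apply q

/-- Both models reduce to this: any manifold with a chart onto `(a, b, log c)`-space in which the
marked subset is the level 2 of the trace. -/
theorem exists_diffeomorph (p : ℕ) (hp : 2 ≤ p)
    {H : Type*} [NormedAddCommGroup H] [InnerProductSpace ℝ H] [CompleteSpace H]
    [TopologicalSpace.SeparableSpace H] (hH : ¬ FiniteDimensional ℝ H)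
    {B M : Type*} [NormedAddCommGroup B] [NormedSpace ℝ B] [TopologicalSpace M] [ChartedSpace B M]
    (D : M ≃ₘ⟮𝓘(ℝ, B), 𝓘(ℝ, ℝ × ℝ × ℝ)⟯ (ℝ × ℝ × ℝ)) {S : Set M}
    (hS : ∀ x, x ∈ S ↔ monodromyTrace (D x).1 (D x).2.1 (Real.exp (D x).2.2) = 2) :
    ∃ Ψ : (M × H) ≃ₘ⟮(𝓘(ℝ, B)).prod 𝓘(ℝ, H), 𝓘(ℝ, Hper p)⟯ (Hper p),
      Ψ '' (S ×ˢ (univ : Set H)) = criticalSet (sturmLiouville p hp) := by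
  obtain ⟨m, rfl⟩ := Nat.exists_eq_add_of_le' hp
  obtain ⟨Φ, h1, h2, h3⟩ := exists_model m hp H hH
  refine exists_diffeomorph_of_equiv D h1 h2 fun x => ?_
  rw [h3]
  constructor
  · rintro ⟨y, hy, e⟩
    rw [← e]
    exact (hS y).1 hy
  · intro hx
    refine ⟨D.symm x.1, (hS _).2 ?_, D.apply_symm_apply _⟩
    rwa [D.apply_symm_apply]

theorem exists_euclidean_coordinates :
    ∃ D : EuclideanSpace ℝ (Fin 3) ≃ₘ⟮𝓘(ℝ, EuclideanSpace ℝ (Fin 3)), 𝓘(ℝ, ℝ × ℝ × ℝ)⟯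
      (ℝ × ℝ × ℝ), ∀ x, x ∈ SigmaSet ↔
        monodromyTrace (D x).1 (D x).2.1 (Real.exp (D x).2.2) = 2 := by
  obtain ⟨Ξ, h1, h2, h3⟩ := exists_straightening
  refine ⟨{ toEquiv := euclideanTriple.trans Ξ.symm
            contMDiff_toFun := (h2.comp contDiff_euclideanTriple).contMDiff
            contMDiff_invFun := (contDiff_euclideanTriple_symm.comp h1).contMDiff }, fun x => ?_⟩
  rw [mem_SigmaSet_iff]
  refine Iff.trans ?_ (h3 _ _ _).symm
  change OnSigma (euclideanTriple x) ↔ OnSigma (Ξ (Ξ.symm (euclideanTriple x)))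
  rw [Ξ.apply_symm_apply]

end Hper

end


theorem mainTheorem5 (p : ℕ) (hp : 2 ≤ p)
    {H : Type*} [NormedAddCommGroup H] [InnerProductSpace ℝ H] [CompleteSpace H]
    [TopologicalSpace.SeparableSpace H] (hH : ¬ FiniteDimensional ℝ H) :
    (∃ Ψ : (SLCover.G₀ × H) ≃ₘ⟮(𝓘(ℝ, ℝ × ℝ × ℝ)).prod 𝓘(ℝ, H), 𝓘(ℝ, Hper p)⟯ (Hper p),
      Ψ '' (SLCover.traceLevel 2 ×ˢ (univ : Set H)) = criticalSet (sturmLiouville p hp)) ∧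
    (∃ Ψ : (EuclideanSpace ℝ (Fin 3) × H) ≃ₘ⟮(𝓘(ℝ, EuclideanSpace ℝ (Fin 3))).prod 𝓘(ℝ, H),
        𝓘(ℝ, Hper p)⟯ (Hper p),
      Ψ '' (SigmaSet ×ˢ (univ : Set H)) = criticalSet (sturmLiouville p hp)) :=
  ⟨Hper.exists_diffeomorph p hp hH SLCover.realDiffeomorph fun g => by
    rw [← SLCover.trace_eq_monodromyTrace]; rfl,
    have ⟨D, hD⟩ := Hper.exists_euclidean_coordinates
    Hper.exists_diffeomorph p hp hH D hD⟩
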